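/- Let $n\ge 1$, let $\Pi$ be a set of permutations of $[n]=\{1,\dots,n\}$ and let $I=(I_0,I_1)$ be a pair of subsets of $[n]$ (initial fixings: $I_b$ is the set of entries fixed to $b$). Put $F(I)=\{x\in\{0,1\}^n : x_i=b \text{ for } b\in\{0,1\},\, i\in I_b\}$, $\gamma(x)_i=x_{\gamma^{-1}(i)}$, $X_\gamma=\{x\in\{0,1\}^n : x\succeq\gamma(x)\}$ with $\succeq$ the lexicographic order, and $X_\Pi=\bigcap_{\gamma\in\Pi}X_\gamma$. A fixing $(i,b)\in[n]\times\{0,1\}$ is valid for $\gamma$ and $I$ if $x_i=b$ for all $x\in X_\gamma\cap F(I)$; it is applied by adding $i$ to $I_b$; and $I$ is complete for $\gamma$ if $i\in I_b$ for every valid $(i,b)$. For $k\ge1$ write $x=_k y$ if $x_i=y_i$ for all $i<k$; $x\succ_k y$ if $x=_i y$ and $x_i>y_i$ for some $i<k$; and $x\preceq_k y$ if $x=_k y$ or $y\succ_k x$. A conjunction is a set $C$ of fixings, $V(C)$ is the set of binary vectors respecting it. $C$ is a $k$-inf-conjunction of $\gamma$ (for $I$) if $x\prec_k\gamma(x)$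 for all $x\in F(I)\cap V(C)$, and a $k$-eq-conjunction if $x\preceq_k\gamma(x)$ for all these $x$ and $x=_k\gamma(x)$ for at least one of them. **Algorithm 1.** If $F(I)=\emptyset$, return Infeasible. Set $i_\gamma=1$ for all $\gamma\in\Pi$. While some $\gamma\in\Pi$ does not satisfy the sufficient conditions for completeness, choose such a $\gamma$, increase $i_\gamma$ by one, and repeat the following: if $\emptyset$ is an $i_\delta$-inf-conjunction for some $\delta\in\Pi$, return Infeasible; else if for some $\delta\in\Pi$ there is an $i_\delta$-inf-conjunction $\{(i,b)\}$ with $i\notin I_{1-b}$, apply the fixing $(i,1-b)$; else leave the inner loop. After the while-loop return Feasible and the current $(I_0,I_1)$. Here sufficient conditions for completeness are any conditions on the state and $\gamma$ that imply, whenever neither test of the inner loop succeeds, that the current fixings are complete for $\gamma$. The concrete conditions are: (P1) there is no $i_\gamma$-eq-conjunction of $\gamma$; or (P2) $i_\gamma>n$; or (P3) $\emptyset$ is not an $i_\gamma$-eq-conjunction, $i_\gamma\notin I_0$, $\gamma^{-1}(i_\gamma)\notin I_1$, $\gamma(i_\gamma)>i_\gamma$ and $\gamma^{-1}(i_\gamma)>i_\gamma$.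 An output is called correct if one of the following holds. * It is Infeasible, $X_\Pi\cap F(I)=\emptyset$, and either $F(I)=\emptyset$ or, after applying a sequence of fixings to $I$, each valid for a single permutation in $\Pi$ and the fixings present at that moment, one obtains $J$ with $X_\delta\cap F(J)=\emptyset$ for some $\delta\in\Pi$. * It is Feasible with fixings $J\supseteq I$ that arise from $I$ by applying such a sequence of valid fixings, with $X_\Pi\cap F(J)=X_\Pi\cap F(I)$ and $F(J)\ne\emptyset$; for every $\gamma\in\Pi$, $X_\gamma\cap F(J)\neq\emptyset$ and $J$ is complete for $\gamma$; and $J$ is the smallest pair $J\supseteq I$ that is complete for every $\gamma\in\Pi$. **Theorem.** 1. For any sufficient conditions for completeness, whenever an execution of Algorithm 1 terminates, its output is correct. 2. With the conditions (P1)–(P3), every execution of Algorithm 1 has at most $2n|\Pi|+n+1$ steps (selections of a permutation with the index increase, applications of a fixing, exits from the inner loop, returns), and every output is correct. 3. Let $\Pi\neq\emptyset$. The implementation of Algorithm 1 with the implication-tree data structure runs in $O(n|\Pi|)$ time: there is a constant $K$ such that, for all $n$, $\Pi$ (given by the tables of its permutations, in any order) and $I$, this implementation halts after at most $K\,n\,|\Pi|$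 steps, its output is one that Algorithm 1 with the conditions (P1)–(P3) returns for $\Pi$ and $I$, and it is correct. The implementation is an explicit program for a unit-cost random access machine with registers and two-dimensional arrays (initially zero outside the input), whose operations are reading, writing, comparisons, Boolean connectives, and adding or subtracting one. For each permutation it stores an implication tree as at most two paths from the root, kept in arrays, with conditional fixing vertices, necessary fixing vertices and loose end vertices; it updates the trees at each index increase and each fixing, and keeps a stack of the fixings that must be applied. -/

import Mathlib

/-!  Binary vectors, lexicographic orders and sets of fixings.

Entry `i` of the index set `{1, ..., n}` is the element of `Fin n` with value `i - 1`.
The values 0 and 1 of binary entries are `false` and `true`, with `false < true`. -/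

namespace Symresack

/-- Binary vectors of length `n`. -/
abbrev Vec (n : ℕ) := Fin n → Bool

/-- The permuted vector: `γ(x)` has the entry `x (γ⁻¹ i)` at position `i`. -/
def permute {n : ℕ} (γ : Equiv.Perm (Fin n)) (x : Vec n) : Vec n := fun i => x (γ.symm i)

/-- `x =_k y`: equality at the (1-based) positions `1, ..., k - 1`. -/
def EqUpTo {n : ℕ} (k : ℕ) (x y : Vec n) : Prop := ∀ i : Fin n, i.val + 1 < k → x i = y i

/-- `x ≻_k y`: at one of the positions `1, ..., k - 1` the vector `x` is larger than `y`, and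
before that position they agree. -/
def GtUpTo {n : ℕ} (k : ℕ) (x y : Vec n) : Prop :=
  ∃ i : Fin n, i.val + 1 < k ∧ EqUpTo (i.val + 1) x y ∧ y i < x i

/-- `x ⪰_k y`. -/
def GeUpTo {n : ℕ} (k : ℕ) (x y : Vec n) : Prop := EqUpTo k x y ∨ GtUpTo k x y

/-- The binary vectors with `x ⪰ γ(x)` (the full lexicographic order is the one up to `n + 1`). -/
def X {n : ℕ} (γ : Equiv.Perm (Fin n)) : Set (Vec n) := {x | GeUpTo (n + 1) x (permute γ x)}

/-- The binary vectors with `x ⪰ γ(x)` for all `γ` in `P`. -/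
def XAll {n : ℕ} (P : Finset (Equiv.Perm (Fin n))) : Set (Vec n) := {x | ∀ γ ∈ P, x ∈ X γ}

/-- A pair `(I₀, I₁)` of sets of entries: `I b` is the set of entries that are fixed to `b`.
The order is inclusion in both components. -/
abbrev Fixings (n : ℕ) := Bool → Finset (Fin n)

/-- The vectors that respect the fixings. -/
def F {n : ℕ} (I : Fixings n) : Set (Vec n) := {x | ∀ b, ∀ i ∈ I b, x i = b}

/-- Apply the fixing `(i, b)`: add `i` to `I b`. -/
def applyFixing {n : ℕ} (I : Fixings n) (f : Fin n × Bool) : Fixings n :=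
  Function.update I f.2 (insert f.1 (I f.2))

/-- The fixing `f` is valid for the constraint `x ⪰ γ(x)` and the fixings `I`. -/
def Valid {n : ℕ} (γ : Equiv.Perm (Fin n)) (I : Fixings n) (f : Fin n × Bool) : Prop :=
  ∀ x ∈ X γ ∩ F I, x f.1 = f.2

/-- `I` is complete for the constraint `x ⪰ γ(x)`: every valid fixing is already in `I`. -/
def Complete {n : ℕ} (γ : Equiv.Perm (Fin n)) (I : Fixings n) : Prop :=
  ∀ f : Fin n × Bool, Valid γ I f → f.1 ∈ I f.2

/-- `J` arises from `I` by applying, one after the other, fixings that are each valid for a single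
permutation in `P` and the fixings present at that moment. -/
def Derives {n : ℕ} (P : Finset (Equiv.Perm (Fin n))) : Fixings n → Fixings n → Prop :=
  Relation.ReflTransGen fun I J => ∃ γ ∈ P, ∃ f, Valid γ I f ∧ J = applyFixing I f

/-! Conjunctions. -/

/-- The vectors that respect the fixings in the conjunction `C`. -/
def V {n : ℕ} (C : Finset (Fin n × Bool)) : Set (Vec n) := {x | ∀ f ∈ C, x f.1 = f.2}

/-- `C` is a `k`-inf-conjunction of `γ` for the fixings `I`: `x ≺_k γ(x)` for all `x` that respect
`I` and `C`. -/
def InfConj {n : ℕ} (γ : Equiv.Perm (Fin n)) (I : Fixings n) (k : ℕ)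
    (C : Finset (Fin n × Bool)) : Prop :=
  ∀ x ∈ F I ∩ V C, GtUpTo k (permute γ x) x

/-- `C` is a `k`-eq-conjunction of `γ` for the fixings `I`: `x ⪯_k γ(x)` for all `x` that respect
`I` and `C`, with `x =_k γ(x)` for at least one of them. -/
def EqConj {n : ℕ} (γ : Equiv.Perm (Fin n)) (I : Fixings n) (k : ℕ)
    (C : Finset (Fin n × Bool)) : Prop :=
  (∀ x ∈ F I ∩ V C, GeUpTo k (permute γ x) x) ∧ ∃ x ∈ F I ∩ V C, EqUpTo k x (permute γ x)

/-- The set of inclusionwise minimal `k`-eq-conjunctions. -/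
def minEqConj {n : ℕ} (γ : Equiv.Perm (Fin n)) (I : Fixings n) (k : ℕ) :
    Set (Finset (Fin n × Bool)) := {C | Minimal (EqConj γ I k) C}

/-! The propagation algorithm, as a nondeterministic transition system. -/

/-- What the algorithm returns. -/
inductive Output (n : ℕ) where
  | infeasible : Output n
  | feasible (I : Fixings n) : Output n

/-- The variables of the algorithm: the fixings, and an index `i_γ` for every permutation. -/
structure State (n : ℕ) where
  fixings : Fixings n
  idx : Equiv.Perm (Fin n) → ℕ

/-- The algorithm is at the head of the outer while-loop, at the head of the inner repeat-loop, or
it has returned. -/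
inductive Config (n : ℕ) where
  | outer (s : State n) : Config n
  | inner (s : State n) : Config n
  | done (o : Output n) : Config n

/-- Some permutation has the empty conjunction as an `i_δ`-inf-conjunction. -/
def HasEmptyConj {n : ℕ} (P : Finset (Equiv.Perm (Fin n))) (s : State n) : Prop :=
  ∃ δ ∈ P, InfConj δ s.fixings (s.idx δ) ∅

/-- Some permutation has the `i_δ`-inf-conjunction `{(i, b)}`, and `i` is not yet fixed to
`1 - b`. -/
def HasSingleConj {n : ℕ} (P : Finset (Equiv.Perm (Fin n))) (s : State n) (f : Fin n × Bool) :
    Prop :=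
  (∃ δ ∈ P, InfConj δ s.fixings (s.idx δ) {f}) ∧ f.1 ∉ s.fixings (!f.2)

/-- The steps of the algorithm for the set `P` of permutations, where `suff s γ` says that in the
state `s` the permutation `γ` satisfies the sufficient conditions for completeness. -/
inductive Step {n : ℕ} (suff : State n → Equiv.Perm (Fin n) → Prop)
    (P : Finset (Equiv.Perm (Fin n))) : Config n → Config n → Prop where
  | finish (s : State n) : (∀ γ ∈ P, suff s γ) →
      Step suff P (.outer s) (.done (.feasible s.fixings))
  | select (s : State n) (γ : Equiv.Perm (Fin n)) : γ ∈ P → ¬ suff s γ →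
      Step suff P (.outer s) (.inner ⟨s.fixings, Function.update s.idx γ (s.idx γ + 1)⟩)
  | infeasible (s : State n) : HasEmptyConj P s →
      Step suff P (.inner s) (.done .infeasible)
  | fix (s : State n) (i : Fin n) (b : Bool) : ¬ HasEmptyConj P s → HasSingleConj P s (i, b) →
      Step suff P (.inner s) (.inner ⟨applyFixing s.fixings (i, !b), s.idx⟩)
  | leave (s : State n) : ¬ HasEmptyConj P s → (∀ f, ¬ HasSingleConj P s f) →
      Step suff P (.inner s) (.outer s)

open Classical in
/-- The first configuration: infeasible if no vector respects the initial fixings; otherwise all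
indices are 1 and the outer loop is entered. -/
noncomputable def start {n : ℕ} (I : Fixings n) : Config n :=
  if F I = ∅ then .done .infeasible else .outer ⟨I, fun _ => 1⟩

/-- The algorithm, started with the fixings `I`, has an execution that returns `o`. -/
def Returns {n : ℕ} (suff : State n → Equiv.Perm (Fin n) → Prop)
    (P : Finset (Equiv.Perm (Fin n))) (I : Fixings n) (o : Output n) : Prop :=
  Relation.ReflTransGen (Step suff P) (start I) (.done o)

/-- The conditions `suff` are sufficient for completeness whenever neither of the two tests of the
inner loop succeeds. -/
def IsSufficient {n : ℕ} (suff : State n → Equiv.Perm (Fin n) → Prop)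
    (P : Finset (Equiv.Perm (Fin n))) : Prop :=
  ∀ s : State n, ¬ HasEmptyConj P s → (∀ f, ¬ HasSingleConj P s f) →
    ∀ γ ∈ P, suff s γ → Complete γ s.fixings

/-- The concrete selection conditions: there is no eq-conjunction; or `i_γ > n`; or
the empty conjunction is no eq-conjunction, `i_γ` is not fixed to 0, `γ⁻¹(i_γ)` is not fixed to 1,
and both `γ(i_γ)` and `γ⁻¹(i_γ)` are larger than `i_γ`. -/
def complConditions {n : ℕ} (s : State n) (γ : Equiv.Perm (Fin n)) : Prop :=
  minEqConj γ s.fixings (s.idx γ) = ∅ ∨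
  n < s.idx γ ∨
  (∅ ∉ minEqConj γ s.fixings (s.idx γ) ∧
    ∃ p : Fin n, p.val + 1 = s.idx γ ∧ p ∉ s.fixings false ∧ γ.symm p ∉ s.fixings true ∧
      p < γ p ∧ p < γ.symm p)

/-- The output is correct for the permutations `P` and the initial fixings `I`.
* Infeasible: no vector that respects `I` satisfies all constraints; this is so since no vector
  respects `I`, or since after valid fixings the constraint of one permutation has no solution left.
* Feasible, with the fixings `J`: they arise from `I` by valid fixings, keep all vectors
  that satisfy all constraints, leave every individual constraint feasible, and are complete for
  every individual constraint. Moreover they are the least fixings above `I` with this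
  completeness. -/
def Correct {n : ℕ} (P : Finset (Equiv.Perm (Fin n))) (I : Fixings n) : Output n → Prop
  | .infeasible => XAll P ∩ F I = ∅ ∧
      (F I = ∅ ∨ ∃ J, Derives P I J ∧ ∃ δ ∈ P, X δ ∩ F J = ∅)
  | .feasible J => I ≤ J ∧ Derives P I J ∧ XAll P ∩ F J = XAll P ∩ F I ∧ (F J).Nonempty ∧
      (∀ γ ∈ P, (X γ ∩ F J).Nonempty ∧ Complete γ J) ∧
      ∀ J' : Fixings n, I ≤ J' → (∀ γ ∈ P, Complete γ J') → J ≤ J'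

/-! A random access machine with registers and two-dimensional arrays of natural numbers, programmed
in a structured language. `R` and `A` are the names of registers and of arrays. The only arithmetic
is adding and subtracting one, so in `t` steps no number can exceed the largest input number or
literal by more than `t`: all words have logarithmic length in polynomial time. -/

/-- The memory of the machine. -/
structure Mem (R A : Type) where
  reg : R → ℕ
  arr : A → ℕ → ℕ → ℕ

/-- Expressions; truth values are 1 and 0, and every nonzero number counts as true. -/
inductive Expr (R A : Type) where
  | lit (c : ℕ) : Expr R A
  | reg (r : R) : Expr R A
  | get (a : A) (i j : Expr R A) : Expr R A
  | succ (e : Expr R A) : Expr R A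
  | pred (e : Expr R A) : Expr R A
  | eq (e f : Expr R A) : Expr R A
  | lt (e f : Expr R A) : Expr R A
  | and (e f : Expr R A) : Expr R A
  | or (e f : Expr R A) : Expr R A
  | not (e : Expr R A) : Expr R A

/-- The value of an expression. -/
def Expr.eval {R A : Type} (σ : Mem R A) : Expr R A → ℕ
  | .lit c => c
  | .reg r => σ.reg r
  | .get a i j => σ.arr a (i.eval σ) (j.eval σ)
  | .succ e => e.eval σ + 1
  | .pred e => e.eval σ - 1
  | .eq e f => if e.eval σ = f.eval σ then 1 else 0
  | .lt e f => if e.eval σ < f.eval σ then 1 else 0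
  | .and e f => if e.eval σ ≠ 0 ∧ f.eval σ ≠ 0 then 1 else 0
  | .or e f => if e.eval σ ≠ 0 ∨ f.eval σ ≠ 0 then 1 else 0
  | .not e => if e.eval σ = 0 then 1 else 0

/-- The time for evaluating an expression: one step for each of its operations. -/
def Expr.cost {R A : Type} : Expr R A → ℕ
  | .lit _ => 1
  | .reg _ => 1
  | .get _ i j => i.cost + j.cost + 1
  | .succ e => e.cost + 1
  | .pred e => e.cost + 1
  | .eq e f => e.cost + f.cost + 1
  | .lt e f => e.cost + f.cost + 1
  | .and e f => e.cost + f.cost + 1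
  | .or e f => e.cost + f.cost + 1
  | .not e => e.cost + 1

/-- Commands. -/
inductive Cmd (R A : Type) where
  | skip : Cmd R A
  | assign (r : R) (e : Expr R A) : Cmd R A
  | store (a : A) (i j e : Expr R A) : Cmd R A
  | seq (c d : Cmd R A) : Cmd R A
  | ite (e : Expr R A) (c d : Cmd R A) : Cmd R A
  | loop (e : Expr R A) (c : Cmd R A) : Cmd R A

/-- The memory after writing a register. -/
def Mem.setReg {R A : Type} [DecidableEq R] (σ : Mem R A) (r : R) (v : ℕ) : Mem R A :=
  { σ with reg := Function.update σ.reg r v }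

/-- The memory after writing one place of an array. -/
def Mem.setArr {R A : Type} [DecidableEq A] (σ : Mem R A) (a : A) (i j v : ℕ) : Mem R A :=
  ⟨σ.reg, Function.update σ.arr a
    (Function.update (σ.arr a) i (Function.update (σ.arr a i) j v))⟩

/-- `Exec c σ τ t`: the command `c`, started in the memory `σ`, halts in the memory `τ` after
exactly `t` steps. A command `loop e c` repeats `c` while `e` is nonzero. -/
inductive Exec {R A : Type} [DecidableEq R] [DecidableEq A] :
    Cmd R A → Mem R A → Mem R A → ℕ → Prop where
  | skip (σ : Mem R A) : Exec .skip σ σ 1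
  | assign (σ : Mem R A) (r : R) (e : Expr R A) :
      Exec (.assign r e) σ (σ.setReg r (e.eval σ)) (e.cost + 1)
  | store (σ : Mem R A) (a : A) (i j e : Expr R A) :
      Exec (.store a i j e) σ (σ.setArr a (i.eval σ) (j.eval σ) (e.eval σ))
        (i.cost + j.cost + e.cost + 1)
  | seq (c d : Cmd R A) (σ τ υ : Mem R A) (t u : ℕ) :
      Exec c σ τ t → Exec d τ υ u → Exec (.seq c d) σ υ (t + u)
  | iteTrue (e : Expr R A) (c d : Cmd R A) (σ τ : Mem R A) (t : ℕ) :
      e.eval σ ≠ 0 → Exec c σ τ t → Exec (.ite e c d) σ τ (e.cost + 1 + t)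
  | iteFalse (e : Expr R A) (c d : Cmd R A) (σ τ : Mem R A) (t : ℕ) :
      e.eval σ = 0 → Exec d σ τ t → Exec (.ite e c d) σ τ (e.cost + 1 + t)
  | loopTrue (e : Expr R A) (c : Cmd R A) (σ τ υ : Mem R A) (t u : ℕ) :
      e.eval σ ≠ 0 → Exec c σ τ t → Exec (.loop e c) τ υ u →
      Exec (.loop e c) σ υ (e.cost + 1 + t + u)
  | loopFalse (e : Expr R A) (c : Cmd R A) (σ : Mem R A) :
      e.eval σ = 0 → Exec (.loop e c) σ σ (e.cost + 1)

/-- Run the commands of a list one after the other. -/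
def block {R A : Type} : List (Cmd R A) → Cmd R A
  | [] => .skip
  | [c] => c
  | c :: d :: l => .seq c (block (d :: l))

/-! The implementation of the algorithm with implication trees.

Permutations are numbered `0, ..., m - 1`, entries `0, ..., n - 1`. The implication tree of
permutation `g` consists of its root and of at most two paths that start at the root, the branches
`s = false` and `s = true`. In an implication tree no entry occurs twice on a path, so a fixing
vertex on branch `s` is given by its entry `i`, its type `kind s g i` (0: there is no such vertex,
1: conditional fixing vertex, 2: necessary fixing vertex) and the value `val s g i` of its fixing.
The entries of the vertices, in the order of the path, stand in the slots
`head s g, ..., top s g - 1` of the row `ent s g`; slots whose entry has type 0 belong to removed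
vertices, and the slot `head s g` is kept unremoved. The flag `loose s g` tells whether the branch
ends in a loose end vertex. -/

/-- The registers: `n`, `m` are the input sizes; `infeas` is the flag for infeasibility; `cur` is the
permutation under consideration in the outer loop; `stk` is the height of the stack of fixings that
must be applied; `g` is the permutation whose tree is updated; `i`, `b` is the fixing that is
applied; the rest is for intermediate values. -/
inductive Reg where
  | n | m | infeas | cur | stk | g | i | b | p | q | α | β | u | k
  | old (s : Bool)
  deriving DecidableEq

/-- The arrays: `perm g i` is `γ_g(i)`, `inv g i` is `γ_g⁻¹(i)`; `fixed b i` tells whether `i` is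
fixed to `b`; `idx g 0` is the index of permutation `g`; `stackE 0`, `stackV 0` is the stack
of fixings that must be applied, and `inStack b i` tells whether `(i, b)` was put there. Of `head`,
`top` and `loose` only the places with second index 0 are used. -/
inductive Arr where
  | perm | inv | fixed | idx | stackE | stackV | inStack
  | kind (s : Bool) | val (s : Bool) | ent (s : Bool) | head (s : Bool) | top (s : Bool)
  | loose (s : Bool)
  deriving DecidableEq

namespace Tree

abbrev E := Expr Reg Arr

abbrev C := Cmd Reg Arr

/-- The value of a register. -/
def r (x : Reg) : E := .reg x

/-- A number. -/
def c (v : ℕ) : E := .lit v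

/-- The place `x` of the array `a`, in the row of the tree under consideration. -/
def at' (a : Arr) (x : E) : E := .get a (r .g) x

/-- Write that place. -/
def put (a : Arr) (x e : E) : C := .store a (r .g) x e

/-- For `x = 0, ..., bound - 1` do `body`. -/
def forEach (x : Reg) (bound : E) (body : C) : C :=
  block [.assign x (c 0), .loop (.lt (r x) bound) (block [body, .assign x (.succ (r x))])]

def head (s : Bool) : E := at' (.head s) (c 0)

def top (s : Bool) : E := at' (.top s) (c 0)

def loose (s : Bool) : E := at' (.loose s) (c 0)

/-- Branch `s` has a fixing vertex. -/
def nonempty (s : Bool) : E := .lt (head s) (top s)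

/-- The entry in the first slot of branch `s`. -/
def firstEntry (s : Bool) : E := at' (.ent s) (head s)

/-- The entry in the last slot of branch `s`. -/
def lastEntry (s : Bool) : E := at' (.ent s) (.pred (top s))

/-- Remove the last vertex of branch `s`. -/
def removeLast (s : Bool) : C :=
  block [put (.kind s) (lastEntry s) (c 0), put (.top s) (c 0) (.pred (top s))]

/-- Remove the subtree that branch `s` forms. -/
def removeBranch (s : Bool) : C :=
  block [put (.loose s) (c 0) (c 0), .loop (nonempty s) (removeLast s)]

/-- Add the vertex of type `kind` with fixing `(x, v)` at the end of branch `s`. -/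
def append (s : Bool) (kind : ℕ) (x : Reg) (v : ℕ) : C :=
  block [put (.ent s) (top s) (r x), put (.top s) (c 0) (.succ (top s)),
    put (.kind s) (r x) (c kind), put (.val s) (r x) (c v)]

/-- Skip removed vertices at the start of branch `s`. -/
def trimHead (s : Bool) : C :=
  .loop (.and (nonempty s) (.eq (at' (.kind s) (firstEntry s)) (c 0)))
    (put (.head s) (c 0) (.succ (head s)))

/-- The fixings on branch `s` cannot all be applied. Let `u` be the last conditional fixing vertex of
the branch. If there is none, the tree is infeasible. Otherwise the subtree of `u` is
replaced by a necessary fixing vertex with the converse fixing. If `u` has a sibling `w`, the merging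
step follows: the new vertex is put before `w` and the child of `w`, which has the same
fixing as the new vertex, is removed; that is, `w` and its child change places and branch `s` is
left empty. -/
def conflict (s : Bool) : C :=
  block [
    put (.loose s) (c 0) (c 0),
    .loop (.and (nonempty s) (.not (.eq (at' (.kind s) (lastEntry s)) (c 1)))) (removeLast s),
    .ite (nonempty s)
      (block [
        .assign .u (lastEntry s),
        .ite (.and (.eq (.succ (head s)) (top s)) (nonempty (!s)))
          (block [
            removeLast s,
            put (.ent (!s)) (.succ (head (!s))) (firstEntry (!s)),
            put (.ent (!s)) (head (!s)) (r .u)])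
          (block [
            put (.kind s) (r .u) (c 2),
            put (.val s) (r .u) (.not (at' (.val s) (r .u)))])])
      (.assign .infeas (c 1))]

/-- If the root has a necessary fixing vertex as child on branch `s`, put its fixing on the stack, if
it is not already there. -/
def pushRoot (s : Bool) : C :=
  .ite (.and (nonempty s) (.eq (at' (.kind s) (firstEntry s)) (c 2)))
    (block [
      .assign .u (firstEntry s),
      .assign .k (at' (.val s) (r .u)),
      .ite (.get .inStack (r .k) (r .u)) .skip
        (block [
          .store .inStack (r .k) (r .u) (c 1),
          .store .stackE (c 0) (r .stk) (r .u),
          .store .stackV (c 0) (r .stk) (r .k),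
          .assign .stk (.succ (r .stk))])])
    .skip

/-- Write to `dest` the value of entry `x` under the fixings and those on branch `s`, or 2 if `x` is
not fixed by them. -/
def lookup (s : Bool) (x dest : Reg) : C :=
  .ite (.get .fixed (c 0) (r x)) (.assign dest (c 0))
  (.ite (.get .fixed (c 1) (r x)) (.assign dest (c 1))
  (.ite (at' (.kind s) (r x)) (.assign dest (at' (.val s) (r x)))
    (.assign dest (c 2))))

/-- The test `(α, β) = (a, b)`. -/
def case (a b : ℕ) : E := .and (.eq (r .α) (c a)) (.eq (r .β) (c b))

/-- Replace the loose end vertex of branch `s` when the index moves past the position `p`, where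
`q = γ⁻¹(p)`. If both entries are unfixed, the tree branches. -/
def extend (s : Bool) : C :=
  block [
    lookup s .p .α,
    lookup s .q .β,
    .ite (case 0 1) (conflict s)
    (.ite (case 1 0) (put (.loose s) (c 0) (c 0))
    (.ite (case 0 2) (append s 2 .q 0)
    (.ite (case 1 2) (append s 1 .q 1)
    (.ite (case 2 0) (append s 1 .p 0)
    (.ite (case 2 1) (append s 2 .p 1)
    (.ite (case 2 2)
      (block [
        append s 1 .p 0, append s 2 .q 0,
        append (!s) 1 .q 1, append (!s) 2 .p 1, put (.loose (!s)) (c 0) (c 1)])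
      .skip))))))]

/-- The index increasing event for permutation `g`. -/
def indexEvent : C :=
  block [
    .assign .p (.pred (at' .idx (c 0))),
    .assign .q (at' .inv (r .p)),
    put .idx (c 0) (.succ (at' .idx (c 0))),
    .ite (.eq (r .p) (r .q)) .skip
      (block [
        .assign (.old false) (loose false),
        .assign (.old true) (loose true),
        .ite (r (.old false)) (extend false) .skip,
        .ite (r (.old true)) (extend true) .skip,
        pushRoot false,
        pushRoot true])]

/-- The update of branch `s` when the fixing `(i, b)` is applied. A vertex with this fixing is
removed, together with the subtree of its sibling. A conditional fixing vertex with the converse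
fixing is removed with its subtree. A necessary fixing vertex with the converse fixing leads to
a conflict. -/
def fixBranch (s : Bool) : C :=
  .ite (at' (.kind s) (r .i))
    (block [
      .ite (.eq (at' (.val s) (r .i)) (r .b))
        (block [
          put (.kind s) (r .i) (c 0),
          .ite (.and (.eq (firstEntry s) (r .i)) (nonempty (!s))) (removeBranch (!s)) .skip])
        (block [
          .assign .k (at' (.kind s) (r .i)),
          put (.loose s) (c 0) (c 0),
          .loop (at' (.kind s) (r .i)) (removeLast s),
          .ite (.eq (r .k) (c 2)) (conflict s) .skip]),
      trimHead s])
    .skip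

/-- The update of the tree of permutation `g` when the fixing `(i, b)` is applied. -/
def fixTree : C :=
  block [fixBranch false, fixBranch true, pushRoot false, pushRoot true]

/-- Apply the fixings on the stack until it is empty or infeasibility is found. After a fixing the
permutations have to be considered again from the first one. -/
def propagate : C :=
  .loop (.and (r .stk) (.not (r .infeas)))
    (block [
      .assign .stk (.pred (r .stk)),
      .assign .i (.get .stackE (c 0) (r .stk)),
      .assign .b (.get .stackV (c 0) (r .stk)),
      .store .fixed (r .b) (r .i) (c 1),
      forEach .g (r .m) (.ite (r .infeas) .skip fixTree),
      .assign .cur (c 0)])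

/-- The sufficient conditions for completeness of permutation `g`, in terms of its tree: no loose end
vertex exists; or the index exceeds `n`; or every path to a loose end vertex contains a
conditional fixing vertex (when the stack is empty, the root has no necessary fixing vertex as child,
so the first fixing vertex of a branch is a conditional one), and the conditions on
the entry `p = i_γ` hold. -/
def complete : E :=
  .or (.and (.not (loose false)) (.not (loose true)))
  (.or (.lt (r .n) (at' .idx (c 0)))
  (.and (.and (.or (.not (loose false)) (nonempty false))
              (.or (.not (loose true)) (nonempty true)))
  (.and (.and (.not (.get .fixed (c 0) (r .p)))
              (.not (.get .fixed (c 1) (at' .inv (r .p)))))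
        (.and (.lt (r .p) (at' .perm (r .p)))
              (.lt (r .p) (at' .inv (r .p)))))))

/-- Test the initial fixings for contradictions, and set up the index, the table of the inverse
permutation and the initial tree (root and loose end vertex) of each permutation. -/
def init : C :=
  block [
    forEach .i (r .n)
      (.ite (.and (.get .fixed (c 0) (r .i)) (.get .fixed (c 1) (r .i)))
        (.assign .infeas (c 1)) .skip),
    forEach .g (r .m)
      (block [
        put .idx (c 0) (c 1),
        put (.loose false) (c 0) (c 1),
        forEach .i (r .n) (put .inv (at' .perm (r .i)) (r .i))])]

/-- The whole program. All permutations before `cur` satisfy the conditions for completeness. -/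
def program : C :=
  block [
    init,
    .assign .cur (c 0),
    .loop (.and (.lt (r .cur) (r .m)) (.not (r .infeas)))
      (block [
        .assign .g (r .cur),
        .assign .p (.pred (at' .idx (c 0))),
        .ite complete
          (.assign .cur (.succ (r .cur)))
          (block [indexEvent, propagate])])]

end Tree

/-- The initial memory: the sizes `n` and `m`, the tables of the permutations `γ 0, ..., γ (m - 1)`
and the two Boolean arrays of the initial fixings; everything else is 0. -/
def encode {n m : ℕ} (γ : Fin m → Equiv.Perm (Fin n)) (I : Fixings n) : Mem Reg Arr where
  reg
    | .n => n
    | .m => m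
    | _ => 0
  arr
    | .perm => fun g i => if h : g < m ∧ i < n then (γ ⟨g, h.1⟩ ⟨i, h.2⟩).val else 0
    | .fixed => fun b i =>
        if h : i < n then
          if (b = 0 ∧ ⟨i, h⟩ ∈ I false) ∨ (b = 1 ∧ ⟨i, h⟩ ∈ I true) then 1 else 0
        else 0
    | _ => fun _ _ => 0

/-- The output that is read off the final memory. -/
def decode (n : ℕ) (σ : Mem Reg Arr) : Output n :=
  if σ.reg .infeas = 0 then
    .feasible fun b => Finset.univ.filter fun i : Fin n => σ.arr .fixed b.toNat i.val ≠ 0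
  else .infeasible

end Symresack

/-! # Partial correctness and the number of steps of the propagation algorithm -/

namespace Symresack

/-! ### Lexicographic comparison of prefixes. -/

section Lex

variable {n : ℕ} {k l : ℕ} {x y : Vec n}

/-! Partial correctness. If `x ≺_k γ(x)` for all vectors that respect the fixings and a conjunction,
none of these vectors lies in `X γ`. So an empty inf-conjunction proves infeasibility, and a
singleton `{(i, b)}` makes `(i, 1 - b)` valid (`InfConj.valid`). The fixings of the algorithm
therefore always arise by valid fixings. Such derivations lose no common solution
(`Derives.inter_eq`). As validity is monotone in the fixings, they also stay below every pair above
`I` that is complete for all permutations (`Derives.le_of_complete`). When the algorithm returns,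
sufficiency gives completeness, so the result is the least such pair. The conditions (P1)-(P3) are
sufficient by an exchange argument at the entries `i_γ` and `γ⁻¹(i_γ)`
(`isSufficient_complConditions`). The potential `remaining` bounds the number of steps.

The data structure. The tree of `γ` for the index `k` encodes two sets of vectors (`TreeInv`): `x
≺_k γ(x)` holds if, on some path, `x` respects the vertices up to some necessary fixing that it
misses, and `x =_k γ(x)` holds if `x` respects a whole path to a loose end. Two paths suffice for
the following reason. The tree branches at an index event only if neither `p = i_γ` nor `γ⁻¹(p)` is
known on a loose path. If that path has a vertex, then (P3) holds and `γ` is not selected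
(`TreeInv.extendable`); so branching takes place only at the root. Both updates keep this meaning:
`TreeInv.fix` for a fixing, `TreeInv.extend` for an index event.

All tests can be read off the root. A consistent tree has no empty inf-conjunction, and a necessary
vertex at the root yields a singleton inf-conjunction. If there is no such vertex, every fixing that
is not opposed to the present ones is possible (`TreeWF.exists_of_rootFree`), so no other singleton
has to be looked for. The conditions (P1)-(P3) become statements about loose ends and empty paths
(`TreeInv.complConditions_iff`). Hence the program simulates the nondeterministic algorithm: a
fixing on the stack is a legal choice in the inner loop, and with an empty stack the inner loop may
be left.

Running time. The cost is amortized, with 40 units of potential for each slot of a tree. Every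
removal of a vertex is paid for by its slot, and an index event adds at most four slots. What
remains is a constant for each of the at most `n * m` index events, for each pair of an applied
fixing and a tree, and for the scan over the permutations, which restarts only after a fixing. At
most `n` fixings are applied, so `mainLoop_spec` gives a bound linear in `n * m`. -/

theorem EqUpTo.symm (h : EqUpTo k x y) : EqUpTo k y x := fun i hi => (h i hi).symm

theorem EqUpTo.mono (hkl : k ≤ l) (h : EqUpTo l x y) : EqUpTo k x y :=
  fun i hi => h i (hi.trans_le hkl)

theorem GtUpTo.mono (hkl : k ≤ l) (h : GtUpTo k x y) : GtUpTo l x y := by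
  obtain ⟨i, hi, he, hlt⟩ := h
  exact ⟨i, hi.trans_le hkl, he, hlt⟩

theorem GtUpTo.not_eqUpTo (h : GtUpTo k x y) : ¬ EqUpTo k x y := by
  obtain ⟨i, hi, _, hlt⟩ := h
  exact fun h => hlt.ne (h i hi).symm

theorem GtUpTo.asymm (h : GtUpTo k x y) : ¬ GtUpTo k y x := by
  obtain ⟨i, hi, he, hlt⟩ := h
  rintro ⟨j, hj, he', hlt'⟩
  rcases lt_trichotomy i j with hij | rfl | hij
  · exact hlt.ne (he' i (by simpa using hij))
  · exact lt_asymm hlt hlt'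
  · exact hlt'.ne (he j (by simpa using hij))

/-- The comparison is decided at the first position below `k` where the vectors differ, which
`Nat.find` provides. -/
theorem eqUpTo_or_gtUpTo (k : ℕ) (x y : Vec n) :
    EqUpTo k x y ∨ GtUpTo k x y ∨ GtUpTo k y x := by
  classical
  by_cases h : EqUpTo k x y
  · exact Or.inl h
  right
  have hex : ∃ j : ℕ, ∃ i : Fin n, i.val = j ∧ i.val + 1 < k ∧ x i ≠ y i := by
    simp only [EqUpTo, not_forall] at h
    obtain ⟨i, hi, hne⟩ := h
    exact ⟨i, i, rfl, hi, hne⟩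
  obtain ⟨i, hij, hi, hne⟩ := Nat.find_spec hex
  have hmin : EqUpTo (i.val + 1) x y := by
    intro j hj
    by_contra hc
    exact Nat.find_min hex (m := j) (by omega) ⟨j, rfl, by omega, hc⟩
  rcases lt_or_gt_of_ne hne with hlt | hlt
  · exact Or.inr ⟨i, hi, hmin.symm, hlt⟩
  · exact Or.inl ⟨i, hi, hmin, hlt⟩

theorem geUpTo_iff_not_gtUpTo : GeUpTo k x y ↔ ¬ GtUpTo k y x := by
  constructor
  · rintro (h | h)
    · exact fun h' => h'.not_eqUpTo h.symm
    · exact h.asymm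
  · intro h
    rcases eqUpTo_or_gtUpTo k x y with h' | h' | h'
    · exact Or.inl h'
    · exact Or.inr h'
    · exact absurd h' h

/-- The 1-based position of `p` is `p.val + 1`: the bound `p.val + 1` sees only positions before
`p`, and `p.val + 2` includes `p`. Together with `gtUpTo_succ` this is the recursion that an index
event follows. -/
theorem eqUpTo_succ (p : Fin n) :
    EqUpTo (p.val + 2) x y ↔ EqUpTo (p.val + 1) x y ∧ x p = y p := by
  constructor
  · exact fun h => ⟨h.mono (by omega), h p (by omega)⟩
  · rintro ⟨h, hp⟩ i hi
    rcases Nat.lt_or_ge i.val p.val with h' | h'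
    · exact h i (by omega)
    · have : i = p := Fin.ext (by omega)
      exact this ▸ hp

theorem gtUpTo_succ (p : Fin n) :
    GtUpTo (p.val + 2) x y ↔ GtUpTo (p.val + 1) x y ∨ EqUpTo (p.val + 1) x y ∧ y p < x p := by
  constructor
  · rintro ⟨i, hi, he, hlt⟩
    rcases Nat.lt_or_ge i.val p.val with h' | h'
    · exact Or.inl ⟨i, by omega, he, hlt⟩
    · have : i = p := Fin.ext (by omega)
      subst this
      exact Or.inr ⟨he, hlt⟩
  · rintro (h | ⟨he, hlt⟩)
    · exact h.mono (by omega)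
    · exact ⟨p, by omega, he, hlt⟩

end Lex

/-! ### Valid fixings, derivations and inf-conjunctions. -/

section Fixings

variable {n : ℕ} {γ : Equiv.Perm (Fin n)} {P : Finset (Equiv.Perm (Fin n))} {I J : Fixings n}
  {x : Vec n} {k l : ℕ}

theorem mem_X_iff : x ∈ X γ ↔ ¬ GtUpTo (n + 1) (permute γ x) x := geUpTo_iff_not_gtUpTo

theorem mem_X_of_not_gtUpTo (hk : n < k) (h : ¬ GtUpTo k (permute γ x) x) : x ∈ X γ :=
  mem_X_iff.2 fun h' => h (h'.mono hk)

/-- No bound on `k` is needed: the deciding position belongs to `Fin n` and is seen by the full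
order anyway. -/
theorem not_mem_X_of_gtUpTo (h : GtUpTo k (permute γ x) x) : x ∉ X γ := by
  rw [mem_X_iff, not_not]
  obtain ⟨i, -, he, hlt⟩ := h
  exact ⟨i, by omega, he, hlt⟩

theorem mem_X_of_gtUpTo (h : GtUpTo k x (permute γ x)) : x ∈ X γ := by
  obtain ⟨i, -, he, hlt⟩ := h
  exact Or.inr ⟨i, by omega, he, hlt⟩

theorem mem_V_singleton {f : Fin n × Bool} : x ∈ V {f} ↔ x f.1 = f.2 := by simp [V]

theorem V_empty : V (∅ : Finset (Fin n × Bool)) = Set.univ := by simp [V]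

theorem F_anti (h : I ≤ J) : F J ⊆ F I := fun _ hx b i hi => hx b i (h b hi)

theorem mem_F_applyFixing {f : Fin n × Bool} :
    x ∈ F (applyFixing I f) ↔ x ∈ F I ∧ x f.1 = f.2 := by
  constructor
  · intro h
    refine ⟨fun b i hi => h b i ?_, h f.2 f.1 (by simp [applyFixing])⟩
    rcases eq_or_ne b f.2 with rfl | hb
    · simp [applyFixing, hi]
    · simp [applyFixing, hb, hi]
  · rintro ⟨h, hf⟩ b i hi
    rcases eq_or_ne b f.2 with rfl | hb
    · simp only [applyFixing, Function.update_self, Finset.mem_insert] at hi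
      rcases hi with rfl | hi
      · exact hf
      · exact h _ _ hi
    · rw [applyFixing, Function.update_of_ne hb] at hi
      exact h b i hi

theorem mem_applyFixing {f : Fin n × Bool} {i : Fin n} {b : Bool} :
    i ∈ applyFixing I f b ↔ (i, b) = f ∨ i ∈ I b := by
  rcases eq_or_ne b f.2 with rfl | hb
  · simp [applyFixing, Prod.ext_iff]
  · simp [applyFixing, hb, Prod.ext_iff]

theorem le_applyFixing (I : Fixings n) (f : Fin n × Bool) : I ≤ applyFixing I f := by
  intro b i hi
  exact mem_applyFixing.2 (Or.inr hi)

/-- An unfixed entry can be changed. -/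
theorem update_mem_F (hx : x ∈ F I) {i : Fin n} {b : Bool} (hi : i ∉ I (!b)) :
    Function.update x i b ∈ F I := by
  intro c j hj
  by_cases hji : j = i
  · subst hji
    cases b <;> cases c <;> simp_all
  · simpa [hji] using hx c j hj

theorem Valid.anti {f : Fin n × Bool} (h : Valid γ I f) (hIJ : I ≤ J) : Valid γ J f :=
  fun x hx => h x ⟨hx.1, F_anti hIJ hx.2⟩

theorem InfConj.anti {C : Finset (Fin n × Bool)} (h : InfConj γ I k C) (hIJ : I ≤ J)
    (hkl : k ≤ l) : InfConj γ J l C :=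
  fun x hx => (h x ⟨F_anti hIJ hx.1, hx.2⟩).mono hkl

theorem Derives.le (h : Derives P I J) : I ≤ J := by
  induction h with
  | refl => exact le_rfl
  | tail _ hs ih =>
    obtain ⟨γ, -, f, -, rfl⟩ := hs
    exact ih.trans (le_applyFixing _ _)

/-- A fixing valid on `X γ` is valid on the smaller set `XAll P`, so no common solution is cut off.
-/
theorem Derives.inter_eq (h : Derives P I J) : XAll P ∩ F J = XAll P ∩ F I := by
  induction h with
  | refl => rfl
  | tail _ hs ih =>
    obtain ⟨γ, hγ, f, hf, rfl⟩ := hs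
    rw [← ih]
    ext x
    simp only [Set.mem_inter_iff, mem_F_applyFixing]
    constructor
    · exact fun h => ⟨h.1, h.2.1⟩
    · exact fun h => ⟨h.1, h.2, hf x ⟨h.1 γ hγ, h.2⟩⟩

/-- As long as the current fixings lie below `J'`, the next fixing of the derivation is still valid
at `J'`, and completeness forces it into `J'`. This gives the minimality of the output. -/
theorem Derives.le_of_complete (h : Derives P I J) {J' : Fixings n} (hI : I ≤ J')
    (hc : ∀ γ ∈ P, Complete γ J') : J ≤ J' := by
  induction h with
  | refl => exact hI
  | tail _ hs ih =>
    obtain ⟨γ, hγ, f, hf, rfl⟩ := hs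
    intro b i hi
    rcases mem_applyFixing.1 hi with rfl | hi
    · exact hc γ hγ _ (hf.anti ih)
    · exact ih b hi

/-- A vector of `X γ ∩ F I` with the value `b` at `i` would be smaller than its permuted vector;
since entries are binary, only `!b` is left. -/
theorem InfConj.valid {i : Fin n} {b : Bool} (h : InfConj γ I k {(i, b)}) :
    Valid γ I (i, !b) := by
  rintro x ⟨hx, hxI⟩
  by_contra hne
  have hxb : x i = b := by
    have : x i ≠ !b := hne
    cases b <;> simp_all
  exact not_mem_X_of_gtUpTo (h x ⟨hxI, mem_V_singleton.2 hxb⟩) hx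

theorem InfConj.inter_eq_empty (h : InfConj γ I k ∅) : X γ ∩ F I = ∅ := by
  ext x
  simp only [Set.mem_inter_iff, Set.mem_empty_iff_false, iff_false, not_and]
  exact fun hx hxI => not_mem_X_of_gtUpTo (h x ⟨hxI, by simp [V_empty]⟩) hx

end Fixings

/-! ### Correctness and number of steps of the nondeterministic algorithm. -/

section Algorithm

variable {n : ℕ} {P : Finset (Equiv.Perm (Fin n))} {I : Fixings n}
  {suff : State n → Equiv.Perm (Fin n) → Prop}

/-- A fixing that the algorithm applies concerns an unfixed entry, and leaves a vector. -/
theorem HasSingleConj.unfixed {s : State n} {i : Fin n} {b : Bool} (h : HasSingleConj P s (i, b))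
    (he : ¬ HasEmptyConj P s) :
    (∀ c, i ∉ s.fixings c) ∧ (F (applyFixing s.fixings (i, !b))).Nonempty := by
  obtain ⟨⟨δ, hδ, hinf⟩, hi⟩ := h
  have h1 : ¬ InfConj δ s.fixings (s.idx δ) ∅ := fun h => he ⟨δ, hδ, h⟩
  simp only [InfConj, V_empty, Set.inter_univ, not_forall] at h1
  obtain ⟨x, hx, hgt⟩ := h1
  have hxi : x i ≠ b := fun hxi => hgt (hinf x ⟨hx, mem_V_singleton.2 hxi⟩)
  refine ⟨fun c hc => ?_, x, mem_F_applyFixing.2 ⟨hx, by cases b <;> simp_all⟩⟩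
  have hxc := hx c i hc
  have hc' : c = !b := by cases b <;> cases c <;> simp_all
  exact hi (hc' ▸ hc)

/-- What holds whenever the algorithm is in a configuration. -/
def Invariant (P : Finset (Equiv.Perm (Fin n))) (I : Fixings n) : Config n → Prop
  | .outer s => Derives P I s.fixings ∧ (F s.fixings).Nonempty ∧ ¬ HasEmptyConj P s ∧
      ∀ f, ¬ HasSingleConj P s f
  | .inner s => Derives P I s.fixings ∧ (F s.fixings).Nonempty
  | .done o => Correct P I o

theorem invariant_start (P : Finset (Equiv.Perm (Fin n))) (I : Fixings n) :
    Invariant P I (start I) := by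
  unfold start
  split_ifs with h
  · exact ⟨by simp [h], Or.inl h⟩
  · obtain ⟨x, hx⟩ := Set.nonempty_iff_ne_empty.2 h
    -- With index 1 no position is compared, so there are no inf-conjunctions that a vector of `F I`
    -- respects.
    have hno : ∀ y z : Vec n, ¬ GtUpTo 1 y z := by
      rintro y z ⟨i, hi, -⟩
      omega
    refine ⟨Relation.ReflTransGen.refl, ⟨x, hx⟩, ?_, ?_⟩
    · rintro ⟨δ, -, hinf⟩
      exact hno _ _ (hinf x ⟨hx, by simp [V_empty]⟩)
    · rintro ⟨i, b⟩ ⟨⟨δ, -, hinf⟩, hi⟩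
      exact hno _ _ (hinf _ ⟨update_mem_F hx hi, mem_V_singleton.2 (by simp)⟩)

theorem Invariant.step (hn : 0 < n) (hsuff : IsSufficient suff P) {c d : Config n}
    (hc : Invariant P I c) (hs : Step suff P c d) : Invariant P I d := by
  cases hs with
  | finish s hall =>
    obtain ⟨hd, hne, he, hsing⟩ := hc
    have hcomp := fun γ hγ => hsuff s he hsing γ hγ (hall γ hγ)
    refine ⟨hd.le, hd, hd.inter_eq, hne, fun γ hγ => ⟨?_, hcomp γ hγ⟩,
      fun J' hJ hc => hd.le_of_complete hJ hc⟩
    -- If one constraint had no solution left, every fixing would be valid. Completeness would then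
    -- fix the first entry to both values, although `F` is nonempty; this is where `0 < n` enters.
    by_contra hemp
    rw [Set.not_nonempty_iff_eq_empty] at hemp
    have hv : ∀ f, Valid γ s.fixings f := fun f x hx => by simp [hemp] at hx
    obtain ⟨x, hx⟩ := hne
    have h0 := hx false ⟨0, hn⟩ (hcomp γ hγ (_, false) (hv _))
    have h1 := hx true ⟨0, hn⟩ (hcomp γ hγ (_, true) (hv _))
    simp [h0] at h1
  | select s γ hγ hnot => exact ⟨hc.1, hc.2.1⟩
  | infeasible s he =>
    obtain ⟨δ, hδ, hinf⟩ := he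
    have hempty := hinf.inter_eq_empty
    refine ⟨?_, Or.inr ⟨s.fixings, hc.1, δ, hδ, hempty⟩⟩
    rw [← hc.1.inter_eq, ← Set.subset_empty_iff, ← hempty]
    exact fun x hx => ⟨hx.1 δ hδ, hx.2⟩
  | fix s i b he hsing =>
    refine ⟨hc.1.tail ?_, (hsing.unfixed he).2⟩
    obtain ⟨⟨δ, hδ, hinf⟩, -⟩ := hsing
    exact ⟨δ, hδ, _, hinf.valid, rfl⟩
  | leave s he hsing => exact ⟨hc.1, hc.2, he, hsing⟩

/-- Every output of the algorithm is correct. -/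
theorem correct_of_returns (hn : 0 < n) (hsuff : IsSufficient suff P) {o : Output n}
    (h : Returns suff P I o) : Correct P I o := by
  suffices ∀ c, Relation.ReflTransGen (Step suff P) (start I) c → Invariant P I c from this _ h
  intro c hc
  induction hc with
  | refl => exact invariant_start P I
  | tail _ hs ih => exact ih.step hn hsuff hs

/-- Prescribing all entries of `x` singles out `x`, so equality at one vector already yields an
eq-conjunction. -/
theorem eqConj_of_eqUpTo {γ : Equiv.Perm (Fin n)} {k : ℕ} {x : Vec n} (hx : x ∈ F I)
    (h : EqUpTo k x (permute γ x)) :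
    EqConj γ I k (Finset.univ.image fun i => (i, x i)) := by
  have hV : ∀ y, y ∈ V (Finset.univ.image fun i => (i, x i)) → y = x := by
    intro y hy
    ext i
    rw [hy (i, x i) (by simp)]
  refine ⟨fun y hy => ?_, x, ⟨hx, by simp [V]⟩, h⟩
  rw [hV y hy.2]
  exact Or.inl h.symm

/-- Finite sets are well-founded under inclusion, so below every eq-conjunction there is a minimal
one; if there is none, `eqConj_of_eqUpTo` excludes equality at any vector. -/
theorem minEqConj_eq_empty_iff {γ : Equiv.Perm (Fin n)} {k : ℕ} :
    minEqConj γ I k = ∅ ↔ ∀ x ∈ F I, ¬ EqUpTo k x (permute γ x) := by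
  constructor
  · intro h x hx he
    obtain ⟨C, -, hC⟩ := exists_minimal_le_of_wellFoundedLT (EqConj γ I k) _
      (eqConj_of_eqUpTo hx he)
    have : C ∈ minEqConj γ I k := hC
    simp [h] at this
  · intro h
    ext C
    simp only [minEqConj, Set.mem_ofPred_eq, Set.mem_empty_iff_false, iff_false]
    rintro ⟨⟨-, x, hx, he⟩, -⟩
    exact h x hx.1 he

theorem empty_mem_minEqConj_iff {γ : Equiv.Perm (Fin n)} {k : ℕ} :
    ∅ ∈ minEqConj γ I k ↔ (∀ x ∈ F I, ¬ GtUpTo k x (permute γ x)) ∧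
      ∃ x ∈ F I, EqUpTo k x (permute γ x) := by
  have : ∅ ∈ minEqConj γ I k ↔ EqConj γ I k ∅ :=
    ⟨fun h => h.1, fun h => ⟨h, fun _ _ _ => Finset.empty_subset _⟩⟩
  simp only [this, EqConj, V_empty, Set.inter_univ, geUpTo_iff_not_gtUpTo]

/-- Suppose that a valid fixing `(i, b)` is missing. As `{(i, !b)}` is no inf-conjunction, some `x`
has `x i = !b` and not `x ≺_k γ(x)`. Validity excludes `x ≻_k γ(x)`, so `x =_k γ(x)`. This
contradicts (P1), puts `x` into `X γ` under (P2), and under (P3) some vector of `X γ` with the value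
`!b` at `i` can be built; each time validity is violated. -/
theorem isSufficient_complConditions (P : Finset (Equiv.Perm (Fin n))) :
    IsSufficient complConditions P := by
  intro s he hsing γ hγ hcond f hf
  by_contra hfi
  obtain ⟨i, b⟩ := f
  set k := s.idx γ with hk
  have h1 : ¬ InfConj γ s.fixings k {(i, !b)} := fun h =>
    hsing (i, !b) ⟨⟨γ, hγ, h⟩, by simpa using hfi⟩
  simp only [InfConj, not_forall] at h1
  obtain ⟨x, ⟨hxI, hxV⟩, hgt⟩ := h1
  have hxi : x i = !b := mem_V_singleton.1 hxV
  have contra : ∀ y ∈ F s.fixings, y i = (!b) → y ∉ X γ := by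
    intro y hy hyi hyX
    have hyb : y i = b := hf y ⟨hyX, hy⟩
    rw [hyb] at hyi
    cases b <;> simp at hyi
  have hxeq : EqUpTo k x (permute γ x) := by
    rcases eqUpTo_or_gtUpTo k x (permute γ x) with h | h | h
    · exact h
    · exact absurd (mem_X_of_gtUpTo h) (contra x hxI hxi)
    · exact absurd h hgt
  rcases hcond with hcond | hcond | ⟨hempty, p, hpk, hp0, hq1, hpγ, hpq⟩
  · exact minEqConj_eq_empty_iff.1 hcond x hxI hxeq
  · exact contra x hxI hxi (mem_X_of_not_gtUpTo hcond hgt)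
  · -- positions before `p` do not see the entries `p` and `γ⁻¹ p`
    set q := γ.symm p with hq
    have far : ∀ j : Fin n, j.val + 1 < k → j ≠ p ∧ j ≠ q ∧ γ.symm j ≠ p ∧ γ.symm j ≠ q := by
      intro j hj
      have hjp : j < p := by rw [Fin.lt_def]; omega
      refine ⟨hjp.ne, (hjp.trans hpq).ne, fun h => ?_, fun h => ?_⟩
      · have : j = γ p := by rw [← h]; simp
        exact absurd (this ▸ hpγ) (by simpa using hjp.le)
      · exact hjp.ne (γ.symm.injective h)
    -- Here entry `p` has to be 0, so `p` cannot decide the comparison. Since ∅ is no eq-conjunction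
    -- although equality occurs, there is some `y ≻_k γ(y)`, and changing its entry `p` is not seen
    -- at the positions before `p`. The case of `q` and the value 1 is analogous.
    by_cases hip : i = p ∧ b = true
    · obtain ⟨rfl, rfl⟩ := hip
      have hgt' : ∃ y ∈ F s.fixings, GtUpTo k y (permute γ y) := by
        by_contra hno
        push Not at hno
        exact hempty (empty_mem_minEqConj_iff.2 ⟨hno, x, hxI, hxeq⟩)
      obtain ⟨y, hy, j, hj, hje, hjlt⟩ := hgt'
      refine contra (Function.update y i false) (update_mem_F hy hfi) (by simp)
        (mem_X_of_gtUpTo (k := k) ⟨j, hj, fun l hl => ?_, ?_⟩)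
      · obtain ⟨a1, a2, a3, a4⟩ := far l (by omega)
        simpa [permute, a1, a3] using hje l hl
      · obtain ⟨a1, a2, a3, a4⟩ := far j hj
        simpa [permute, a1, a3] using hjlt
    by_cases hiq : i = q ∧ b = false
    · obtain ⟨rfl, rfl⟩ := hiq
      have hgt' : ∃ y ∈ F s.fixings, GtUpTo k y (permute γ y) := by
        by_contra hno
        push Not at hno
        exact hempty (empty_mem_minEqConj_iff.2 ⟨hno, x, hxI, hxeq⟩)
      obtain ⟨y, hy, j, hj, hje, hjlt⟩ := hgt'
      refine contra (Function.update y q true) (update_mem_F hy hfi) (by simp)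
        (mem_X_of_gtUpTo (k := k) ⟨j, hj, fun l hl => ?_, ?_⟩)
      · obtain ⟨a1, a2, a3, a4⟩ := far l (by omega)
        simpa [permute, a2, a4] using hje l hl
      · obtain ⟨a1, a2, a3, a4⟩ := far j hj
        simpa [permute, a2, a4] using hjlt
    -- In all other cases the values 1 at `p` and 0 at `q` are compatible with the value `!b` at
    -- `i`. They keep the equality before `p` and decide the comparison at `p`.
    have hqp : q ≠ p := hpq.ne'
    refine contra (Function.update (Function.update x p true) q false)
      (update_mem_F (update_mem_F hxI hp0) hq1) ?_
      (mem_X_of_gtUpTo (k := k + 1) ⟨p, by omega, fun l hl => ?_, ?_⟩)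
    · by_cases h1 : i = q
      · subst h1
        cases b <;> simp_all
      · by_cases h2 : i = p
        · subst h2
          cases b <;> simp_all
        · simp [h1, h2, hxi]
    · obtain ⟨a1, a2, a3, a4⟩ := far l (by omega)
      simpa [permute, a1, a2, a3, a4] using hxeq l (by omega)
    · simp [permute, ← hq, hqp.symm]

/-- The entries that are not fixed. -/
def unfixed (I : Fixings n) : Finset (Fin n) := Finset.univ.filter fun i => ∀ b, i ∉ I b

theorem mem_unfixed {i : Fin n} : i ∈ unfixed I ↔ ∀ b, i ∉ I b := by simp [unfixed]

theorem card_unfixed_le : (unfixed I).card ≤ n := by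
  simpa using Finset.card_le_univ (unfixed I)

theorem unfixed_applyFixing (f : Fin n × Bool) :
    unfixed (applyFixing I f) = (unfixed I).erase f.1 := by
  ext i
  simp only [mem_unfixed, mem_applyFixing, Finset.mem_erase, not_or, Prod.ext_iff, not_and]
  constructor
  · exact fun h => ⟨fun hi => (h f.2).1 hi rfl, fun b => (h b).2⟩
  · exact fun h b => ⟨fun hi => absurd hi h.1, h.2 b⟩

theorem card_unfixed_applyFixing {f : Fin n × Bool} (hf : ∀ b, f.1 ∉ I b) :
    (unfixed (applyFixing I f)).card + 1 = (unfixed I).card := by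
  rw [unfixed_applyFixing, Finset.card_erase_add_one (mem_unfixed.2 hf)]

/-- An upper bound for the number of remaining steps. -/
def remaining (P : Finset (Equiv.Perm (Fin n))) : Config n → ℕ
  | .outer s => 2 * ∑ γ ∈ P, (n + 1 - s.idx γ) + (unfixed s.fixings).card + 1
  | .inner s => 2 * ∑ γ ∈ P, (n + 1 - s.idx γ) + (unfixed s.fixings).card + 2
  | .done _ => 0

/-- The factor 2 of an index increment pays for the selection and for the exit from the inner loop;
a fixing uses up an unfixed entry; the additive constant is left for the return. -/
theorem remaining_lt_of_step {c d : Config n} (h : Step complConditions P c d) :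
    remaining P d < remaining P c := by
  cases h with
  | finish s _ => simp [remaining]
  | select s γ hγ hnot =>
    have hidx : s.idx γ ≤ n := by
      by_contra hc
      exact hnot (Or.inr (Or.inl (by omega)))
    have : ∑ δ ∈ P, (n + 1 - Function.update s.idx γ (s.idx γ + 1) δ) <
        ∑ δ ∈ P, (n + 1 - s.idx δ) := by
      apply Finset.sum_lt_sum
      · intro δ _
        rcases eq_or_ne δ γ with rfl | hne
        · simp; omega
        · simp [hne]
      · exact ⟨γ, hγ, by simp; omega⟩
    simp only [remaining]
    omega
  | infeasible s _ => simp [remaining]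
  | fix s i b he hsing =>
    have := card_unfixed_applyFixing (f := (i, !b)) (hsing.unfixed he).1
    simp only [remaining]
    omega
  | leave s _ _ => simp [remaining]

theorem remaining_start_le (P : Finset (Equiv.Perm (Fin n))) (I : Fixings n) :
    remaining P (start I) ≤ 2 * n * P.card + n + 1 := by
  unfold start
  split_ifs
  · simp [remaining]
  · have := card_unfixed_le (I := I)
    simp only [remaining, Nat.add_sub_cancel, Finset.sum_const, smul_eq_mul]
    rw [Nat.mul_comm P.card n, ← Nat.mul_assoc]
    omega

theorem steps_le (P : Finset (Equiv.Perm (Fin n))) (I : Fixings n) (N : ℕ) (a : ℕ → Config n)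
    (h0 : a 0 = start I) (hs : ∀ k < N, Step complConditions P (a k) (a (k + 1))) :
    N ≤ 2 * n * P.card + n + 1 := by
  have key : ∀ k ≤ N, remaining P (a k) + k ≤ remaining P (a 0) := by
    intro k
    induction k with
    | zero => simp
    | succ k ih =>
      intro hk
      have h1 := ih (by omega)
      have h2 := remaining_lt_of_step (hs k (by omega))
      omega
  have h1 := key N le_rfl
  have h2 := remaining_start_le P I
  rw [h0] at h1
  omega

end Algorithm

end Symresack

/-! # Implication trees

The abstract counterpart of the data structure: a tree consists of at most two branches, and a
branch is a list of vertices, some of which are marked as removed. -/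

namespace Symresack

/-- The type of a vertex: removed, conditional fixing, or necessary fixing. -/
inductive Kind where
  | dead | cond | nec
  deriving DecidableEq

/-- A vertex of an implication tree, with entry `e` and value `v` of its fixing. -/
structure Slot (n : ℕ) where
  e : Fin n
  k : Kind
  v : Bool

/-- The vertex of type `k` with the fixing `f`. -/
def Slot.mk' {n : ℕ} (f : Fin n × Bool) (k : Kind) : Slot n := ⟨f.1, k, f.2⟩

/-- The converse fixing. -/
def conv {n : ℕ} (f : Fin n × Bool) : Fin n × Bool := (f.1, !f.2)

/-- The vertices of a branch, and whether it has a loose end. -/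
structure Branch (n : ℕ) where
  slots : List (Slot n)
  loose : Bool

/-- The branch without vertices. -/
def Branch.empty (n : ℕ) : Branch n := ⟨[], false⟩

/-- An implication tree, given by its two branches. -/
abbrev ITree (n : ℕ) := Bool → Branch n

variable {n : ℕ}

@[simp] theorem conv_conv (f : Fin n × Bool) : conv (conv f) = f := by simp [conv]

/-! ### Paths as conditions on vectors; cutting and trimming of paths. -/

section Semantics

variable {x : Vec n} {l l' : List (Slot n)} {v : Slot n}

/-- `x` respects the vertices before some necessary fixing vertex, but not this one. -/
def Violates (x : Vec n) : List (Slot n) → Prop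
  | [] => False
  | v :: l => match v.k with
    | .dead => Violates x l
    | .cond => x v.e = v.v ∧ Violates x l
    | .nec => x v.e ≠ v.v ∨ Violates x l

/-- `x` respects all vertices. -/
def Respects (x : Vec n) (l : List (Slot n)) : Prop := ∀ v ∈ l, v.k ≠ .dead → x v.e = v.v

@[simp] theorem not_violates_nil : ¬ Violates x [] := id

@[simp] theorem respects_nil : Respects x [] := by simp [Respects]

@[simp] theorem respects_cons :
    Respects x (v :: l) ↔ (v.k ≠ .dead → x v.e = v.v) ∧ Respects x l := by
  simp [Respects]

@[simp] theorem respects_append : Respects x (l ++ l') ↔ Respects x l ∧ Respects x l' := by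
  simp [Respects, or_imp, forall_and]

theorem violates_cons_dead (h : v.k = .dead) : Violates x (v :: l) ↔ Violates x l := by
  rw [Violates, h]

theorem violates_cons_cond (h : v.k = .cond) :
    Violates x (v :: l) ↔ x v.e = v.v ∧ Violates x l := by
  rw [Violates, h]

theorem violates_cons_nec (h : v.k = .nec) :
    Violates x (v :: l) ↔ x v.e ≠ v.v ∨ Violates x l := by
  rw [Violates, h]

theorem violates_append :
    Violates x (l ++ l') ↔ Violates x l ∨ Respects x l ∧ Violates x l' := by
  induction l with
  | nil => simp
  | cons v l ih =>
    rw [List.cons_append, respects_cons]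
    rcases hk : v.k with _ | _ | _
    · rw [violates_cons_dead hk, violates_cons_dead hk, ih]
      simp
    · rw [violates_cons_cond hk, violates_cons_cond hk, ih]
      simp
      tauto
    · rw [violates_cons_nec hk, violates_cons_nec hk, ih]
      simp
      tauto

/-- Remove the vertices after the last conditional fixing vertex. -/
def cut : List (Slot n) → List (Slot n)
  | [] => []
  | v :: l => if (cut l).isEmpty ∧ v.k ≠ .cond then [] else v :: cut l

theorem cut_append_singleton (l : List (Slot n)) (v : Slot n) :
    cut (l ++ [v]) = if v.k = .cond then l ++ [v] else cut l := by
  induction l with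
  | nil => by_cases h : v.k = .cond <;> simp [cut, h]
  | cons w l ih =>
    by_cases h : v.k = .cond <;> simp_all [cut]

theorem cut_prefix (l : List (Slot n)) : cut l <+: l := by
  induction l with
  | nil => simp [cut]
  | cons v l ih =>
    unfold cut
    split_ifs
    · exact List.nil_prefix
    · exact List.cons_prefix_cons.2 ⟨rfl, ih⟩

theorem cut_last_cond {u : Slot n} (h : cut l = l' ++ [u]) : u.k = .cond := by
  induction l generalizing l' with
  | nil => simp [cut] at h
  | cons v l ih =>
    unfold cut at h
    split_ifs at h with hc
    · simp at h
    · rcases l' with _ | ⟨w, l'⟩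
      · simp only [List.nil_append, List.cons.injEq] at h
        obtain ⟨rfl, h⟩ := h
        simp [h] at hc
        exact hc
      · simp only [List.cons_append, List.cons.injEq] at h
        exact ih h.2

/-- A removed or necessary vertex at the end is irrelevant here: a vector that respects everything
before it either respects or violates it. So a conflict may discard all vertices behind the last
conditional one. -/
theorem violates_or_respects_cut :
    Violates x l ∨ Respects x l ↔ Violates x (cut l) ∨ Respects x (cut l) := by
  induction l using List.reverseRecOn with
  | nil => simp [cut]
  | append_singleton l v ih =>
    rw [cut_append_singleton]
    split_ifs with h
    · rfl
    · rw [← ih, violates_append, respects_append]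
      rcases hk : v.k with _ | _ | _
      · simp [violates_cons_dead hk, hk]
      · exact absurd hk h
      · simp [violates_cons_nec hk, hk]
        tauto

/-- Skip removed vertices at the start. -/
def trim (l : List (Slot n)) : List (Slot n) := l.dropWhile fun v => v.k = .dead

@[simp] theorem violates_trim : Violates x (trim l) ↔ Violates x l := by
  induction l with
  | nil => simp [trim]
  | cons v l ih =>
    by_cases h : v.k = .dead
    · rw [violates_cons_dead h, ← ih, trim, List.dropWhile_cons_of_pos (by simpa using h), trim]
    · rw [trim, List.dropWhile_cons_of_neg (by simpa using h)]

@[simp] theorem respects_trim : Respects x (trim l) ↔ Respects x l := by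
  induction l with
  | nil => simp [trim]
  | cons v l ih =>
    by_cases h : v.k = .dead
    · rw [trim, List.dropWhile_cons_of_pos (by simpa using h), ← trim, ih]
      simp [h]
    · rw [trim, List.dropWhile_cons_of_neg (by simpa using h)]

theorem trim_suffix : trim l <:+ l := List.dropWhile_suffix _

theorem trim_head : ∀ v ∈ (trim l).head?, v.k ≠ .dead := by
  intro v hv
  have := List.head?_dropWhile_not (fun v : Slot n => decide (v.k = .dead)) l
  rw [trim] at hv
  rw [Option.mem_def] at hv
  simpa [hv] using this

theorem mem_trim (hv : v ∈ l) : v.k = .dead ∨ v ∈ trim l := by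
  induction l with
  | nil => simp at hv
  | cons w l ih =>
    by_cases h : w.k = .dead
    · rw [trim, List.dropWhile_cons_of_pos (by simpa using h), ← trim]
      rcases List.mem_cons.1 hv with rfl | hv
      · exact Or.inl h
      · exact ih hv
    · rw [trim, List.dropWhile_cons_of_neg (by simpa using h)]
      exact Or.inr hv

end Semantics

/-! ### Consistent trees and the effects of conflicts, fixings and index events. -/

section Trees

/-- The entry is fixed. -/
def Fixed (I : Fixings n) (e : Fin n) : Prop := ∃ b, e ∈ I b

/-- The entry is fixed, or it occurs on the branch. -/
def Known (I : Fixings n) (B : Branch n) (e : Fin n) : Prop :=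
  Fixed I e ∨ ∃ v ∈ B.slots, v.e = e

/-- The branch is consistent with the fixings. -/
structure BranchWF (I : Fixings n) (B : Branch n) : Prop where
  nodup : (B.slots.map Slot.e).Nodup
  dead : ∀ v ∈ B.slots, v.k = .dead ↔ Fixed I v.e
  head : ∀ v ∈ B.slots.head?, v.k ≠ .dead

/-- Both branches are present: their first fixings are `f`, `g` and `¬ g`, `¬ f`. -/
def Branching (t : ITree n) (s : Bool) (f g : Fin n × Bool) : Prop :=
  ∃ r₀ r₁, (t s).slots = .mk' f .cond :: .mk' g .nec :: r₀ ∧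
    (t !s).slots = .mk' (conv g) .cond :: .mk' (conv f) .nec :: r₁

theorem Branching.symm {t : ITree n} {s : Bool} {f g : Fin n × Bool} (h : Branching t s f g) :
    Branching t (!s) (conv g) (conv f) := by
  obtain ⟨r₀, r₁, h₀, h₁⟩ := h
  exact ⟨r₁, r₀, h₁, by simpa using h₀⟩

/-- The tree is consistent with the fixings. -/
structure TreeWF (I : Fixings n) (t : ITree n) : Prop where
  branch : ∀ s, BranchWF I (t s)
  shape : (∃ s, t (!s) = .empty n) ∨ ∃ f g, Branching t false f g

theorem branchWF_empty (I : Fixings n) : BranchWF I (.empty n) :=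
  ⟨by simp [Branch.empty], by simp [Branch.empty], by simp [Branch.empty]⟩

theorem exists_bool (s : Bool) {p : Bool → Prop} : (∃ s, p s) ↔ p s ∨ p (!s) := by
  cases s <;> simp [or_comm]

theorem forall_bool (s : Bool) {p : Bool → Prop} : (∀ s, p s) ↔ p s ∧ p (!s) := by
  cases s <;> simp [and_comm]

/-- `x` violates a necessary fixing of the tree. -/
def TViolates (x : Vec n) (t : ITree n) : Prop := ∃ s, Violates x (t s).slots

/-- `x` respects all vertices of a branch with a loose end. -/
def Branch.Loose (x : Vec n) (B : Branch n) : Prop := B.loose = true ∧ Respects x B.slots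

/-- `x` respects all vertices of some branch with a loose end. -/
def TLoose (x : Vec n) (t : ITree n) : Prop := ∃ s, (t s).Loose x

theorem not_loose_empty {x : Vec n} : ¬ (Branch.empty n).Loose x := by
  simp [Branch.Loose, Branch.empty]

theorem not_violates_empty {x : Vec n} : ¬ Violates x (Branch.empty n).slots := id

/-- The effect of a conflict on branch `s`; the last argument tells whether infeasibility is
detected. -/
inductive ConflictRel (s : Bool) (t t' : ITree n) : Bool → Prop
  | bad : cut (t s).slots = [] → t' s = .empty n → t' (!s) = t (!s) → ConflictRel s t t' true
  | merge (u w c : Slot n) (r : List (Slot n)) : cut (t s).slots = [u] →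
      (t !s).slots = w :: c :: r → t' s = .empty n →
      t' (!s) = ⟨c :: w :: r, (t !s).loose⟩ → ConflictRel s t t' false
  | flip (l : List (Slot n)) (u : Slot n) : cut (t s).slots = l ++ [u] →
      (l = [] → (t !s).slots = []) → t' s = ⟨l ++ [⟨u.e, .nec, !u.v⟩], false⟩ →
      t' (!s) = t (!s) → ConflictRel s t t' false

/-- The effect of the fixing `(i, b)` on branch `s`. -/
inductive FixRel (s : Bool) (i : Fin n) (b : Bool) (t t' : ITree n) : Bool → Prop
  | none : (∀ v ∈ (t s).slots, v.e = i → v.k = .dead) → t' s = t s → t' (!s) = t (!s) →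
      FixRel s i b t t' false
  | hit (l r : List (Slot n)) (v : Slot n) : (t s).slots = l ++ v :: r → v.e = i →
      v.k ≠ .dead → v.v = b → t' s = ⟨trim (l ++ ⟨v.e, .dead, v.v⟩ :: r), (t s).loose⟩ →
      t' (!s) = (if l.isEmpty ∧ (t !s).slots ≠ [] then .empty n else t !s) →
      FixRel s i b t t' false
  | missCond (l r : List (Slot n)) (v : Slot n) : (t s).slots = l ++ v :: r → v.e = i →
      v.k = .cond → v.v = (!b) → t' s = ⟨trim l, false⟩ → t' (!s) = t (!s) →
      FixRel s i b t t' false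
  | missNec (l r : List (Slot n)) (v : Slot n) (t₁ : ITree n) (bad : Bool) :
      (t s).slots = l ++ v :: r → v.e = i → v.k = .nec → v.v = (!b) →
      ConflictRel s (Function.update t s ⟨l, false⟩) t₁ bad →
      t' s = ⟨trim (t₁ s).slots, (t₁ s).loose⟩ → t' (!s) = t₁ (!s) →
      FixRel s i b t t' bad

/-- `o` is the value of the entry under the fixings and those on the branch. -/
inductive Look (I : Fixings n) (B : Branch n) (e : Fin n) : Option Bool → Prop
  | fixed (b : Bool) : e ∈ I b → Look I B e (some b)
  | slot (v : Slot n) : v ∈ B.slots → v.e = e → v.k ≠ .dead → Look I B e (some v.v)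
  | none : ¬ Known I B e → Look I B e Option.none

/-- Append vertices to a branch. -/
def Branch.append (B : Branch n) (l : List (Slot n)) : Branch n := ⟨B.slots ++ l, B.loose⟩

/-- The effect of replacing the loose end of branch `s`. -/
def ExtendRel (s : Bool) (p q : Fin n) (t t' : ITree n) :
    Option Bool → Option Bool → Bool → Prop
  | some false, some true, bad => ConflictRel s t t' bad
  | some true, some false, bad =>
      bad = false ∧ t' s = ⟨(t s).slots, false⟩ ∧ t' (!s) = t (!s)
  | some false, none, bad =>
      bad = false ∧ t' s = (t s).append [⟨q, .nec, false⟩] ∧ t' (!s) = t (!s)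
  | some true, none, bad =>
      bad = false ∧ t' s = (t s).append [⟨q, .cond, true⟩] ∧ t' (!s) = t (!s)
  | none, some false, bad =>
      bad = false ∧ t' s = (t s).append [⟨p, .cond, false⟩] ∧ t' (!s) = t (!s)
  | none, some true, bad =>
      bad = false ∧ t' s = (t s).append [⟨p, .nec, true⟩] ∧ t' (!s) = t (!s)
  | none, none, bad =>
      bad = false ∧ t' s = (t s).append [⟨p, .cond, false⟩, ⟨q, .nec, false⟩] ∧
        t' (!s) = ⟨(t !s).slots ++ [⟨q, .cond, true⟩, ⟨p, .nec, true⟩], true⟩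
  | some _, some _, bad => bad = false ∧ t' s = t s ∧ t' (!s) = t (!s)

/-- In the merging step of a conflict on branch `s`, the second vertex of the other branch has the
entry of the only vertex that is left on branch `s`. -/
def MergeOK (s : Bool) (t : ITree n) : Prop :=
  ∀ u, cut (t s).slots = [u] → (t !s).slots ≠ [] →
    ∃ w c r, (t !s).slots = w :: c :: r ∧ c.e = u.e

variable {I : Fixings n} {t t' : ITree n} {s : Bool} {f g : Fin n × Bool}

theorem mergeOK_of_empty (h : t (!s) = .empty n) : MergeOK s t := by
  intro u _ hne
  simp [h, Branch.empty] at hne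

/-- A prefix of the first branch has `f` as its only vertex if one vertex is left after cutting. -/
theorem eq_of_cut_prefix {l r : List (Slot n)} {u : Slot n}
    (hl : l <+: Slot.mk' f .cond :: Slot.mk' g .nec :: r) (hc : cut l = [u]) :
    u = .mk' f .cond := by
  have : [u] <+: Slot.mk' f .cond :: Slot.mk' g .nec :: r := by
    rw [← hc]
    exact (cut_prefix l).trans hl
  simpa using this

/-- Branch `s` is the start of one of two branches with the first fixings `f`, `g` and `¬ g`, `¬ f`,
and the other branch is present. -/
def PreBranching (t : ITree n) (s : Bool) (f g : Fin n × Bool) : Prop :=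
  ∃ r₀ r₁, (t s).slots <+: .mk' f .cond :: .mk' g .nec :: r₀ ∧
    (t !s).slots = .mk' (conv g) .cond :: .mk' (conv f) .nec :: r₁

theorem Branching.pre (h : Branching t s f g) : PreBranching t s f g := by
  obtain ⟨r₀, r₁, h₀, h₁⟩ := h
  exact ⟨r₀, r₁, by rw [h₀], h₁⟩

theorem Branching.pre_update (h : Branching t s f g) {l : List (Slot n)} (hl : l <+: (t s).slots)
    {a : Bool} : PreBranching (Function.update t s ⟨l, a⟩) s f g := by
  obtain ⟨r₀, r₁, h₀, h₁⟩ := h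
  exact ⟨r₀, r₁, by simpa [h₀] using hl, by rw [Function.update_of_ne (by cases s <;> simp), h₁]⟩

/-- A single vertex that survives the cut is the first one, with the fixing `f`; the second vertex
of the other branch carries the converse of `f`. -/
theorem PreBranching.mergeOK (h : PreBranching t s f g) : MergeOK s t := by
  obtain ⟨r₀, r₁, h₀, h₁⟩ := h
  intro u hu _
  obtain rfl := eq_of_cut_prefix h₀ hu
  exact ⟨.mk' (conv g) .cond, .mk' (conv f) .nec, r₁, h₁, rfl⟩

/-- In the merging step the second vertex of the other branch has the converse fixing. -/
def MergeConv (s : Bool) (t : ITree n) : Prop :=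
  ∀ u w c r, cut (t s).slots = [u] → (t !s).slots = w :: c :: r →
    w.k = .cond ∧ c = ⟨u.e, .nec, !u.v⟩

theorem mergeConv_of_empty (h : t (!s) = .empty n) : MergeConv s t := by
  intro u w c r _ hne
  simp [h, Branch.empty] at hne

theorem PreBranching.mergeConv (h : PreBranching t s f g) : MergeConv s t := by
  obtain ⟨r₀, r₁, h₀, h₁⟩ := h
  intro u w c r hu hw
  obtain rfl := eq_of_cut_prefix h₀ hu
  rw [h₁] at hw
  simp only [List.cons.injEq] at hw
  obtain ⟨rfl, rfl, rfl⟩ := hw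
  exact ⟨rfl, rfl⟩

/-- Without a conditional vertex on the branch, a vector that does not respect all of it violates
the first necessary fixing that it misses. -/
theorem ConflictRel.violates (h : ConflictRel s t t' true) (x : Vec n) :
    Violates x (t s).slots ∨ Respects x (t s).slots := by
  cases h with
  | bad h => rw [violates_or_respects_cut, h]; simp

/-- In a conflict the vectors that respect the branch become violating. After the cut the branch is
`l` followed by a conditional `u`. Respecting both means respecting `l` and missing the converse of
`u`, so the converse becomes a necessary fixing behind `l`. If `l` is empty and a sibling `w`
exists, the new necessary fixing belongs at the root; the other branch already has it behind `w`, so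
moving it before `w` covers both. -/
theorem ConflictRel.semantics (h : ConflictRel s t t' false) (hm : MergeConv s t) (x : Vec n) :
    (Violates x (t' s).slots ∨ Violates x (t' !s).slots ↔
      (Violates x (t s).slots ∨ Respects x (t s).slots) ∨ Violates x (t !s).slots) ∧
    (t' s).loose = false ∧ (t' !s).loose = (t !s).loose ∧
    (Respects x (t' !s).slots ↔ Respects x (t !s).slots) := by
  rw [violates_or_respects_cut]
  cases h with
  | merge u w c r hu ho h1 h2 =>
    obtain ⟨hw, rfl⟩ := hm u w c r hu ho
    have huc := cut_last_cond (l' := []) hu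
    rw [hu, h1, h2, ho]
    refine ⟨?_, rfl, rfl, ?_⟩
    · rw [violates_cons_cond huc, violates_cons_cond hw,
        violates_cons_nec (v := ⟨u.e, .nec, !u.v⟩) rfl, violates_cons_cond hw,
        violates_cons_nec (v := ⟨u.e, .nec, !u.v⟩) rfl]
      simp [huc, Branch.empty]
      tauto
    · simp
      tauto
  | flip l u hu hl h1 h2 =>
    have huc := cut_last_cond hu
    rw [hu, h1, h2]
    refine ⟨?_, rfl, rfl, Iff.rfl⟩
    simp only [violates_append, violates_cons_nec, violates_cons_cond huc, respects_append,
      respects_cons]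
    simp [huc]

end Trees

end Symresack

/-! ### Consistency and meaning of one branch under conflicts and fixings. -/

namespace Symresack

variable {n : ℕ} {I J : Fixings n} {t t' : ITree n} {s : Bool} {f g : Fin n × Bool}

section WF

theorem update_not (t : ITree n) (s : Bool) (B : Branch n) :
    Function.update t s B (!s) = t (!s) :=
  Function.update_of_ne (by cases s <;> simp) _ _

theorem Fixed.mono (hIJ : I ≤ J) {e : Fin n} (h : Fixed I e) : Fixed J e :=
  let ⟨b, hb⟩ := h
  ⟨b, hIJ b hb⟩

theorem fixed_applyFixing {f : Fin n × Bool} {e : Fin n} :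
    Fixed (applyFixing I f) e ↔ e = f.1 ∨ Fixed I e := by
  simp only [Fixed, mem_applyFixing, Prod.ext_iff]
  constructor
  · rintro ⟨b, h | h⟩
    · exact Or.inl h.1
    · exact Or.inr ⟨b, h⟩
  · rintro (h | ⟨b, h⟩)
    · exact ⟨f.2, Or.inl ⟨h, rfl⟩⟩
    · exact ⟨b, Or.inr h⟩

theorem BranchWF.of_prefix {B : Branch n} (h : BranchWF I B) {l : List (Slot n)}
    (hl : l <+: B.slots) (a : Bool) : BranchWF I ⟨l, a⟩ := by
  refine ⟨h.nodup.sublist (hl.sublist.map _), fun v hv => h.dead v (hl.subset hv), ?_⟩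
  intro v hv
  apply h.head
  cases l with
  | nil => simp at hv
  | cons w l =>
    obtain ⟨r, hr⟩ := hl
    simpa [← hr] using hv

/-- On a branch no two vertices have the same entry. -/
theorem BranchWF.ne_of_split {B : Branch n} (h : BranchWF I B) {l r : List (Slot n)} {v : Slot n}
    (hs : B.slots = l ++ v :: r) : ∀ w ∈ l ++ r, w.e ≠ v.e := by
  intro w hw he
  have := h.nodup
  rw [hs, List.map_append, List.map_cons, List.nodup_append, List.nodup_cons] at this
  rcases List.mem_append.1 hw with hw | hw
  · exact this.2.2 w.e (List.mem_map_of_mem hw) v.e (by simp) he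
  · exact this.2.1.1 (he ▸ List.mem_map_of_mem hw)

theorem ConflictRel.branchWF {bad : Bool} (h : ConflictRel s t t' bad) (hw : BranchWF I (t s)) :
    BranchWF I (t' s) ∧ (t' s).loose = false := by
  cases h with
  | bad _ h1 => rw [h1]; exact ⟨branchWF_empty I, rfl⟩
  | merge u w c r _ _ h1 => rw [h1]; exact ⟨branchWF_empty I, rfl⟩
  | flip l u hu _ h1 =>
    have h := hw.of_prefix (hu ▸ cut_prefix (t s).slots) false
    have huc := cut_last_cond hu
    rw [h1]
    refine ⟨⟨?_, ?_, ?_⟩, rfl⟩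
    · simpa using h.nodup
    · intro v hv
      simp only [List.mem_append, List.mem_singleton] at hv
      rcases hv with hv | rfl
      · exact h.dead v (by simp [hv])
      · have := h.dead u (by simp)
        simp only [huc, reduceCtorEq, false_iff] at this
        simpa using this
    · intro v hv
      cases l with
      | nil => simp at hv; simp [← hv]
      | cons w l => exact h.head v (by simpa using hv)

theorem ConflictRel.branchWF_other {bad : Bool} (h : ConflictRel s t t' bad)
    (hw : BranchWF I (t !s)) (hm : MergeConv s t) : BranchWF I (t' !s) := by
  cases h with
  | bad _ _ h2 => rwa [h2]
  | merge u w c r hu ho _ h2 =>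
    obtain ⟨hwk, hc⟩ := hm u w c r hu ho
    obtain ⟨h1, h3, -⟩ := hw
    rw [ho] at h1 h3
    rw [h2]
    refine ⟨?_, ?_, by simp [hc]⟩
    · simp only [List.map_cons, List.nodup_cons, List.mem_cons, not_or] at h1 ⊢
      tauto
    · intro v hv
      apply h3
      simp only [List.mem_cons] at hv ⊢
      tauto
  | flip _ _ _ _ _ h2 => rwa [h2]

theorem ConflictRel.known_other {bad : Bool} (h : ConflictRel s t t' bad) (e : Fin n)
    (hk : Known I (t !s) e) : Known I (t' !s) e := by
  cases h with
  | bad _ _ h2 => rwa [h2]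
  | merge u w c r hu ho _ h2 =>
    rcases hk with hk | ⟨v, hv, he⟩
    · exact Or.inl hk
    · refine Or.inr ⟨v, ?_, he⟩
      rw [h2]
      rw [ho] at hv
      simp only [List.mem_cons] at hv ⊢
      tauto
  | flip _ _ _ _ _ h2 => rwa [h2]

theorem ConflictRel.other_of_empty {bad : Bool} (h : ConflictRel s t t' bad)
    (he : t (!s) = .empty n) : t' (!s) = .empty n := by
  cases h with
  | bad _ _ h2 => rwa [h2]
  | merge u w c r hu ho _ h2 => simp [he, Branch.empty] at ho
  | flip _ _ _ _ _ h2 => rwa [h2]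

/-- A nonempty start of a branching begins with the conditional vertex `f`, so the cut leaves
something and no infeasibility arises. Either the branch is merged away, or the flipped vertex lies
behind the first two and the branching persists. -/
theorem ConflictRel.shape {bad : Bool} (h : ConflictRel s t t' bad) (hb : PreBranching t s f g)
    (hne : (t s).slots ≠ []) : bad = false ∧ (t' s = .empty n ∨ Branching t' s f g) := by
  obtain ⟨r₀, r₁, h₀, h₁⟩ := hb
  have hcut : cut (t s).slots <+: .mk' f .cond :: .mk' g .nec :: r₀ :=
    (cut_prefix _).trans h₀
  cases h with
  | bad hc =>
    rcases hl : (t s).slots with _ | ⟨v, l⟩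
    · exact absurd hl hne
    · rw [hl] at hc h₀
      obtain ⟨rfl, -⟩ := List.cons_prefix_cons.1 h₀
      simp [cut, Slot.mk'] at hc
  | merge u w c r hu ho h1 h2 => exact ⟨rfl, Or.inl h1⟩
  | flip l u hu hl h1 h2 =>
    refine ⟨rfl, Or.inr ?_⟩
    have huc := cut_last_cond hu
    rw [hu] at hcut
    -- The vertex `u` is not the first one, because then the other branch would have no vertex, and
    -- not the second one, which is necessary instead of conditional.
    rcases l with _ | ⟨a, _ | ⟨b, l⟩⟩
    · simp [hl rfl] at h₁
    · simp only [List.cons_append, List.nil_append, List.cons_prefix_cons] at hcut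
      rw [hcut.2.1] at huc
      simp [Slot.mk'] at huc
    · simp only [List.cons_append, List.cons_prefix_cons] at hcut
      obtain ⟨rfl, rfl, -⟩ := hcut
      exact ⟨l ++ [⟨u.e, .nec, !u.v⟩], r₁, by simp [h1], by rw [h2, h₁]⟩

end WF

section Fix

variable {i : Fin n} {b : Bool} {x : Vec n}

theorem FixRel.eq_of_empty {bad : Bool} (h : FixRel s i b t t' bad) (he : t s = .empty n) :
    t' = t ∧ bad = false := by
  cases h with
  | none _ h1 h2 => exact ⟨funext ((forall_bool s).2 ⟨h1, h2⟩), rfl⟩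
  | hit l r v hs => simp [he, Branch.empty] at hs
  | missCond l r v hs => simp [he, Branch.empty] at hs
  | missNec l r v t₁ bad hs => simp [he, Branch.empty] at hs

/-- A vertex whose fixing is respected by the vector has no effect, whether it is conditional or
necessary. -/
theorem violates_kill {l r : List (Slot n)} {v : Slot n} (hv : x v.e = v.v) (hk : v.k ≠ .dead) :
    Violates x (l ++ ⟨v.e, .dead, v.v⟩ :: r) ↔ Violates x (l ++ v :: r) := by
  rw [violates_append, violates_append, violates_cons_dead rfl]
  rcases h : v.k with _ | _ | _
  · exact absurd h hk
  · rw [violates_cons_cond h]; simp [hv]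
  · rw [violates_cons_nec h]; simp [hv]

theorem respects_kill {l r : List (Slot n)} {v : Slot n} (hv : x v.e = v.v) :
    Respects x (l ++ ⟨v.e, .dead, v.v⟩ :: r) ↔ Respects x (l ++ v :: r) := by
  simp [hv]

/-- A fixing keeps a branch consistent. -/
theorem FixRel.branchWF {bad : Bool} (h : FixRel s i b t t' bad) (hw : BranchWF I (t s))
    (hi : ¬ Fixed I i) : BranchWF (applyFixing I (i, b)) (t' s) := by
  -- a part of a branch without the entry `i`
  have key : ∀ B : Branch n, BranchWF I B → (∀ v ∈ B.slots, v.e ≠ i) →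
      BranchWF (applyFixing I (i, b)) B := by
    intro B hB hne
    refine ⟨hB.nodup, fun v hv => ?_, hB.head⟩
    rw [hB.dead v hv, fixed_applyFixing]
    simp [hne v hv]
  have ktrim : ∀ J, ∀ B : Branch n, BranchWF J B → BranchWF J ⟨trim B.slots, B.loose⟩ :=
    fun J B hB => ⟨hB.nodup.sublist (trim_suffix.sublist.map _),
      fun v hv => hB.dead v (trim_suffix.subset hv), trim_head⟩
  cases h with
  | none hd h1 =>
    rw [h1]
    refine key _ hw fun v hv he => hi ?_
    rw [← he, ← hw.dead v hv]
    exact hd v hv he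
  | hit l r v hs he hk hv h1 =>
    have hne := hw.ne_of_split hs
    rw [h1]
    refine ⟨?_, ?_, trim_head⟩
    · have : ((l ++ ⟨v.e, .dead, v.v⟩ :: r).map Slot.e).Nodup := by
        simpa [hs] using hw.nodup
      exact this.sublist (trim_suffix.sublist.map _)
    · intro w hw'
      have := trim_suffix.subset hw'
      rw [List.mem_append, List.mem_cons] at this
      rw [fixed_applyFixing]
      have h2 : ∀ w ∈ l ++ r, w.k = .dead ↔ w.e = i ∨ Fixed I w.e := by
        intro w hw'
        rw [hw.dead w (by rw [hs]; simp at hw' ⊢; tauto)]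
        have := hne w hw'
        rw [he] at this
        simp [this]
      rcases this with h | rfl | h
      · exact h2 w (by simp [h])
      · simp [he]
      · exact h2 w (by simp [h])
  | missCond l r v hs he hk hv h1 =>
    have hne := hw.ne_of_split hs
    rw [h1]
    refine ktrim _ ⟨l, false⟩ (key _ (hw.of_prefix (by simp [hs]) _) fun w hw' => ?_)
    rw [← he]
    exact hne w (List.mem_append_left _ hw')
  | missNec l r v t₁ bad hs he hk hv hc h1 =>
    have hne := hw.ne_of_split hs
    rw [h1]
    refine ktrim _ (t₁ s) (hc.branchWF ?_).1
    rw [Function.update_self]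
    refine key _ (hw.of_prefix (by simp [hs]) _) fun w hw' => ?_
    rw [← he]
    exact hne w (List.mem_append_left _ hw')

/-- What is known on a branch stays known. -/
theorem FixRel.known {bad : Bool} (h : FixRel s i b t t' bad) (hw : BranchWF I (t s))
    (hl : (t' s).loose = true) :
    (t s).loose = true ∧
      ∀ e, Known (applyFixing I (i, b)) (t s) e → Known (applyFixing I (i, b)) (t' s) e := by
  cases h with
  | none _ h1 => rw [h1] at hl ⊢; exact ⟨hl, fun _ => id⟩
  | hit l r v hs he hk hv h1 =>
    rw [h1] at hl
    refine ⟨hl, ?_⟩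
    rintro e (h | ⟨w, hw', rfl⟩)
    · exact Or.inl h
    by_cases hwe : w.e = i
    · exact Or.inl (fixed_applyFixing.2 (Or.inl hwe))
    have hmem : w ∈ l ++ ⟨v.e, .dead, v.v⟩ :: r := by
      rw [hs] at hw'
      simp only [List.mem_append, List.mem_cons] at hw' ⊢
      rcases hw' with h | rfl | h
      · exact Or.inl h
      · exact absurd he hwe
      · exact Or.inr (Or.inr h)
    rcases mem_trim hmem with hd | hd
    · refine Or.inl (Fixed.mono (le_applyFixing _ _) ((hw.dead w ?_).1 hd))
      exact hw'
    · exact Or.inr ⟨w, by rwa [h1], rfl⟩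
  | missCond l r v hs he hk hv h1 => simp [h1] at hl
  | missNec l r v t₁ bad hs he hk hv hc h1 =>
    rw [h1] at hl
    have : (t₁ s).loose = true := hl
    rw [hc.branchWF (I := I) (by
      rw [Function.update_self]; exact hw.of_prefix (by simp [hs]) _) |>.2] at this
    simp at this

/-- The effect on the semantics, unless the other branch is removed. -/
theorem FixRel.semantics (h : FixRel s i b t t' false) (hx : x i = b)
    (hm : ∀ l r v, (t s).slots = l ++ v :: r → v.e = i → v.k = .nec → v.v = (!b) →
      MergeConv s (Function.update t s ⟨l, false⟩))
    (hrem : ∀ v r, (t s).slots = v :: r → v.e = i → v.v = b → t (!s) = .empty n) :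
    (Violates x (t' s).slots ∨ Violates x (t' !s).slots ↔
      Violates x (t s).slots ∨ Violates x (t !s).slots) ∧
    ((t' s).Loose x ↔ (t s).Loose x) ∧ ((t' !s).Loose x ↔ (t !s).Loose x) := by
  have hx' : x i ≠ !b := by rw [hx]; cases b <;> simp
  cases h with
  | none _ h1 h2 => rw [h1, h2]; simp
  | hit l r v hs he hk hv h1 h2 =>
    have hxv : x v.e = v.v := by rw [he, hv, hx]
    have h3 : t' (!s) = t (!s) := by
      rw [h2]
      split_ifs with hc
      · simp only [List.isEmpty_iff] at hc
        exact (hrem v r (by simpa [hc.1] using hs) he hv).symm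
      · rfl
    simp only [h1, h3, Branch.Loose, hs, violates_trim, respects_trim, violates_kill hxv hk,
      respects_kill hxv, and_self]
  | missCond l r v hs he hk hv h1 h2 =>
    rw [h1, h2]
    simp [hs, Branch.Loose, violates_append, violates_cons_cond hk, hk, he, hv, hx]
  | missNec l r v t₁ bad hs he hk hv hc h1 h2 =>
    obtain ⟨a1, a2, a3, a4⟩ := hc.semantics (hm l r v hs he hk hv) x
    rw [update_not, Function.update_self] at a1
    rw [update_not] at a3 a4
    rw [h1, h2]
    simp only [violates_trim, respects_trim, Branch.Loose]
    refine ⟨a1.trans ?_, ?_, by rw [a3, a4]⟩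
    · rw [hs, violates_append, violates_cons_nec hk, he, hv]
      simp [hx']
    · simp [a2, hs, hk, he, hv, hx]

/-- Infeasibility means that no conditional vertex precedes the necessary one. So a vector violates
the part before it, or it respects this part and then misses the vertex. -/
theorem FixRel.violates_of_bad (h : FixRel s i b t t' true) (hx : x i = b) :
    Violates x (t s).slots := by
  cases h with
  | missNec l r v t₁ bad hs he hk hv hc h1 h2 =>
    have := hc.violates x
    rw [Function.update_self] at this
    rw [hs, violates_append, violates_cons_nec hk, he, hv, hx]
    simpa using this

theorem FixRel.empty_of_bad (h : FixRel s i b t t' true) : t' s = .empty n := by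
  cases h with
  | missNec l r v t₁ bad hs he hk hv hc h1 h2 =>
    cases hc with
    | bad _ h => rw [h1, h]; rfl

theorem FixRel.other_of_empty {bad : Bool} (h : FixRel s i b t t' bad) (he : t (!s) = .empty n) :
    t' (!s) = .empty n := by
  cases h with
  | none _ _ h2 => rw [h2, he]
  | hit l r v hs hvi hk hv h1 h2 =>
    rw [h2]
    split_ifs
    · rfl
    · exact he
  | missCond l r v hs hvi hk hv h1 h2 => rw [h2, he]
  | missNec l r v t₁ bad hs hvi hk hv hc h1 h2 =>
    rw [h2]
    exact hc.other_of_empty (by rwa [update_not])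

end Fix

end Symresack

/-! ### A fixing applied to the two branches of a tree in turn. -/

namespace Symresack

variable {n : ℕ} {I J : Fixings n} {t t' t₁ t₂ : ITree n} {s : Bool} {f g : Fin n × Bool}
  {i : Fin n} {b : Bool} {x : Vec n} {bad bad₁ bad₂ : Bool}

/-- The merging step is sound whenever the fixing `(i, b)` leads to a conflict. -/
def FixMergeOK (s : Bool) (i : Fin n) (b : Bool) (t : ITree n) : Prop :=
  ∀ l r v, (t s).slots = l ++ v :: r → v.e = i → v.k = .nec → v.v = (!b) →
    MergeOK s (Function.update t s ⟨l, false⟩) ∧ MergeConv s (Function.update t s ⟨l, false⟩)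

theorem fixMergeOK_of_empty (h : t (!s) = .empty n) : FixMergeOK s i b t :=
  fun _ _ _ _ _ _ _ => ⟨mergeOK_of_empty (by rwa [update_not]),
    mergeConv_of_empty (by rwa [update_not])⟩

theorem Branching.fixMergeOK (h : Branching t s f g) : FixMergeOK s i b t :=
  fun l r v hs _ _ _ =>
    have := h.pre_update (l := l) (a := false) (by simp [hs])
    ⟨this.mergeOK, this.mergeConv⟩

theorem TreeWF.fixMergeOK (h : TreeWF I t) : FixMergeOK false i b t := by
  rcases h.shape with ⟨s, hs⟩ | ⟨f, g, hb⟩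
  · cases s
    · exact fixMergeOK_of_empty hs
    · intro l r v h
      have : t false = .empty n := hs
      simp [this, Branch.empty] at h
  · exact hb.fixMergeOK

/-- The effect of the fixing `(i, b)` on the tree. -/
structure FixInv (I : Fixings n) (i : Fin n) (b : Bool) (t t' : ITree n) (bad : Bool) : Prop where
  known : ∀ s, (t' s).loose = true → (t s).loose = true ∧
    ∀ e, Known (applyFixing I (i, b)) (t s) e → Known (applyFixing I (i, b)) (t' s) e
  sem : bad = false → ∀ x : Vec n, x i = b →
    (TViolates x t' ↔ TViolates x t) ∧ (TLoose x t' ↔ TLoose x t)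
  bad : bad = true → (∀ x : Vec n, x i = b → TViolates x t) ∧ ∀ s, t' s = .empty n

theorem FixInv.trans (h₁ : FixInv I i b t t₁ bad₁) (h₂ : FixInv I i b t₁ t₂ bad₂)
    (hb : bad₁ = true → t₂ = t₁) : FixInv I i b t t₂ (bad₁ || bad₂) := by
  refine ⟨fun s hs => ?_, fun hbad x hx => ?_, fun hbad => ?_⟩
  · obtain ⟨h3, h4⟩ := h₂.known s hs
    obtain ⟨h5, h6⟩ := h₁.known s h3
    exact ⟨h5, fun e he => h4 e (h6 e he)⟩
  · rw [Bool.or_eq_false_iff] at hbad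
    obtain ⟨h3, h4⟩ := h₂.sem hbad.2 x hx
    obtain ⟨h5, h6⟩ := h₁.sem hbad.1 x hx
    exact ⟨h3.trans h5, h4.trans h6⟩
  · cases hb1 : bad₁ with
    | true => rw [hb hb1]; exact h₁.bad hb1
    | false =>
      have hb2 : bad₂ = true := by simpa [hb1] using hbad
      exact ⟨fun x hx => (h₁.sem hb1 x hx).1.1 ((h₂.bad hb2).1 x hx), (h₂.bad hb2).2⟩

theorem FixInv.refl : FixInv I i b t t false :=
  ⟨fun _ h => ⟨h, fun _ => id⟩, fun _ _ _ => ⟨Iff.rfl, Iff.rfl⟩, fun h => by simp at h⟩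

/-- The effect on the other branch, unless it is removed. -/
theorem FixRel.other (h : FixRel s i b t t' bad) (hm : FixMergeOK s i b t)
    (hrem : ∀ v r, (t s).slots = v :: r → v.e = i → v.v = b → t (!s) = .empty n) :
    (∀ J, BranchWF J (t !s) → BranchWF J (t' !s)) ∧
    ((t' !s).loose = true → (t !s).loose = true) ∧
    ∀ J e, Known J (t !s) e → Known J (t' !s) e := by
  cases h with
  | none _ _ h2 => rw [h2]; exact ⟨fun _ => id, id, fun _ _ => id⟩
  | hit l r v hs hvi hk hv h1 h2 =>
    have h3 : t' (!s) = t (!s) := by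
      rw [h2]
      split_ifs with hc
      · simp only [List.isEmpty_iff] at hc
        exact (hrem v r (by simpa [hc.1] using hs) hvi hv).symm
      · rfl
    rw [h3]; exact ⟨fun _ => id, id, fun _ _ => id⟩
  | missCond l r v hs hvi hk hv h1 h2 => rw [h2]; exact ⟨fun _ => id, id, fun _ _ => id⟩
  | missNec l r v t₁ bad hs hvi hk hv hc h1 h2 =>
    obtain ⟨-, hm⟩ := hm l r v hs hvi hk hv
    rw [h2]
    refine ⟨fun J hJ => hc.branchWF_other (by rwa [update_not]) hm, ?_,
      fun J e hk => hc.known_other e (by rwa [update_not])⟩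
    cases bad with
    | true =>
      cases hc with
      | bad _ _ h => rw [h, update_not]; exact id
    | false =>
      rw [(hc.semantics hm (fun _ => false)).2.2.1, update_not]
      exact id

theorem FixRel.fixInv (h : FixRel s i b t t' bad) (hw : BranchWF I (t s))
    (hm : FixMergeOK s i b t)
    (hrem : ∀ v r, (t s).slots = v :: r → v.e = i → v.v = b → t (!s) = .empty n)
    (hbad : bad = true → t (!s) = .empty n) : FixInv I i b t t' bad := by
  refine ⟨(forall_bool s).2 ⟨h.known hw, fun hl => ?_⟩, ?_, ?_⟩
  · obtain ⟨-, h1, h2⟩ := h.other hm hrem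
    exact ⟨h1 hl, h2 _⟩
  · rintro rfl x hx
    obtain ⟨h1, h2, h3⟩ :=
      h.semantics hx (fun l r v a1 a2 a3 a4 => (hm l r v a1 a2 a3 a4).2) hrem
    rw [TViolates, TViolates, TLoose, TLoose, exists_bool s, exists_bool s, exists_bool s,
      exists_bool s, h2, h3]
    exact ⟨h1, Iff.rfl⟩
  · rintro rfl
    exact ⟨fun x hx => ⟨s, h.violates_of_bad hx⟩,
      (forall_bool s).2 ⟨h.empty_of_bad, h.other_of_empty (hbad rfl)⟩⟩

theorem Branching.ne (h : Branching t s f g) (hw : BranchWF I (t s)) : f.1 ≠ g.1 := by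
  obtain ⟨r₀, r₁, h₀, -⟩ := h
  have := hw.nodup
  rw [h₀] at this
  simp [Slot.mk'] at this
  exact this.1.1

theorem split_unique {l₁ l₂ r₁ r₂ : List (Slot n)} {v w : Slot n}
    (hn : ((l₁ ++ v :: r₁).map Slot.e).Nodup) (h : l₁ ++ v :: r₁ = l₂ ++ w :: r₂)
    (he : v.e = w.e) : l₁ = l₂ ∧ v = w ∧ r₁ = r₂ := by
  induction l₁ generalizing l₂ with
  | nil =>
    cases l₂ with
    | nil => simpa using h
    | cons a l₂ =>
      obtain ⟨rfl, rfl⟩ : v = a ∧ r₁ = l₂ ++ w :: r₂ := by simpa using h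
      simp [he] at hn
  | cons a l₁ ih =>
    cases l₂ with
    | nil =>
      obtain ⟨rfl, rfl⟩ : a = w ∧ l₁ ++ v :: r₁ = r₂ := by simpa using h
      simp [he] at hn
    | cons c l₂ =>
      obtain ⟨rfl, h1⟩ : a = c ∧ l₁ ++ v :: r₁ = l₂ ++ w :: r₂ := by simpa using h
      obtain ⟨rfl, h2⟩ := ih (List.Nodup.of_cons hn) h1
      exact ⟨rfl, h2⟩

theorem BranchWF.split_unique {B : Branch n} (hw : BranchWF I B) {l₁ l₂ r₁ r₂ : List (Slot n)}
    {v w : Slot n} (h₁ : B.slots = l₁ ++ v :: r₁) (h₂ : B.slots = l₂ ++ w :: r₂)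
    (he : v.e = w.e) : l₁ = l₂ ∧ v = w ∧ r₁ = r₂ :=
  Symresack.split_unique (h₁ ▸ hw.nodup) (h₁ ▸ h₂) he

theorem violates_mk'_cond {l : List (Slot n)} :
    Violates x (.mk' f .cond :: l) ↔ x f.1 = f.2 ∧ Violates x l := Iff.rfl

theorem violates_mk'_nec {l : List (Slot n)} :
    Violates x (.mk' f .nec :: l) ↔ x f.1 ≠ f.2 ∨ Violates x l := Iff.rfl

theorem eq_of_split {a c v : Slot n} {l r r₀ : List (Slot n)} (h : a :: c :: r₀ = l ++ v :: r) :
    l = [] ∧ v = a ∨ l = [a] ∧ v = c ∨ ∃ l', l = a :: c :: l' ∧ r₀ = l' ++ v :: r := by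
  rcases l with _ | ⟨a', _ | ⟨c', l⟩⟩
  · simp at h; exact Or.inl ⟨rfl, h.1.symm⟩
  · simp at h; exact Or.inr (Or.inl ⟨by rw [h.1], h.2.1.symm⟩)
  · simp only [List.cons_append, List.cons.injEq] at h
    exact Or.inr (Or.inr ⟨l, by rw [h.1, h.2.1], h.2.2⟩)

theorem trim_cons {v : Slot n} {l : List (Slot n)} (h : v.k ≠ .dead) :
    trim (v :: l) = v :: l := List.dropWhile_cons_of_neg (by simpa using h)

/-- The affected vertex lies behind the first two, which therefore survive unless a conflict empties
the branch. -/
theorem FixRel.shape (h : FixRel s i b t t' bad) (hb : Branching t s f g) (hf : f.1 ≠ i)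
    (hg : g.1 ≠ i) : bad = false ∧ (t' s = .empty n ∨ Branching t' s f g) := by
  obtain ⟨r₀, r₁, h₀, h₁⟩ := id hb
  have split : ∀ l r v, (t s).slots = l ++ v :: r → v.e = i →
      ∃ l', l = .mk' f .cond :: .mk' g .nec :: l' := by
    intro l r v hs hv
    rw [h₀] at hs
    rcases eq_of_split hs with ⟨-, rfl⟩ | ⟨-, rfl⟩ | ⟨l', h, -⟩
    · exact absurd hv hf
    · exact absurd hv hg
    · exact ⟨l', h⟩
  cases h with
  | none hd h1 h2 => exact ⟨rfl, Or.inr ⟨r₀, r₁, by rw [h1, h₀], by rw [h2, h₁]⟩⟩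
  | hit l r v hs hvi hk hv h1 h2 =>
    obtain ⟨l', rfl⟩ := split l r v hs hvi
    refine ⟨rfl, Or.inr ⟨_, r₁, by rw [h1]; exact trim_cons (v := .mk' f .cond) (by simp [Slot.mk']), ?_⟩⟩
    rw [h2]
    simp [h₁]
  | missCond l r v hs hvi hk hv h1 h2 =>
    obtain ⟨l', rfl⟩ := split l r v hs hvi
    refine ⟨rfl, Or.inr ⟨_, r₁, by rw [h1]; exact trim_cons (v := .mk' f .cond) (by simp [Slot.mk']), ?_⟩⟩
    rw [h2, h₁]
  | missNec l r v t₁ bad hs hvi hk hv hc h1 h2 =>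
    obtain ⟨l', rfl⟩ := split l r v hs hvi
    obtain ⟨hbad, h3 | ⟨r₂, r₃, h3, h4⟩⟩ :=
      hc.shape (hb.pre_update (by simp [hs])) (by simp)
    · exact ⟨hbad, Or.inl (by rw [h1, h3]; rfl)⟩
    · refine ⟨hbad, Or.inr ⟨r₂, r₃, ?_, by rw [h2, h4]⟩⟩
      rw [h1, h3]
      exact trim_cons (v := .mk' f .cond) (by simp [Slot.mk'])

/-- A tree after the fixing `(i, b)` has been applied to the first branch. -/
structure Halfway (I : Fixings n) (i : Fin n) (b : Bool) (t : ITree n) : Prop where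
  branch : BranchWF (applyFixing I (i, b)) (t false)
  shape : t true = .empty n ∨ BranchWF I (t true) ∧ (t false = .empty n ∨
    (∃ f g, Branching t false f g ∧ f.1 ≠ i ∧ g.1 ≠ i) ∨
    ∃ r, (t true).slots = ⟨i, .cond, !b⟩ :: r)

/-- The interesting trees have two branches, starting with `f`, `g` and with `¬g`, `¬f`. If `f` is
applied, the second branch is dropped: its necessary fixing `¬f` fails, so it is violated exactly if
`g` fails, which the first branch, now with `g` at its front, expresses as well. If `¬f` is applied,
the first branch disappears. If `g` is applied, the second branch is left with a conditional first
vertex that fails, to be dealt with in the second update. If `¬g` is applied, the conflict leaves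
only `f` on the first branch, and merging empties it. Any other entry keeps the two front vertices
or empties the branch. -/
theorem TreeWF.fix_first (hw : TreeWF I t) (hi : ¬ Fixed I i) (h : FixRel false i b t t₁ bad) :
    Halfway I i b t₁ ∧ FixInv I i b t t₁ bad := by
  have hbr := h.branchWF (hw.branch false) hi
  rcases hw.shape with ⟨s, hs⟩ | ⟨f, g, hb⟩
  · cases s
    · exact ⟨⟨hbr, Or.inl (h.other_of_empty hs)⟩, h.fixInv (hw.branch false) hw.fixMergeOK
        (fun _ _ _ _ _ => hs) fun _ => hs⟩
    · obtain ⟨rfl, rfl⟩ := h.eq_of_empty hs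
      exact ⟨⟨hbr, Or.inr ⟨hw.branch true, Or.inl hs⟩⟩, .refl⟩
  · have hne := hb.ne (hw.branch false)
    obtain ⟨r₀, r₁, h₀, h₁⟩ := id hb
    have h₁' : (t true).slots = _ := h₁
    by_cases hfb : f = (i, b)
    · -- the first vertex is removed, together with the other branch
      subst hfb
      cases h with
      | none hd =>
        have := hd (.mk' (i, b) .cond) (by simp [h₀]) rfl
        simp [Slot.mk'] at this
      | hit l r v hs hvi hk hv h2 h3 =>
        obtain ⟨rfl, rfl, rfl⟩ := (hw.branch false).split_unique (l₂ := []) hs h₀ hvi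
        have h4 : t₁ true = .empty n := by simpa [h₁'] using h3
        refine ⟨⟨hbr, Or.inl h4⟩, ?_, fun _ x hx => ?_, by simp⟩
        · rintro (_ | _) hl
          · exact (FixRel.hit (t := t) (t' := t₁) [] _ _ hs hvi hk hv h2 h3).known
              (hw.branch false) hl
          · simp [h4, Branch.empty] at hl
        · have hxv : x (Slot.mk' (i, b) .cond : Slot n).e = (Slot.mk' (i, b) .cond : Slot n).v :=
            hx
          simp only [TViolates, TLoose, Bool.exists_bool, h4, not_loose_empty, or_false,
            not_violates_empty]
          simp only [h2, Branch.Loose, violates_trim, respects_trim, violates_kill hxv hk,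
            respects_kill hxv, ← hs]
          rw [h₁', h₀]
          constructor
          · simp only [violates_mk'_cond, violates_mk'_nec]
            simp only [hx, conv]
            by_cases h : x g.1 = g.2 <;> simp [h]
          · simp [Slot.mk', conv, hx]
      | missCond l r v hs hvi hk hv =>
        obtain ⟨rfl, rfl, rfl⟩ := (hw.branch false).split_unique (l₂ := []) hs h₀ hvi
        simp [Slot.mk'] at hv
      | missNec l r v t₁ bad hs hvi hk hv =>
        obtain ⟨rfl, rfl, rfl⟩ := (hw.branch false).split_unique (l₂ := []) hs h₀ hvi
        simp [Slot.mk'] at hv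
    have hrem : ∀ v r, (t false).slots = v :: r → v.e = i → v.v = b → t (!false) = .empty n := by
      intro v r hs hvi hv
      rw [h₀] at hs
      simp only [List.cons.injEq] at hs
      rw [← hs.1] at hvi hv
      exact absurd (Prod.ext hvi hv) hfb
    suffices bad = false ∧ (t₁ false = .empty n ∨
        (∃ f g, Branching t₁ false f g ∧ f.1 ≠ i ∧ g.1 ≠ i) ∨
        ∃ r, (t₁ true).slots = ⟨i, .cond, !b⟩ :: r) from
      ⟨⟨hbr, Or.inr ⟨(h.other hb.fixMergeOK hrem).1 I (hw.branch true), this.2⟩⟩,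
        h.fixInv (hw.branch false) hb.fixMergeOK hrem (by simp [this.1])⟩
    by_cases hf : f.1 = i
    · cases h with
      | none hd =>
        have := hd (.mk' f .cond) (by simp [h₀]) hf
        simp [Slot.mk'] at this
      | hit l r v hs hvi hk hv h2 h3 =>
        obtain ⟨rfl, rfl, rfl⟩ :=
          (hw.branch false).split_unique (l₂ := []) hs h₀ (hvi.trans hf.symm)
        exact absurd (Prod.ext hf hv) hfb
      | missCond l r v hs hvi hk hv h2 h3 =>
        obtain ⟨rfl, rfl, rfl⟩ :=
          (hw.branch false).split_unique (l₂ := []) hs h₀ (hvi.trans hf.symm)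
        exact ⟨rfl, Or.inl h2⟩
      | missNec l r v t₁ bad hs hvi hk hv =>
        obtain ⟨rfl, rfl, rfl⟩ :=
          (hw.branch false).split_unique (l₂ := []) hs h₀ (hvi.trans hf.symm)
        simp [Slot.mk'] at hk
    by_cases hg : g.1 = i
    · cases h with
      | none hd =>
        have := hd (.mk' g .nec) (by simp [h₀]) hg
        simp [Slot.mk'] at this
      | hit l r v hs hvi hk hv h2 h3 =>
        obtain ⟨rfl, rfl, rfl⟩ :=
          (hw.branch false).split_unique (l₂ := [.mk' f .cond]) hs h₀ (hvi.trans hg.symm)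
        refine ⟨rfl, Or.inr (Or.inr ⟨.mk' (conv f) .nec :: r₁, ?_⟩)⟩
        have h4 : t₁ true = t true := by simpa using h3
        rw [h4, h₁', ← hvi, ← hv]
        rfl
      | missCond l r v hs hvi hk hv h2 h3 =>
        obtain ⟨rfl, rfl, rfl⟩ :=
          (hw.branch false).split_unique (l₂ := [.mk' f .cond]) hs h₀ (hvi.trans hg.symm)
        simp [Slot.mk'] at hk
      | missNec l r v t₂ bad hs hvi hk hv hc h2 h3 =>
        obtain ⟨rfl, rfl, rfl⟩ :=
          (hw.branch false).split_unique (l₂ := [.mk' f .cond]) hs h₀ (hvi.trans hg.symm)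
        have hcut : cut [Slot.mk' f .cond] = [.mk' f .cond] := by simp [cut, Slot.mk']
        refine ⟨(hc.shape (hb.pre_update (by simp [hs])) (by simp)).1, Or.inl ?_⟩
        have : t₂ false = .empty n := by
          cases hc with
          | bad _ h => exact h
          | merge _ _ _ _ _ _ h => exact h
          | flip l u hu hl =>
            rw [Function.update_self, hcut] at hu
            have hl' : l = [] := by
              rcases l with _ | ⟨a, l⟩
              · rfl
              · simp at hu
            have := hl hl'
            rw [update_not, h₁] at this
            simp at this
        rw [h2, this]
        rfl
    · obtain ⟨hbad, h⟩ := h.shape hb hf hg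
      exact ⟨hbad, h.imp_right fun h => Or.inl ⟨f, g, h, hf, hg⟩⟩

theorem Halfway.fixMergeOK (h : Halfway I i b t) : FixMergeOK true i b t := by
  rcases h.shape with h1 | ⟨hw, h1 | ⟨f, g, h1, -, -⟩ | ⟨r, h1⟩⟩
  · intro l r v hs
    simp [h1, Branch.empty] at hs
  · exact fixMergeOK_of_empty h1
  · exact h1.symm.fixMergeOK
  · intro l r v hs hvi hk hv
    obtain ⟨rfl, rfl, rfl⟩ := hw.split_unique (l₂ := []) hs h1 hvi
    simp at hk

/-- By `Halfway` the front vertex of this branch can carry the applied fixing only if the first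
branch is already empty, so nothing is lost there. If the front vertex has the converse fixing as
recorded in the last alternative, it is conditional and the whole branch goes. -/
theorem Halfway.fix_second (hw : Halfway I i b t) (hi : ¬ Fixed I i)
    (h : FixRel true i b t t₁ bad) :
    TreeWF (applyFixing I (i, b)) t₁ ∧ FixInv I i b t t₁ bad := by
  rcases hw.shape with h1 | ⟨hwt, h1⟩
  · obtain ⟨rfl, rfl⟩ := h.eq_of_empty h1
    refine ⟨⟨(forall_bool false).2 ⟨hw.branch, ?_⟩, Or.inl ⟨false, h1⟩⟩, .refl⟩
    simpa [h1] using branchWF_empty _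
  have hbr := h.branchWF hwt hi
  have hrem : ∀ v r, (t true).slots = v :: r → v.e = i → v.v = b → t (!true) = .empty n := by
    intro v r hs hvi hv
    rcases h1 with h1 | ⟨f, g, ⟨r₀, r₁, h2, h3⟩, hf, hg⟩ | ⟨r, h1⟩
    · exact h1
    · have h3' : (t true).slots = _ := h3
      rw [hs] at h3'
      simp only [List.cons.injEq] at h3'
      rw [h3'.1] at hvi
      exact absurd hvi hg
    · rw [hs] at h1
      simp only [List.cons.injEq] at h1
      rw [h1.1] at hv
      cases b <;> simp at hv
  have hother := (h.other hw.fixMergeOK hrem).1 _ hw.branch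
  suffices (bad = true → t false = .empty n) ∧ ((∃ s, t₁ (!s) = .empty n) ∨
      ∃ f g, Branching t₁ false f g) from
    ⟨⟨(forall_bool true).2 ⟨hbr, hother⟩, this.2⟩,
      h.fixInv hwt hw.fixMergeOK hrem this.1⟩
  rcases h1 with h1 | ⟨f, g, hb, hf, hg⟩ | ⟨r, h1⟩
  · exact ⟨fun _ => h1, Or.inl ⟨true, h.other_of_empty h1⟩⟩
  · obtain ⟨hbad, h2 | h2⟩ := h.shape hb.symm hg hf
    · exact ⟨by simp [hbad], Or.inl ⟨false, h2⟩⟩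
    · refine ⟨by simp [hbad], Or.inr ⟨f, g, ?_⟩⟩
      simpa using h2.symm
  · cases h with
    | none hd =>
      have := hd ⟨i, .cond, !b⟩ (by simp [h1]) rfl
      simp at this
    | hit l r v hs hvi hk hv h2 h3 =>
      obtain ⟨rfl, rfl, rfl⟩ := hwt.split_unique (l₂ := []) hs h1 hvi
      cases b <;> simp at hv
    | missCond l r v hs hvi hk hv h2 h3 =>
      obtain ⟨rfl, rfl, rfl⟩ := hwt.split_unique (l₂ := []) hs h1 hvi
      exact ⟨by simp, Or.inl ⟨false, h2⟩⟩
    | missNec l r v t₂ bad hs hvi hk hv hc h2 h3 =>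
      obtain ⟨rfl, rfl, rfl⟩ := hwt.split_unique (l₂ := []) hs h1 hvi
      simp at hk

/-- A fixing keeps the tree consistent, and does not change its meaning. -/
theorem TreeWF.fix (hw : TreeWF I t) (hi : ¬ Fixed I i) (h₁ : FixRel false i b t t₁ bad₁)
    (h₂ : FixRel true i b t₁ t₂ bad₂) :
    TreeWF (applyFixing I (i, b)) t₂ ∧ FixInv I i b t t₂ (bad₁ || bad₂) := by
  obtain ⟨h3, h4⟩ := hw.fix_first hi h₁
  obtain ⟨h5, h6⟩ := h3.fix_second hi h₂
  -- If the first update finds infeasibility, both branches are empty and the second update has no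
  -- effect.
  exact ⟨h5, h4.trans h6 fun hb => (h₂.eq_of_empty ((h4.bad hb).2 true)).1⟩

end Symresack

/-! ### Replacing loose ends, and the invariant that ties a tree to its permutation. -/

namespace Symresack

variable {n : ℕ} {I J : Fixings n} {t t' t₁ t₂ : ITree n} {s : Bool} {f g : Fin n × Bool}
  {i : Fin n} {b : Bool} {x : Vec n} {bad bad₁ bad₂ : Bool} {p q : Fin n}

theorem TreeWF.shape_at (hw : TreeWF I t) (s : Bool) :
    t s = .empty n ∨ t (!s) = .empty n ∨ ∃ f g, Branching t s f g := by
  rcases hw.shape with ⟨s', h⟩ | ⟨f, g, h⟩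
  · cases s <;> cases s' <;> simp_all
  · cases s
    · exact Or.inr (Or.inr ⟨f, g, h⟩)
    · exact Or.inr (Or.inr ⟨_, _, h.symm⟩)

theorem TreeWF.of_shape_at (hb : ∀ s, BranchWF I (t s))
    (h : t s = .empty n ∨ t (!s) = .empty n ∨ ∃ f g, Branching t s f g) : TreeWF I t := by
  refine ⟨hb, ?_⟩
  rcases h with h | h | ⟨f, g, h⟩
  · exact Or.inl ⟨!s, by simpa using h⟩
  · exact Or.inl ⟨s, h⟩
  · cases s
    · exact Or.inr ⟨f, g, h⟩
    · exact Or.inr ⟨_, _, h.symm⟩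

theorem TreeWF.merge (hw : TreeWF I t) (s : Bool) : MergeOK s t ∧ MergeConv s t := by
  rcases hw.shape_at s with h | h | ⟨f, g, h⟩
  · constructor
    · intro u hu
      simp [h, Branch.empty, cut] at hu
    · intro u w c r hu
      simp [h, Branch.empty, cut] at hu
  · exact ⟨mergeOK_of_empty h, mergeConv_of_empty h⟩
  · exact ⟨h.pre.mergeOK, h.pre.mergeConv⟩

section Extend

theorem Look.eq {B : Branch n} {e : Fin n} (h : Look I B e (some b)) (hx : x ∈ F I)
    (hr : Respects x B.slots) : x e = b := by
  cases h with
  | fixed b hb => exact hx b e hb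
  | slot v hv he hk => exact he ▸ hr v hv hk

theorem Look.known {B : Branch n} {e : Fin n} (h : Look I B e (some b)) : Known I B e := by
  cases h with
  | fixed b hb => exact Or.inl ⟨b, hb⟩
  | slot v hv he hk => exact Or.inr ⟨v, hv, he⟩

theorem Look.not_known {B : Branch n} {e : Fin n} (h : Look I B e Option.none) : ¬ Known I B e := by
  cases h with
  | none h => exact h

theorem BranchWF.append {B : Branch n} (hw : BranchWF I B) {e : Fin n} (he : ¬ Known I B e)
    {k : Kind} (hk : k ≠ .dead) (v : Bool) : BranchWF I (B.append [⟨e, k, v⟩]) := by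
  rw [Known, not_or] at he
  refine ⟨?_, ?_, ?_⟩
  · simp only [Branch.append, List.map_append, List.nodup_append]
    refine ⟨hw.nodup, by simp, ?_⟩
    simp only [List.mem_map, List.map_cons, List.map_nil, List.mem_singleton]
    rintro a ⟨v, hv, rfl⟩ b rfl h
    exact he.2 ⟨v, hv, h⟩
  · intro w hw'
    simp only [Branch.append, List.mem_append, List.mem_singleton] at hw'
    rcases hw' with h | rfl
    · exact hw.dead w h
    · simp [hk, he.1]
  · intro w hw'
    rcases hl : B.slots with _ | ⟨a, l⟩
    · simp [Branch.append, hl] at hw'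
      simp [← hw', hk]
    · exact hw.head w (by simpa [Branch.append, hl] using hw')

theorem known_append {B : Branch n} {l : List (Slot n)} {e : Fin n} :
    Known I (B.append l) e ↔ Known I B e ∨ ∃ v ∈ l, v.e = e := by
  simp [Known, Branch.append, or_and_right, exists_or, or_assoc]

/-- The effect of replacing the loose end of branch `s`, unless the tree branches. -/
structure ExtendInv (I : Fixings n) (s : Bool) (p q : Fin n) (t t' : ITree n) (bad : Bool) :
    Prop where
  wf : TreeWF I t'
  loose : (t' !s).loose = (t !s).loose
  known_other : ∀ e, Known I (t !s) e → Known I (t' !s) e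
  known : (t' s).loose = true →
    (∀ e, Known I (t s) e → Known I (t' s) e) ∧ Known I (t' s) p ∧ Known I (t' s) q
  sem : bad = false → ∀ x ∈ F I,
    (Violates x (t' s).slots ∨ Violates x (t' !s).slots ↔
      (Violates x (t s).slots ∨ Violates x (t !s).slots) ∨
        Respects x (t s).slots ∧ x p = false ∧ x q = true) ∧
    ((t' s).Loose x ↔ Respects x (t s).slots ∧ x p = x q) ∧
    ((t' !s).Loose x ↔ (t !s).Loose x)
  bad : bad = true → t (!s) = .empty n ∧ (∀ s, t' s = .empty n) ∧ ∀ x ∈ F I,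
    Violates x (t s).slots ∨ Respects x (t s).slots ∧ x p = false ∧ x q = true

theorem Branching.append (h : Branching t s f g) {l : List (Slot n)}
    (h1 : t' s = (t s).append l) (h2 : t' (!s) = t (!s)) : Branching t' s f g := by
  obtain ⟨r₀, r₁, h3, h4⟩ := h
  exact ⟨r₀ ++ l, r₁, by simp [h1, Branch.append, h3], by rw [h2, h4]⟩

/-- Only vectors that respect the branch so far matter. For a necessary vertex, missing it has to
mean `x p < x q`. For a conditional vertex, `hsem` says that `x p < x q` cannot occur, so the
vectors that miss it have `x p > x q` and leave the path for good. Respecting the vertex means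
equality at `p` in both cases. -/
theorem ExtendInv.of_append (hw : TreeWF I t) (hl : (t s).loose = true) {e : Fin n}
    (he : ¬ Known I (t s) e) {k : Kind} (hk : k ≠ .dead) {v : Bool}
    (h1 : t' s = (t s).append [⟨e, k, v⟩]) (h2 : t' (!s) = t (!s))
    (hkn : Known I (t' s) p ∧ Known I (t' s) q)
    (hsem : ∀ x ∈ F I, Respects x (t s).slots →
      ((k = .nec ∧ x e ≠ v ↔ x p = false ∧ x q = true) ∧ (x e = v ↔ x p = x q))) :
    ExtendInv I s p q t t' false := by
  refine ⟨TreeWF.of_shape_at (s := s) ((forall_bool s).2 ⟨?_, ?_⟩) ?_, by rw [h2], ?_, ?_, ?_,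
    by simp⟩
  · rw [h1]; exact (hw.branch s).append he hk v
  · rw [h2]; exact hw.branch _
  · rcases hw.shape_at s with h | h | ⟨f, g, h⟩
    · simp [h, Branch.empty] at hl
    · exact Or.inr (Or.inl (h2.trans h))
    · exact Or.inr (Or.inr ⟨f, g, h.append h1 h2⟩)
  · rw [h2]; exact fun _ => id
  · refine fun _ => ⟨fun e h => ?_, hkn⟩
    rw [h1, known_append]
    exact Or.inl h
  · intro _ x hx
    rw [h2, h1]
    refine ⟨?_, ?_, Iff.rfl⟩
    · simp only [Branch.append, violates_append]
      have key : Respects x (t s).slots →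
          (Violates x [⟨e, k, v⟩] ↔ x p = false ∧ x q = true) := by
        intro h
        rw [← (hsem x hx h).1]
        rcases k with _ | _ | _
        · exact absurd rfl hk
        · rw [violates_cons_cond rfl]; simp
        · rw [violates_cons_nec rfl]; simp
      tauto
    · simp only [Branch.Loose, Branch.append, hl, respects_append, respects_cons, respects_nil]
      constructor
      · rintro ⟨-, h3, h4, -⟩
        exact ⟨h3, (hsem x hx h3).2.1 (h4 hk)⟩
      · rintro ⟨h3, h4⟩
        exact ⟨trivial, h3, fun _ => (hsem x hx h3).2.2 h4, trivial⟩

/-- The branch forces 0 at `p` and 1 at `q`, so all vectors that respect it become violating. By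
`ConflictRel.shape` infeasibility arises only if there is no second branch. -/
theorem TreeWF.extend_conflict (hw : TreeWF I t) (hl : (t s).loose = true)
    (hα : Look I (t s) p (some false)) (hβ : Look I (t s) q (some true))
    (h : ConflictRel s t t' bad) : ExtendInv I s p q t t' bad := by
  have hshape : t (!s) = .empty n ∨ ∃ f g, Branching t s f g := by
    rcases hw.shape_at s with h | h
    · simp [h, Branch.empty] at hl
    · exact h
  have hbadsem : ∀ x ∈ F I, Respects x (t s).slots →
      Respects x (t s).slots ∧ x p = false ∧ x q = true :=
    fun x hx hr => ⟨hr, hα.eq hx hr, hβ.eq hx hr⟩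
  obtain ⟨-, hm⟩ := hw.merge s
  have hbr := h.branchWF (hw.branch s)
  have hne : ∀ f g, Branching t s f g → (t s).slots ≠ [] := by
    rintro f g ⟨r₀, r₁, h3, -⟩
    simp [h3]
  have hbad : bad = true → t (!s) = .empty n := by
    rintro rfl
    rcases hshape with h1 | ⟨f, g, h1⟩
    · exact h1
    · exact absurd (h.shape h1.pre (hne f g h1)).1 (by simp)
  refine ⟨TreeWF.of_shape_at (s := s) ((forall_bool s).2
    ⟨hbr.1, h.branchWF_other (hw.branch _) hm⟩) ?_, ?_, h.known_other, by simp [hbr.2],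
    ?_, fun hb => ⟨hbad hb, ?_⟩⟩
  · rcases hshape with h1 | ⟨f, g, h1⟩
    · exact Or.inr (Or.inl (h.other_of_empty h1))
    · exact ((h.shape h1.pre (hne f g h1)).2).imp_right fun h => Or.inr ⟨f, g, h⟩
  · cases bad with
    | true => rw [h.other_of_empty (hbad rfl), hbad rfl]
    | false => exact (h.semantics hm (fun _ => false)).2.2.1
  · rintro rfl x hx
    obtain ⟨h1, h2, h3, h4⟩ := h.semantics hm x
    have h5 := hbadsem x hx
    simp only [Branch.Loose, h2, h3, h4, h1]
    refine ⟨?_, ?_, ?_⟩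
    · generalize Violates x (t s).slots = A at *
      generalize Respects x (t s).slots = B at *
      generalize Violates x (t !s).slots = C at *
      constructor
      · rintro ((h | h) | h)
        · exact Or.inl (Or.inl h)
        · exact Or.inr (h5 h)
        · exact Or.inl (Or.inr h)
      · rintro ((h | h) | h)
        · exact Or.inl (Or.inl h)
        · exact Or.inr h
        · exact Or.inl (Or.inr h.1)
    swap
    · trivial
    simp only [Bool.false_eq_true, false_and, false_iff, not_and]
    intro hr
    simp [(h5 hr).2.1, (h5 hr).2.2]
  · subst hb
    refine ⟨(forall_bool s).2 ⟨?_, h.other_of_empty (hbad rfl)⟩, fun x hx => ?_⟩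
    · cases h with
      | bad _ h1 => exact h1
    · exact (h.violates x).imp_right (hbadsem x hx)

/-- With one value known, a single new vertex prescribes that the other value is equal. It is
necessary if a different value would give `x p < x q`, and conditional if it would give `x p > x q`.
-/
theorem TreeWF.extend (hw : TreeWF I t) (hl : (t s).loose = true)
    (hpq : Known I (t s) p ∨ Known I (t s) q) {α β : Option Bool}
    (hα : Look I (t s) p α) (hβ : Look I (t s) q β) (h : ExtendRel s p q t t' α β bad) :
    ExtendInv I s p q t t' bad := by
  have hshape : t (!s) = .empty n ∨ ∃ f g, Branching t s f g := by
    rcases hw.shape_at s with h | h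
    · simp [h, Branch.empty] at hl
    · exact h
  -- the cases in which no vertex is appended
  have same : ∀ a, t' s = ⟨(t s).slots, a⟩ → t' (!s) = t (!s) → TreeWF I t' := by
    intro a h1 h2
    refine TreeWF.of_shape_at (s := s) ((forall_bool s).2 ⟨?_, ?_⟩) ?_
    · rw [h1]; exact (hw.branch s).of_prefix (List.prefix_refl _) a
    · rw [h2]; exact hw.branch _
    · right
      refine hshape.imp h2.trans ?_
      rintro ⟨f, g, r₀, r₁, h3, h4⟩
      exact ⟨f, g, r₀, r₁, by rw [h1, h3], by rw [h2, h4]⟩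
  have vα : ∀ b, α = some b → ∀ x ∈ F I, Respects x (t s).slots → x p = b := by
    rintro b rfl x hx hr
    exact hα.eq hx hr
  have vβ : ∀ b, β = some b → ∀ x ∈ F I, Respects x (t s).slots → x q = b := by
    rintro b rfl x hx hr
    exact hβ.eq hx hr
  rcases α with _ | _ | _ <;> rcases β with _ | _ | _
  · exact absurd hpq (not_or.2 ⟨hα.not_known, hβ.not_known⟩)
  · obtain ⟨rfl, h1, h2⟩ := h
    refine .of_append hw hl hα.not_known (by simp) h1 h2 ?_ fun x hx hr => ?_
    · rw [h1, known_append, known_append]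
      exact ⟨by simp, Or.inl hβ.known⟩
    · simp [vβ _ rfl x hx hr]
  · obtain ⟨rfl, h1, h2⟩ := h
    refine .of_append hw hl hα.not_known (by simp) h1 h2 ?_ fun x hx hr => ?_
    · rw [h1, known_append, known_append]
      exact ⟨by simp, Or.inl hβ.known⟩
    · simp [vβ _ rfl x hx hr]
  · obtain ⟨rfl, h1, h2⟩ := h
    refine .of_append hw hl hβ.not_known (by simp) h1 h2 ?_ fun x hx hr => ?_
    · rw [h1, known_append, known_append]
      exact ⟨Or.inl hα.known, by simp⟩
    · simp [vα _ rfl x hx hr]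
  · obtain ⟨rfl, h1, h2⟩ := h
    refine ⟨same _ h1 h2, by rw [h2], by rw [h2]; exact fun _ => id, fun _ => ?_, fun _ x hx => ?_,
      by simp⟩
    · rw [h1]; exact ⟨fun _ => id, hα.known, hβ.known⟩
    · have h3 := vα _ rfl x hx
      have h4 := vβ _ rfl x hx
      rw [h1, h2]
      simp only [Branch.Loose, hl]
      grind
  · exact hw.extend_conflict hl hα hβ h
  · obtain ⟨rfl, h1, h2⟩ := h
    refine .of_append hw hl hβ.not_known (by simp) h1 h2 ?_ fun x hx hr => ?_
    · rw [h1, known_append, known_append]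
      exact ⟨Or.inl hα.known, by simp⟩
    · simp [vα _ rfl x hx hr]
  · obtain ⟨rfl, h1, h2⟩ := h
    refine ⟨same _ h1 h2, by rw [h2], by rw [h2]; exact fun _ => id, by simp [h1],
      fun _ x hx => ?_, by simp⟩
    have h3 := vα _ rfl x hx
    have h4 := vβ _ rfl x hx
    rw [h1, h2]
    simp only [Branch.Loose]
    grind
  · obtain ⟨rfl, h1, h2⟩ := h
    refine ⟨same _ h1 h2, by rw [h2], by rw [h2]; exact fun _ => id, fun _ => ?_, fun _ x hx => ?_,
      by simp⟩
    · rw [h1]; exact ⟨fun _ => id, hα.known, hβ.known⟩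
    · have h3 := vα _ rfl x hx
      have h4 := vβ _ rfl x hx
      rw [h1, h2]
      simp only [Branch.Loose, hl]
      grind

end Extend

/-- The tree describes the constraint of `γ` up to the index `k`. -/
structure TreeInv (γ : Equiv.Perm (Fin n)) (I : Fixings n) (k : ℕ) (t : ITree n) : Prop where
  wf : TreeWF I t
  known : ∀ s, (t s).loose = true → ∀ r : Fin n, r.val + 1 < k → γ.symm r ≠ r →
    Known I (t s) r ∧ Known I (t s) (γ.symm r)
  sem : ∀ x ∈ F I, (GtUpTo k (permute γ x) x ↔ TViolates x t) ∧
    (EqUpTo k x (permute γ x) ↔ TLoose x t)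

variable {γ : Equiv.Perm (Fin n)} {k : ℕ}

/-- Neither comparison in the invariant depends on the fixings, so it suffices that the tree keeps
its meaning on the vectors with `x i = b`. -/
theorem TreeInv.fix (h : TreeInv γ I k t) (hi : ¬ Fixed I i) (h₁ : FixRel false i b t t₁ bad₁)
    (h₂ : FixRel true i b t₁ t₂ bad₂) :
    TreeWF (applyFixing I (i, b)) t₂ ∧
    ((bad₁ || bad₂) = false → TreeInv γ (applyFixing I (i, b)) k t₂) ∧
    ((bad₁ || bad₂) = true → InfConj γ (applyFixing I (i, b)) k ∅ ∧ ∀ s, t₂ s = .empty n) := by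
  obtain ⟨hw, hf⟩ := h.wf.fix hi h₁ h₂
  refine ⟨hw, fun hb => ⟨hw, fun s hs r hr hne => ?_, fun x hx => ?_⟩, fun hb => ⟨?_, ?_⟩⟩
  · obtain ⟨h3, h4⟩ := hf.known s hs
    have key : ∀ e, Known I (t s) e → Known (applyFixing I (i, b)) (t₂ s) e :=
      fun e he => h4 e (he.imp_left (Fixed.mono (le_applyFixing _ _)))
    exact (h.known s h3 r hr hne).imp (key _) (key _)
  · obtain ⟨hx, hxi⟩ := mem_F_applyFixing.1 hx
    obtain ⟨h3, h4⟩ := hf.sem hb x hxi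
    rw [h3, h4]
    exact h.sem x hx
  · intro x hx
    obtain ⟨hxI, hxi⟩ := mem_F_applyFixing.1 hx.1
    exact (h.sem x hxI).1.2 ((hf.bad hb).1 x hxi)
  · exact (hf.bad hb).2

/-- The effect of the index event on the branch `s`; `old` tells whether the branch had a loose end
before. -/
def ExtendStep (I : Fixings n) (s : Bool) (p q : Fin n) (old : Bool) (t t' : ITree n)
    (bad : Bool) : Prop :=
  if old then ∃ α β, Look I (t s) p α ∧ Look I (t s) q β ∧ ExtendRel s p q t t' α β bad
  else t' = t ∧ bad = false

/-- In an index event a branch whose loose end is replaced is empty, or one of the two entries is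
known. -/
def Extendable (I : Fixings n) (p q : Fin n) (t : ITree n) : Prop :=
  ∀ s, (t s).loose = true → (t s).slots = [] ∨ Known I (t s) p ∨ Known I (t s) q

/-- A loose branch without vertices leaves the other branch empty. Then `x p ≥ x q` is stored as two
implications, contrapositive to each other: `x p = 0` forces `x q = 0`, and `x q = 1` forces `x p =
1`. A vector with `x p = x q` follows exactly one of the new paths to its end, and one with `x p > x
q` enters neither. -/
theorem TreeWF.branch_step (hw : TreeWF I t) (hpq : p ≠ q) (hl : (t s).loose = true)
    (he : (t s).slots = []) (hp : ¬ Known I (t s) p) (hq : ¬ Known I (t s) q)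
    (h : ExtendRel s p q t t' none none bad) :
    t (!s) = .empty n ∧ bad = false ∧ TreeWF I t' ∧
    (∀ s' e, Known I (t s) e → Known I (t' s') e) ∧
    (∀ s', Known I (t' s') p ∧ Known I (t' s') q) ∧
    ∀ x, (TViolates x t' ↔ x p = false ∧ x q = true) ∧ (TLoose x t' ↔ x p = x q) := by
  have hempty : t (!s) = .empty n := by
    rcases hw.shape_at s with h | h | ⟨f, g, r₀, r₁, h, -⟩
    · simp [h, Branch.empty] at hl
    · exact h
    · simp [he] at h
  obtain ⟨rfl, h1, h2⟩ := h
  have hfix : ∀ e, Known I (t s) e ↔ Fixed I e := by simp [Known, he]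
  rw [hfix] at hp hq
  simp only [Branch.append, he, hl, hempty, Branch.empty, List.nil_append] at h1 h2
  refine ⟨hempty, rfl, TreeWF.of_shape_at (s := s) ((forall_bool s).2 ⟨?_, ?_⟩)
    (Or.inr (Or.inr ⟨(p, false), (q, false), [], [], by rw [h1]; rfl, by rw [h2]; rfl⟩)), ?_, ?_,
    fun x => ?_⟩
  · rw [h1]
    exact ⟨by simpa using hpq, by simp [hp, hq], by simp⟩
  · rw [h2]
    exact ⟨by simpa using hpq.symm, by simp [hp, hq], by simp⟩
  · exact fun s' e h => Or.inl ((hfix e).1 h)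
  · refine (forall_bool s).2 ⟨?_, ?_⟩
    · simp [Known, h1]
    · simp [Known, h2]
  · rw [TViolates, TLoose, exists_bool s, exists_bool s, h1, h2]
    constructor
    · rw [violates_cons_cond (by rfl), violates_cons_nec (by rfl), violates_cons_cond (by rfl),
        violates_cons_nec (by rfl)]
      cases x p <;> cases x q <;> simp
    · simp only [Branch.Loose, respects_cons]
      cases x p <;> cases x q <;> simp

theorem not_known_of_look {B : Branch n} {α β : Option Bool} (hα : Look I B p α)
    (hβ : Look I B q β) (h : ¬ (Known I B p ∨ Known I B q)) : α = none ∧ β = none := by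
  rw [not_or] at h
  constructor
  · cases hα with
    | none _ => rfl
    | fixed b hb => exact absurd (Look.fixed b hb : Look I B p _).known h.1
    | slot v h1 h2 h3 => exact absurd (Look.slot v h1 h2 h3 : Look I B p _).known h.1
  · cases hβ with
    | none _ => rfl
    | fixed b hb => exact absurd (Look.fixed b hb : Look I B q _).known h.2
    | slot v h1 h2 h3 => exact absurd (Look.slot v h1 h2 h3 : Look I B q _).known h.2

/-- The tree is consistent between the updates of its two branches. -/
theorem TreeWF.extend_first (hw : TreeWF I t) (hpq : p ≠ q) (he : Extendable I p q t)
    (h : ExtendStep I false p q (t false).loose t t₁ bad) : TreeWF I t₁ := by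
  unfold ExtendStep at h
  split_ifs at h with hl
  · obtain ⟨α, β, hα, hβ, h⟩ := h
    by_cases hk : Known I (t false) p ∨ Known I (t false) q
    · exact (hw.extend hl hk hα hβ h).wf
    · obtain ⟨rfl, rfl⟩ := not_known_of_look hα hβ hk
      have := (he false hl).resolve_right hk
      rw [not_or] at hk
      exact (hw.branch_step hpq hl this hk.1 hk.2 h).2.2.1
  · rw [h.1]; exact hw

/-- This transfers the recursion of `eqUpTo_succ` and `gtUpTo_succ` to trees. A new loose path must
inherit the known entries of some old loose path; if `γ` fixes `p`, the position `p` adds no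
requirement. -/
theorem treeInv_succ (hp : p.val + 1 = k) (hw : TreeWF I t')
    (hinv : TreeInv γ I k t)
    (hk : ∀ s', (t' s').loose = true →
      (∃ s, (t s).loose = true ∧ ∀ e, Known I (t s) e → Known I (t' s') e) ∧
      (γ.symm p ≠ p → Known I (t' s') p ∧ Known I (t' s') (γ.symm p)))
    (hs : ∀ x ∈ F I, (TViolates x t' ↔ TViolates x t ∨ TLoose x t ∧ x p < x (γ.symm p)) ∧
      (TLoose x t' ↔ TLoose x t ∧ x p = x (γ.symm p))) : TreeInv γ I (k + 1) t' := by
  subst hp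
  refine ⟨hw, fun s' hs' r hr hne => ?_, fun x hx => ?_⟩
  · obtain ⟨⟨s, h1, h2⟩, h3⟩ := hk s' hs'
    rcases Nat.lt_or_ge r.val p.val with h | h
    · exact (hinv.known s h1 r (by omega) hne).imp (h2 _) (h2 _)
    · obtain rfl : r = p := Fin.ext (by omega)
      exact h3 hne
  · rw [(hs x hx).1, (hs x hx).2, ← (hinv.sem x hx).1, ← (hinv.sem x hx).2]
    refine ⟨?_, eqUpTo_succ p⟩
    rw [gtUpTo_succ p]
    exact or_congr Iff.rfl (and_congr ⟨EqUpTo.symm, EqUpTo.symm⟩ Iff.rfl)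

theorem TreeInv.skip (h : TreeInv γ I k t) (hp : p.val + 1 = k) (hpq : γ.symm p = p) :
    TreeInv γ I (k + 1) t :=
  treeInv_succ hp h.wf h (fun s hs => ⟨⟨s, hs, fun _ => id⟩, fun h => absurd hpq h⟩)
    fun x _ => by simp [hpq]

/-- The cases are which branches were loose before the event. Branching requires that only one was;
the branch that it creates is not extended at the same index, because `ExtendStep` uses the
looseness of the old tree. If both were loose, the first replacement keeps the loose end and the
known entries of the other branch, and the two effects add up. -/
theorem TreeInv.extend (h : TreeInv γ I k t) (hp : p.val + 1 = k) (hpq : p ≠ γ.symm p)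
    (he : Extendable I p (γ.symm p) t)
    (h₁ : ExtendStep I false p (γ.symm p) (t false).loose t t₁ bad₁)
    (h₂ : ExtendStep I true p (γ.symm p) (t true).loose t₁ t₂ bad₂) :
    TreeWF I t₂ ∧ ((bad₁ || bad₂) = false → TreeInv γ I (k + 1) t₂) ∧
    ((bad₁ || bad₂) = true → InfConj γ I (k + 1) ∅ ∧ ∀ s, t₂ s = .empty n) := by
  set q := γ.symm p with hq
  have hlt : ∀ x : Vec n, x p < x q ↔ x p = false ∧ x q = true := fun x => Bool.lt_iff
  have hinf : (∀ x ∈ F I, TViolates x t ∨ TLoose x t ∧ x p < x q) → InfConj γ I (k + 1) ∅ := by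
    subst hp
    intro h3 x hx
    rw [gtUpTo_succ p]
    refine (h3 x hx.1).imp (h.sem x hx.1).1.2 fun h4 => ⟨?_, h4.2⟩
    exact ((h.sem x hx.1).2.2 h4.1).symm
  -- branching
  have hbranch : ∀ s t' bad, (t s).loose = true → ¬ (Known I (t s) p ∨ Known I (t s) q) →
      ExtendRel s p q t t' none none bad →
      bad = false ∧ (t !s).loose = false ∧ TreeInv γ I (k + 1) t' := by
    intro s t' bad hl hk hr
    have hs := (he s hl).resolve_right hk
    rw [not_or] at hk
    obtain ⟨h3, h4, h5, h6, h7, h8⟩ := h.wf.branch_step hpq hl hs hk.1 hk.2 hr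
    refine ⟨h4, by rw [h3]; rfl, treeInv_succ hp h5 h
      (fun s' _ => ⟨⟨s, hl, h6 s'⟩, fun _ => h7 s'⟩) fun x _ => ?_⟩
    have h9 : ¬ TViolates x t := by
      rw [TViolates, exists_bool s, hs, h3]
      simp [Branch.empty]
    have h10 : TLoose x t := ⟨s, hl, by simp [hs]⟩
    rw [(h8 x).1, (h8 x).2, ← hq, hlt]
    simp [h9, h10]
  unfold ExtendStep at h₁ h₂
  by_cases hl₁ : (t false).loose = true
  · rw [if_pos hl₁] at h₁
    obtain ⟨α, β, hα, hβ, hr⟩ := h₁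
    by_cases hk₁ : Known I (t false) p ∨ Known I (t false) q
    · have e₁ := h.wf.extend hl₁ hk₁ hα hβ hr
      by_cases hl₂ : (t true).loose = true
      · -- both loose ends are replaced
        -- Infeasibility in the first update needs an empty second branch, which has no loose end.
        have hbad₁ : bad₁ = false := by
          by_contra hb
          have := (e₁.bad (by simpa using hb)).1
          rw [Bool.not_false] at this
          simp [this, Branch.empty] at hl₂
        subst hbad₁
        rw [if_pos hl₂] at h₂
        obtain ⟨α', β', hα', hβ', hr'⟩ := h₂
        have hl₂' : (t₁ true).loose = true := e₁.loose.trans hl₂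
        have hk₂ : Known I (t true) p ∨ Known I (t true) q := by
          refine (he true hl₂).resolve_left fun hs => ?_
          rcases h.wf.shape_at true with h | h | ⟨f, g, r₀, r₁, h, -⟩
          · simp [h, Branch.empty] at hl₂
          · rw [Bool.not_true] at h; simp [h, Branch.empty] at hl₁
          · simp [hs] at h
        have e₂ := e₁.wf.extend hl₂' (hk₂.imp (e₁.known_other _) (e₁.known_other _)) hα' hβ' hr'
        refine ⟨e₂.wf, fun hb => ?_, fun hb => ⟨hinf fun x hx => ?_, (e₂.bad hb).2.1⟩⟩
        · refine treeInv_succ hp e₂.wf h (fun s' hs' => ?_) fun x hx => ?_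
          · cases s'
            · have h3 : (t₁ false).loose = true := e₂.loose.symm.trans hs'
              obtain ⟨h4, h5, h6⟩ := e₁.known h3
              exact ⟨⟨false, hl₁, fun e h => e₂.known_other e (h4 e h)⟩,
                fun _ => ⟨e₂.known_other _ h5, e₂.known_other _ h6⟩⟩
            · obtain ⟨h4, h5⟩ := e₂.known hs'
              exact ⟨⟨true, hl₂, fun e h => h4 e (e₁.known_other e h)⟩, fun _ => h5⟩
          · obtain ⟨a1, a2, a3⟩ := e₁.sem rfl x hx
            obtain ⟨b1, b2, b3⟩ := e₂.sem hb x hx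
            simp only [TViolates, TLoose, Bool.exists_bool, ← hq, hlt]
            simp only [Bool.not_true, Bool.not_false] at a1 a2 a3 b1 b2 b3
            have c1 : Branch.Loose x (t false) ↔ Respects x (t false).slots := by
              simp [Branch.Loose, hl₁]
            have c2 : Branch.Loose x (t true) ↔ Respects x (t true).slots := by
              simp [Branch.Loose, hl₂]
            have c3 : Branch.Loose x (t₁ true) ↔ Respects x (t₁ true).slots := by
              simp [Branch.Loose, hl₂']
            rw [b2, b3, a2, ← c3, a3, c1, c2]
            rw [← c3, a3, c2] at b1
            constructor
            · rw [or_comm, b1, or_comm (b := Violates x (t₁ false).slots), a1, or_assoc,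
                ← or_and_right]
            · rw [← or_and_right]
        · have h3 := (e₂.bad hb).2.2 x hx
          obtain ⟨a1, a2, a3⟩ := e₁.sem rfl x hx
          simp only [TViolates, TLoose, Bool.exists_bool, hlt]
          simp only [Bool.not_false] at a1 a3
          have c1 : Branch.Loose x (t false) ↔ Respects x (t false).slots := by
            simp [Branch.Loose, hl₁]
          have c2 : Branch.Loose x (t true) ↔ Respects x (t true).slots := by
            simp [Branch.Loose, hl₂]
          have c3 : Branch.Loose x (t₁ true) ↔ Respects x (t₁ true).slots := by
            simp [Branch.Loose, hl₂']
          rw [← c3, a3, c2] at h3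
          rw [c1, c2]
          rcases h3 with h3 | ⟨h3, h4⟩
          · exact (a1.1 (Or.inr h3)).imp_right fun h => ⟨Or.inl h.1, h.2⟩
          · exact Or.inr ⟨Or.inr h3, h4⟩
      · rw [if_neg hl₂] at h₂
        obtain ⟨rfl, rfl⟩ := h₂
        rw [Bool.or_false]
        refine ⟨e₁.wf, fun hb => ?_, fun hb => ⟨hinf fun x hx => ?_, (e₁.bad hb).2.1⟩⟩
        · refine treeInv_succ hp e₁.wf h (fun s' hs' => ?_) fun x hx => ?_
          · cases s'
            · obtain ⟨h4, h5⟩ := e₁.known hs'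
              exact ⟨⟨false, hl₁, h4⟩, fun _ => h5⟩
            · exact absurd (e₁.loose.symm.trans hs') hl₂
          · obtain ⟨a1, a2, a3⟩ := e₁.sem hb x hx
            simp only [TViolates, TLoose, Bool.exists_bool, ← hq, hlt]
            simp only [Bool.not_false] at a1 a2 a3
            have c1 : Branch.Loose x (t false) ↔ Respects x (t false).slots := by
              simp [Branch.Loose, hl₁]
            have c2 : ¬ Branch.Loose x (t true) := by
              simp [Branch.Loose, hl₂]
            simp [a1, a2, a3, c1, c2]
        · have h3 := (e₁.bad hb).2.2 x hx
          simp only [TViolates, TLoose, Bool.exists_bool, hlt]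
          have c1 : Branch.Loose x (t false) ↔ Respects x (t false).slots := by
            simp [Branch.Loose, hl₁]
          rw [c1]
          exact h3.imp Or.inl fun h => ⟨Or.inl h.1, h.2⟩
    · obtain ⟨rfl, rfl⟩ := not_known_of_look hα hβ hk₁
      obtain ⟨rfl, h4, h5⟩ := hbranch false t₁ bad₁ hl₁ hk₁ hr
      rw [Bool.not_false] at h4
      rw [if_neg (by simp [h4])] at h₂
      obtain ⟨rfl, rfl⟩ := h₂
      exact ⟨h5.wf, fun _ => h5, by simp⟩
  · rw [if_neg hl₁] at h₁
    obtain ⟨rfl, rfl⟩ := h₁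
    rw [Bool.false_or]
    by_cases hl₂ : (t₁ true).loose = true
    · rw [if_pos hl₂] at h₂
      obtain ⟨α, β, hα, hβ, hr⟩ := h₂
      by_cases hk₂ : Known I (t₁ true) p ∨ Known I (t₁ true) q
      · have e₂ := h.wf.extend hl₂ hk₂ hα hβ hr
        have c1 : ∀ x, Branch.Loose x (t₁ true) ↔ Respects x (t₁ true).slots := by
          simp [Branch.Loose, hl₂]
        have c2 : ∀ x, ¬ Branch.Loose x (t₁ false) := by
          simp [Branch.Loose, hl₁]
        refine ⟨e₂.wf, fun hb => ?_, fun hb => ⟨hinf fun x hx => ?_, (e₂.bad hb).2.1⟩⟩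
        · refine treeInv_succ hp e₂.wf h (fun s' hs' => ?_) fun x hx => ?_
          · cases s'
            · exact absurd (e₂.loose.symm.trans hs') hl₁
            · obtain ⟨h4, h5⟩ := e₂.known hs'
              exact ⟨⟨true, hl₂, h4⟩, fun _ => h5⟩
          · obtain ⟨a1, a2, a3⟩ := e₂.sem hb x hx
            simp only [TViolates, TLoose, Bool.exists_bool, ← hq, hlt]
            simp only [Bool.not_true] at a1 a2 a3
            rw [or_comm, a1, a2, a3, c1]
            simp [c2, or_comm]
        · have h3 := (e₂.bad hb).2.2 x hx
          simp only [TViolates, TLoose, Bool.exists_bool, hlt]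
          rw [c1]
          exact h3.imp Or.inr fun h => ⟨Or.inr h.1, h.2⟩
      · obtain ⟨rfl, rfl⟩ := not_known_of_look hα hβ hk₂
        obtain ⟨rfl, -, h5⟩ := hbranch true t₂ bad₂ hl₂ hk₂ hr
        exact ⟨h5.wf, fun _ => h5, by simp⟩
    · rw [if_neg hl₂] at h₂
      obtain ⟨rfl, rfl⟩ := h₂
      have c1 : ∀ x, ¬ TLoose x t₂ := by
        simp [TLoose, Branch.Loose, hl₁, hl₂]
      refine ⟨h.wf, fun _ => treeInv_succ hp h.wf h (fun s' hs' => ?_) fun x hx => ?_, by simp⟩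
      · cases s'
        · exact absurd hs' hl₁
        · exact absurd hs' hl₂
      · simp [c1]

end Symresack

/-! ### Reading inf- and eq-conjunctions off a consistent tree. -/

namespace Symresack

variable {n : ℕ} {I J : Fixings n} {t : ITree n} {s : Bool} {f g : Fin n × Bool}
  {i : Fin n} {b : Bool} {x : Vec n} {γ : Equiv.Perm (Fin n)} {k : ℕ}

theorem update_mem_F_of_not_fixed (hx : x ∈ F I) (hi : ¬ Fixed I i) (b : Bool) :
    Function.update x i b ∈ F I := update_mem_F hx fun h => hi ⟨_, h⟩

/-- The vertices of a branch can be respected simultaneously. -/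
theorem BranchWF.exists_respects {B : Branch n} (hw : BranchWF I B) (hF : (F I).Nonempty) :
    ∃ x ∈ F I, Respects x B.slots := by
  obtain ⟨hn, hd, -⟩ := hw
  generalize B.slots = l at hn hd
  induction l with
  | nil => exact hF.imp fun x hx => ⟨hx, by simp⟩
  | cons v l ih =>
    obtain ⟨x, hx, hr⟩ := ih (List.Nodup.of_cons hn) fun w hw => hd w (List.mem_cons_of_mem _ hw)
    by_cases hv : v.k = .dead
    · exact ⟨x, hx, by simp [hv, hr]⟩
    · refine ⟨Function.update x v.e v.v, update_mem_F_of_not_fixed hx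
        (fun h => hv ((hd v (by simp)).2 h)) _, ?_⟩
      rw [respects_cons]
      refine ⟨by simp, fun w hw hwk => ?_⟩
      have : w.e ≠ v.e := by
        intro h
        simp only [List.map_cons, List.nodup_cons] at hn
        exact hn.1 (h ▸ List.mem_map_of_mem hw)
      rw [Function.update_of_ne this]
      exact hr w hw hwk

theorem Respects.not_violates {l : List (Slot n)} (h : Respects x l) : ¬ Violates x l := by
  induction l with
  | nil => simp
  | cons v l ih =>
    rw [respects_cons] at h
    have := ih h.2
    rcases hk : v.k with _ | _ | _
    · rwa [violates_cons_dead hk]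
    · rw [violates_cons_cond hk]; tauto
    · rw [violates_cons_nec hk]; simp [h.1 (by simp [hk]), this]

/-- A vector that respects one branch violates nothing. -/
theorem TreeWF.not_violates (hw : TreeWF I t) (hs : (t s).slots ≠ [] ∨ t (!s) = .empty n)
    (hr : Respects x (t s).slots) : ¬ TViolates x t := by
  rw [TViolates, exists_bool s, not_or]
  refine ⟨hr.not_violates, ?_⟩
  rcases hw.shape_at s with h | h | ⟨f, g, r₀, r₁, h1, h2⟩
  · rcases hs with hs | hs
    · simp [h, Branch.empty] at hs
    · rw [hs]; exact id
  · rw [h]; exact id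
  · have : x g.1 = g.2 := by
      rw [h1] at hr
      exact hr (.mk' g .nec) (by simp) (by simp [Slot.mk'])
    rw [h2, violates_mk'_cond]
    simp [conv, this]

theorem TreeWF.exists_not_violates (hw : TreeWF I t) (hF : (F I).Nonempty) :
    ∃ x ∈ F I, ¬ TViolates x t := by
  obtain ⟨s, hs⟩ : ∃ s, (t s).slots ≠ [] ∨ t (!s) = .empty n := by
    rcases hw.shape_at false with h | h | ⟨f, g, r₀, r₁, h1, h2⟩
    · exact ⟨true, Or.inr h⟩
    · exact ⟨false, Or.inr h⟩
    · exact ⟨false, Or.inl (by simp [h1])⟩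
  obtain ⟨x, hx, hr⟩ := (hw.branch s).exists_respects hF
  exact ⟨x, hx, hw.not_violates hs hr⟩

/-- The root has no necessary fixing vertex as child. -/
def RootFree (t : ITree n) : Prop := ∀ s, ∀ v ∈ (t s).slots.head?, v.k ≠ .nec

/-- The first fixing on some branch. -/
def FirstFixing (t : ITree n) (f : Fin n × Bool) : Prop :=
  ∃ s, ∃ v ∈ (t s).slots.head?, (v.e, v.v) = f

theorem Violates.head {l : List (Slot n)} (h : Violates x l)
    (hk : ∀ v ∈ l.head?, v.k = .cond) : ∀ v ∈ l.head?, x v.e = v.v := by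
  cases l with
  | nil => simp
  | cons v l =>
    rw [violates_cons_cond (hk v (by simp))] at h
    simpa using h.1

theorem Respects.head {l : List (Slot n)} (h : Respects x l)
    (hk : ∀ v ∈ l.head?, v.k = .cond) : ∀ v ∈ l.head?, x v.e = v.v := by
  intro v hv
  exact h v (List.mem_of_mem_head? hv) (by simp [hk v hv])

theorem TreeWF.head_cond (hw : TreeWF I t) (hr : RootFree t) :
    ∀ v ∈ (t s).slots.head?, v.k = .cond := by
  intro v hv
  have h1 := (hw.branch s).head v hv
  have h2 := hr s v hv
  rcases h : v.k with _ | _ | _ <;> simp_all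

/-- The first fixings of all branches can be avoided. -/
theorem TreeWF.exists_avoiding (hw : TreeWF I t) (hF : (F I).Nonempty)
    (hf : ¬ Fixed I f.1) (hff : ¬ FirstFixing t f) :
    ∃ x ∈ F I, x f.1 = f.2 ∧ ∀ s, ∀ v ∈ (t s).slots.head?, x v.e ≠ v.v := by
  obtain ⟨x, hx⟩ := hF
  have hunf : ∀ s, ∀ v ∈ (t s).slots.head?, ¬ Fixed I v.e := fun s v hv h =>
    (hw.branch s).head v hv (((hw.branch s).dead v (List.mem_of_mem_head? hv)).2 h)
  have single : ∀ s, t (!s) = .empty n →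
      ∃ x ∈ F I, x f.1 = f.2 ∧ ∀ s, ∀ v ∈ (t s).slots.head?, x v.e ≠ v.v := by
    intro s hs
    rcases hh : (t s).slots.head? with _ | v
    · refine ⟨Function.update x f.1 f.2, update_mem_F_of_not_fixed hx hf _, by simp,
        (forall_bool s).2 ⟨by simp [hh], by simp [hs, Branch.empty]⟩⟩
    -- Setting `f` last may overwrite the entry of `v`. As `f` is not the first fixing, its value is
    -- then the converse one, which also avoids `v`.
    · refine ⟨Function.update (Function.update x v.e (!v.v)) f.1 f.2,
        update_mem_F_of_not_fixed (update_mem_F_of_not_fixed hx (hunf s v hh) _) hf _, by simp,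
        (forall_bool s).2 ⟨?_, by simp [hs, Branch.empty]⟩⟩
      intro w hw'
      obtain rfl : v = w := by simpa [hh] using hw'
      by_cases he : v.e = f.1
      · rw [he, Function.update_self]
        exact fun h => hff ⟨s, v, hh, Prod.ext he h.symm⟩
      · simp [he]
  rcases hw.shape_at false with h | h | ⟨f', g', hb⟩
  · exact single true h
  · exact single false h
  · have hne := hb.ne (hw.branch false)
    obtain ⟨r₀, r₁, h1, h2⟩ := hb
    rw [Bool.not_false] at h2
    have u1 := hunf false (.mk' f' .cond) (by simp [h1])
    have u2 := hunf true (.mk' (conv g') .cond) (by simp [h2])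
    -- The first fixings are `f'` and the converse of `g'`. Their entries differ, so both can be
    -- avoided at once; as before, overwriting by `f` does no harm.
    refine ⟨Function.update (Function.update (Function.update x f'.1 (!f'.2)) g'.1 g'.2) f.1 f.2,
      update_mem_F_of_not_fixed (update_mem_F_of_not_fixed (update_mem_F_of_not_fixed hx u1 _)
        u2 _) hf _, by simp, (forall_bool false).2 ⟨?_, ?_⟩⟩
    · rw [h1]
      rintro v ⟨⟩
      by_cases he : f'.1 = f.1
      · simp only [Slot.mk', he, Function.update_self]
        exact fun h => hff ⟨false, .mk' f' .cond, by simp [h1], Prod.ext he h.symm⟩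
      · simp [Slot.mk', he, hne]
    · rw [Bool.not_false, h2]
      rintro v ⟨⟩
      by_cases he : g'.1 = f.1
      · simp only [Slot.mk', conv, he, Function.update_self]
        exact fun h => hff ⟨true, .mk' (conv g') .cond, by simp [h2], Prod.ext he h.symm⟩
      · simp [Slot.mk', conv, he]

/-- If the root has no necessary fixing vertex as child, every single fixing is possible. -/
theorem TreeWF.exists_of_rootFree (hw : TreeWF I t) (hr : RootFree t) (hF : (F I).Nonempty)
    (hf : f.1 ∉ I (!f.2)) : ∃ x ∈ F I, x f.1 = f.2 ∧ ¬ TViolates x t := by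
  by_cases hfix : Fixed I f.1
  · obtain ⟨c, hc⟩ := hfix
    obtain ⟨x, hx, hv⟩ := hw.exists_not_violates hF
    refine ⟨x, hx, ?_, hv⟩
    have hcf : c = f.2 := by
      by_contra h
      have : c = !f.2 := by cases c <;> cases h' : f.2 <;> simp_all
      exact hf (this ▸ hc)
    rw [← hcf]
    exact hx c _ hc
  -- If `f` opens a branch, a vector that respects that whole branch realizes `f`. Otherwise a
  -- vector leaves every branch at its first vertex, which is conditional because the root is free.
  by_cases hff : FirstFixing t f
  · obtain ⟨s, v, hv, rfl⟩ := hff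
    obtain ⟨x, hx, hres⟩ := (hw.branch s).exists_respects hF
    refine ⟨x, hx, hres.head (hw.head_cond hr) v hv, hw.not_violates (Or.inl ?_) hres⟩
    intro h
    simp [h] at hv
  · obtain ⟨x, hx, hxf, hav⟩ := hw.exists_avoiding hF hfix hff
    refine ⟨x, hx, hxf, ?_⟩
    rintro ⟨s, hviol⟩
    rcases hl : (t s).slots with _ | ⟨v, l⟩
    · simp [hl] at hviol
    · exact hav s v (by simp [hl]) (hviol.head (hw.head_cond hr) v (by simp [hl]))

/-- A vector that avoids all first vertices, which are conditional, leaves all paths at once; by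
`TreeInv` it then satisfies `x ≻_k γ(x)`. To apply `exists_avoiding`, the converse of some first
fixing is prescribed; it is not itself a first fixing, since the two first vertices of a branching
have different entries. A tree without vertices has no loose end by `hl`. -/
theorem TreeWF.exists_not_loose (hw : TreeWF I t) (hr : RootFree t) (hF : (F I).Nonempty)
    (hl : ∀ s, (t s).loose = true → (t s).slots ≠ []) :
    ∃ x ∈ F I, ¬ TViolates x t ∧ ¬ TLoose x t := by
  by_cases hne : ∃ s, ∃ v, v ∈ (t s).slots.head?
  · obtain ⟨s, v, hv⟩ := hne
    have hunf : ¬ Fixed I v.e := fun h =>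
      (hw.branch s).head v hv (((hw.branch s).dead v (List.mem_of_mem_head? hv)).2 h)
    have hff : ¬ FirstFixing t (v.e, !v.v) := by
      rintro ⟨s', w, hw', he⟩
      rcases hw.shape_at s with h | h | ⟨f, g, hb⟩
      · simp [h, Branch.empty] at hv
      · by_cases hs : s' = s
        · subst hs
          obtain rfl : v = w := by
            rw [Option.mem_def] at hv hw'
            simpa [hv] using hw'
          simp at he
        · obtain rfl : s' = !s := by cases s <;> cases s' <;> simp_all
          simp [h, Branch.empty] at hw'
      · have hfg := hb.ne (hw.branch s)
        obtain ⟨r₀, r₁, h1, h2⟩ := hb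
        obtain rfl : Slot.mk' f .cond = v := by simpa [h1] using hv
        by_cases hs : s' = s
        · subst hs
          obtain rfl : Slot.mk' f .cond = w := by simpa [h1] using hw'
          simp at he
        · obtain rfl : s' = !s := by cases s <;> cases s' <;> simp_all
          obtain rfl : Slot.mk' (conv g) .cond = w := by simpa [h2] using hw'
          exact hfg (Prod.ext_iff.1 he).1.symm
    obtain ⟨x, hx, -, hav⟩ := hw.exists_avoiding hF (f := (v.e, !v.v)) hunf hff
    refine ⟨x, hx, ?_, ?_⟩
    · rintro ⟨s, hviol⟩
      rcases hl : (t s).slots with _ | ⟨v, l⟩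
      · simp [hl] at hviol
      · exact hav s v (by simp [hl]) (hviol.head (hw.head_cond hr) v (by simp [hl]))
    · rintro ⟨s, hlo, hres⟩
      rcases hl' : (t s).slots with _ | ⟨v, l⟩
      · exact hl s hlo hl'
      · exact hav s v (by simp [hl']) (hres.head (hw.head_cond hr) v (by simp [hl']))
  · have hnil : ∀ s, (t s).slots = [] := by
      intro s
      rcases hl : (t s).slots with _ | ⟨v, l⟩
      · rfl
      · exact absurd ⟨s, v, by simp [hl]⟩ hne
    obtain ⟨x, hx⟩ := hF
    refine ⟨x, hx, ?_, ?_⟩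
    · rintro ⟨s, h⟩
      simp [hnil] at h
    · rintro ⟨s, h, -⟩
      exact hl s h (hnil s)

theorem TreeInv.not_infConj_empty (h : TreeInv γ I k t) (hF : (F I).Nonempty) :
    ¬ InfConj γ I k ∅ := by
  obtain ⟨x, hx, hv⟩ := h.wf.exists_not_violates hF
  exact fun hinf => hv ((h.sem x hx).1.1 (hinf x ⟨hx, by simp [V_empty]⟩))

theorem TreeInv.not_infConj_singleton (h : TreeInv γ I k t) (hF : (F I).Nonempty)
    (hr : RootFree t) (hf : f.1 ∉ I (!f.2)) : ¬ InfConj γ I k {f} := by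
  obtain ⟨x, hx, hxf, hv⟩ := h.wf.exists_of_rootFree hr hF hf
  exact fun hinf => hv ((h.sem x hx).1.1 (hinf x ⟨hx, mem_V_singleton.2 hxf⟩))

theorem TreeInv.infConj_of_root (h : TreeInv γ I k t) {v : Slot n}
    (hv : v ∈ (t s).slots.head?) (hk : v.k = .nec) : InfConj γ I k {(v.e, !v.v)} := by
  rintro x ⟨hx, hxv⟩
  refine (h.sem x hx).1.2 ⟨s, ?_⟩
  rcases hl : (t s).slots with _ | ⟨w, l⟩
  · simp [hl] at hv
  · obtain rfl : w = v := by simpa [hl] using hv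
    rw [violates_cons_nec hk, mem_V_singleton.1 hxv]
    simp

/-- Every path to a loose end is respected by some vector of `F I`, so a loose end and equality at
some vector are the same thing. -/
theorem TreeInv.minEqConj_eq_empty_iff (h : TreeInv γ I k t) (hF : (F I).Nonempty) :
    minEqConj γ I k = ∅ ↔ ∀ s, (t s).loose = false := by
  rw [Symresack.minEqConj_eq_empty_iff]
  constructor
  · intro h' s
    by_contra hl
    obtain ⟨x, hx, hr⟩ := (h.wf.branch s).exists_respects hF
    exact h' x hx ((h.sem x hx).2.2 ⟨s, by simpa using hl, hr⟩)
  · rintro h' x hx he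
    obtain ⟨s, hl, -⟩ := (h.sem x hx).2.1 he
    simp [h' s] at hl

/-- A loose end right at the root means equality for all vectors. If every loose end has a vertex
before it, `exists_not_loose` provides a vector with `x ≻_k γ(x)`. -/
theorem TreeInv.empty_mem_minEqConj_iff (h : TreeInv γ I k t) (hF : (F I).Nonempty)
    (hr : RootFree t) :
    ∅ ∈ minEqConj γ I k ↔ ∃ s, (t s).loose = true ∧ (t s).slots = [] := by
  rw [Symresack.empty_mem_minEqConj_iff]
  constructor
  · rintro ⟨h1, -⟩
    by_contra hno
    push Not at hno
    obtain ⟨x, hx, hv, hlo⟩ := h.wf.exists_not_loose hr hF hno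
    rcases eqUpTo_or_gtUpTo k x (permute γ x) with h' | h' | h'
    · exact hlo ((h.sem x hx).2.1 h')
    · exact h1 x hx h'
    · exact hv ((h.sem x hx).1.1 h')
  · rintro ⟨s, hs, he⟩
    have heq : ∀ x ∈ F I, EqUpTo k x (permute γ x) := fun x hx =>
      (h.sem x hx).2.2 ⟨s, hs, by simp [he]⟩
    obtain ⟨x, hx⟩ := hF
    exact ⟨fun x hx hgt => hgt.not_eqUpTo (heq x hx), x, hx, heq x hx⟩

/-- The sufficient conditions for completeness, in terms of the tree. -/
def TreeComplete (γ : Equiv.Perm (Fin n)) (I : Fixings n) (k : ℕ) (t : ITree n) : Prop :=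
  (∀ s, (t s).loose = false) ∨ n < k ∨
    (∀ s, (t s).loose = true → (t s).slots ≠ []) ∧
      ∃ p : Fin n, p.val + 1 = k ∧ p ∉ I false ∧ γ.symm p ∉ I true ∧ p < γ p ∧ p < γ.symm p

theorem TreeInv.complConditions_iff {S : State n} (h : TreeInv γ S.fixings (S.idx γ) t)
    (hF : (F S.fixings).Nonempty) (hr : RootFree t) :
    complConditions S γ ↔ TreeComplete γ S.fixings (S.idx γ) t := by
  unfold complConditions TreeComplete
  rw [h.minEqConj_eq_empty_iff hF]
  by_cases hl : ∀ s, (t s).loose = false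
  · simp [hl]
  · rw [h.empty_mem_minEqConj_iff hF hr]
    push Not
    rfl

/-- If the tree does not satisfy the sufficient conditions, it can be extended. -/
theorem TreeInv.extendable (h : TreeInv γ I k t) (hc : ¬ TreeComplete γ I k t) {p : Fin n}
    (hp : p.val + 1 = k) (hpq : p ≠ γ.symm p) : Extendable I p (γ.symm p) t := by
  intro s hl
  by_contra hno
  push Not at hno
  obtain ⟨hne, hkp, hkq⟩ := hno
  apply hc
  -- Otherwise (P3) holds. The entries `p` and `γ⁻¹ p` are unknown on a loose path, hence unfixed.
  -- If `γ p < p`, the earlier comparison at `γ p` made `p` known there; if `γ⁻¹ p < p`, the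
  -- comparison at `γ⁻¹ p` made that entry known.
  refine Or.inr (Or.inr ⟨?_, p, hp, fun h => hkp (Or.inl ⟨_, h⟩), fun h => hkq (Or.inl ⟨_, h⟩),
    ?_, ?_⟩)
  · refine (forall_bool s).2 ⟨fun _ => hne, fun hl' => ?_⟩
    rcases h.wf.shape_at s with h | h | ⟨f, g, r₀, r₁, -, h⟩
    · simp [h, Branch.empty] at hl
    · simp [h, Branch.empty] at hl'
    · simp [h]
  · by_contra hlt
    have hne' : γ p ≠ p := fun h => hpq (by rw [Equiv.eq_symm_apply]; exact h)
    have hlt' : γ p < p := lt_of_le_of_ne (not_lt.1 hlt) hne'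
    have := (h.known s hl (γ p) (by rw [Fin.lt_def] at hlt'; omega)
      (by simpa using hne'.symm)).2
    rw [Equiv.symm_apply_apply] at this
    exact hkp this
  · by_contra hlt
    have hlt' : γ.symm p < p := lt_of_le_of_ne (not_lt.1 hlt) hpq.symm
    exact hkq (h.known s hl (γ.symm p) (by rw [Fin.lt_def] at hlt'; omega)
      fun h => hpq (γ.symm.injective h).symm).1

/-- The loose end below the root is attributed to branch `false`, and branch `true` is absent; this
matches the memory that `init` prepares. -/
theorem treeInv_initial (γ : Equiv.Perm (Fin n)) (I : Fixings n) :
    TreeInv γ I 1 fun s => ⟨[], !s⟩ := by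
  refine ⟨⟨fun s => ⟨by simp, by simp, by simp⟩, Or.inl ⟨false, rfl⟩⟩, fun s _ r hr => by omega,
    fun x _ => ⟨?_, ?_⟩⟩
  · simp only [TViolates, not_violates_nil, exists_const, iff_false]
    rintro ⟨i, hi, -⟩
    omega
  · simp only [TLoose, Branch.Loose]
    exact ⟨fun _ => ⟨false, by simp⟩, fun _ i hi => by omega⟩

end Symresack

/-! # The memory representation of implication trees -/

namespace Symresack

/-! ### A calculus for halting commands with exact step counts. -/

section WP

variable {R A : Type} [DecidableEq R] [DecidableEq A]

/-- The command halts, and the final memory and the number of steps satisfy `Q`. -/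
def WP (c : Cmd R A) (σ : Mem R A) (Q : Mem R A → ℕ → Prop) : Prop :=
  ∃ τ t, Exec c σ τ t ∧ Q τ t

variable {c d : Cmd R A} {σ : Mem R A} {Q Q' : Mem R A → ℕ → Prop} {e : Expr R A}

theorem WP.mono (h : WP c σ Q) (hQ : ∀ τ t, Q τ t → Q' τ t) : WP c σ Q' :=
  let ⟨τ, t, h1, h2⟩ := h
  ⟨τ, t, h1, hQ τ t h2⟩

theorem WP.skip (h : Q σ 1) : WP .skip σ Q := ⟨_, _, .skip σ, h⟩

theorem WP.assign {r : R} (h : Q (σ.setReg r (e.eval σ)) (e.cost + 1)) :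
    WP (.assign r e) σ Q := ⟨_, _, .assign σ r e, h⟩

theorem WP.store {a : A} {i j : Expr R A}
    (h : Q (σ.setArr a (i.eval σ) (j.eval σ) (e.eval σ)) (i.cost + j.cost + e.cost + 1)) :
    WP (.store a i j e) σ Q := ⟨_, _, .store σ a i j e, h⟩

theorem WP.seq (h : WP c σ fun τ t => WP d τ fun υ u => Q υ (t + u)) : WP (.seq c d) σ Q :=
  let ⟨_, _, h1, _, _, h2, h3⟩ := h
  ⟨_, _, .seq _ _ _ _ _ _ _ h1 h2, h3⟩

theorem WP.ite (h1 : e.eval σ ≠ 0 → WP c σ fun τ t => Q τ (e.cost + 1 + t))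
    (h0 : e.eval σ = 0 → WP d σ fun τ t => Q τ (e.cost + 1 + t)) : WP (.ite e c d) σ Q := by
  by_cases h : e.eval σ = 0
  · obtain ⟨τ, t, h1, h2⟩ := h0 h
    exact ⟨_, _, .iteFalse _ _ _ _ _ _ h h1, h2⟩
  · obtain ⟨τ, t, h1, h2⟩ := h1 h
    exact ⟨_, _, .iteTrue _ _ _ _ _ _ h h1, h2⟩

theorem WP.loop_true (he : e.eval σ ≠ 0)
    (h : WP c σ fun τ t => WP (.loop e c) τ fun υ u => Q υ (e.cost + 1 + t + u)) :
    WP (.loop e c) σ Q :=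
  let ⟨_, _, h1, _, _, h2, h3⟩ := h
  ⟨_, _, .loopTrue _ _ _ _ _ _ _ he h1 h2, h3⟩

theorem WP.loop_false (he : e.eval σ = 0) (h : Q σ (e.cost + 1)) : WP (.loop e c) σ Q :=
  ⟨_, _, .loopFalse _ _ _ he, h⟩

end WP

section Mem

variable {R A : Type}

@[simp] theorem Mem.setReg_reg [DecidableEq R] (σ : Mem R A) (r r' : R) (v : ℕ) :
    (σ.setReg r v).reg r' = if r' = r then v else σ.reg r' := Function.update_apply _ _ _ _

@[simp] theorem Mem.setReg_arr [DecidableEq R] (σ : Mem R A) (r : R) (v : ℕ) :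
    (σ.setReg r v).arr = σ.arr := rfl

@[simp] theorem Mem.setArr_reg [DecidableEq A] (σ : Mem R A) (a : A) (i j v : ℕ) :
    (σ.setArr a i j v).reg = σ.reg := rfl

@[simp] theorem Mem.setArr_arr [DecidableEq A] (σ : Mem R A) (a a' : A) (i i' j j' v : ℕ) :
    (σ.setArr a i j v).arr a' i' j' =
      if a' = a ∧ i' = i ∧ j' = j then v else σ.arr a' i' j' := by
  by_cases ha : a' = a
  · subst ha
    by_cases hi : i' = i
    · subst hi
      simp [Mem.setArr, Function.update_apply]
    · simp [Mem.setArr, hi]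
  · simp [Mem.setArr, ha]

end Mem

/-! ### Branches and trees in memory; frame conditions. -/

section Rep

variable {n : ℕ}

/-- The number that encodes the type of a vertex. -/
def Kind.code : Kind → ℕ
  | .dead => 0
  | .cond => 1
  | .nec => 2

@[simp] theorem Kind.code_eq_zero {k : Kind} : k.code = 0 ↔ k = .dead := by cases k <;> simp [code]

@[simp] theorem Kind.code_eq_one {k : Kind} : k.code = 1 ↔ k = .cond := by cases k <;> simp [code]

@[simp] theorem Kind.code_eq_two {k : Kind} : k.code = 2 ↔ k = .nec := by cases k <;> simp [code]

/-- The array belongs to branch `s` of the trees. -/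
def IsBranchArr (s : Bool) : Arr → Prop
  | .kind s' => s' = s
  | .val s' => s' = s
  | .ent s' => s' = s
  | .head s' => s' = s
  | .top s' => s' = s
  | .loose s' => s' = s
  | _ => False

/-- The array belongs to the trees. -/
def IsTreeArr (a : Arr) : Prop := ∃ s, IsBranchArr s a

/-- The registers for intermediate values of the commands that update a tree. -/
def IsScratch : Reg → Prop
  | .u => True
  | .k => True
  | .α => True
  | .β => True
  | .infeas => True
  | _ => False

/-- Only row `g` of the arrays in `A` and the registers in `R` have changed. -/
structure Frame (A : Arr → Prop) (R : Reg → Prop) (g : ℕ) (σ τ : Mem Reg Arr) : Prop where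
  arr : ∀ a j, (A a → j ≠ g) → τ.arr a j = σ.arr a j
  reg : ∀ r, ¬ R r → τ.reg r = σ.reg r

variable {A A' : Arr → Prop} {R R' : Reg → Prop} {g : ℕ} {σ τ υ : Mem Reg Arr} {s : Bool}
  {B : Branch n} {t : ITree n}

theorem Frame.refl : Frame A R g σ σ := ⟨fun _ _ _ => rfl, fun _ _ => rfl⟩

theorem Frame.trans (h₁ : Frame A R g σ τ) (h₂ : Frame A R g τ υ) : Frame A R g σ υ :=
  ⟨fun a j h => (h₂.arr a j h).trans (h₁.arr a j h), fun r h => (h₂.reg r h).trans (h₁.reg r h)⟩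

theorem Frame.mono (h : Frame A R g σ τ) (hA : ∀ a, A a → A' a) (hR : ∀ r, R r → R' r) :
    Frame A' R' g σ τ :=
  ⟨fun a j h' => h.arr a j fun ha => h' (hA a ha), fun r h' => h.reg r fun hr => h' (hR r hr)⟩

theorem frame_setReg {r : Reg} (hr : R r) (v : ℕ) : Frame A R g σ (σ.setReg r v) := by
  refine ⟨fun _ _ _ => rfl, fun r' hr' => ?_⟩
  rw [Mem.setReg_reg, if_neg]
  rintro rfl
  exact hr' hr

theorem frame_setArr {a : Arr} (ha : A a) (j v : ℕ) : Frame A R g σ (σ.setArr a g j v) := by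
  refine ⟨fun a' i h => ?_, fun _ _ => rfl⟩
  funext j'
  rw [Mem.setArr_arr, if_neg]
  rintro ⟨rfl, rfl, -⟩
  exact h ha rfl

/-- A branch is stored in the memory. -/
structure Rep (σ : Mem Reg Arr) (g : ℕ) (s : Bool) (B : Branch n) : Prop where
  nodup : (B.slots.map Slot.e).Nodup
  top : σ.arr (.top s) g 0 = σ.arr (.head s) g 0 + B.slots.length
  ent : ∀ (j : ℕ) (v : Slot n), B.slots[j]? = some v →
    σ.arr (.ent s) g (σ.arr (.head s) g 0 + j) = v.e
  kind : ∀ v ∈ B.slots, σ.arr (.kind s) g v.e = v.k.code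
  val : ∀ v ∈ B.slots, σ.arr (.val s) g v.e = v.v.toNat
  absent : ∀ x : Fin n, (∀ v ∈ B.slots, v.e ≠ x) → σ.arr (.kind s) g x = 0
  loose : σ.arr (.loose s) g 0 = B.loose.toNat

theorem Rep.of_eq (h : Rep σ g s B) (he : ∀ a, IsBranchArr s a → τ.arr a g = σ.arr a g) :
    Rep τ g s B := by
  have h1 := he (.top s) rfl
  have h2 := he (.head s) rfl
  have h3 := he (.ent s) rfl
  have h4 := he (.kind s) rfl
  have h5 := he (.val s) rfl
  have h6 := he (.loose s) rfl
  obtain ⟨a0, a1, a2, a3, a4, a5, a6⟩ := h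
  exact ⟨a0, by rw [h1, h2, a1], by rw [h2, h3]; exact a2, by rw [h4]; exact a3,
    by rw [h5]; exact a4, by rw [h4]; exact a5, by rw [h6]; exact a6⟩

theorem isBranchArr_not {a : Arr} (h : IsBranchArr (!s) a) : ¬ IsBranchArr s a := by
  cases a <;> simp_all [IsBranchArr]

theorem Rep.frame_other (h : Rep σ g (!s) B) (hf : Frame (IsBranchArr s) R g σ τ) :
    Rep τ g (!s) B :=
  h.of_eq fun a ha => hf.arr a g fun h => absurd h (isBranchArr_not ha)

/-- An implication tree is stored in the memory. -/
def TRep (σ : Mem Reg Arr) (g : ℕ) (t : ITree n) : Prop := ∀ s, Rep σ g s (t s)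

/-- The number of slots of a tree. -/
def ITree.size (t : ITree n) : ℕ := (t false).slots.length + (t true).slots.length

theorem size_eq (t : ITree n) (s : Bool) :
    t.size = (t s).slots.length + (t !s).slots.length := by
  cases s <;> simp [ITree.size, Nat.add_comm]

end Rep

/-! ### Elementary commands on one branch. -/

namespace Tree

attribute [local simp] Expr.eval Expr.cost block at' put r c head top loose nonempty firstEntry
  lastEntry

variable {n : ℕ} {g : ℕ} {σ : Mem Reg Arr} {s : Bool} {a : Bool} {l m : List (Slot n)} {v : Slot n}
  {B : Branch n}

/-- No register changes. -/
abbrev NoReg : Reg → Prop := fun _ => False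

theorem Rep_last (h : Rep σ g s ⟨l ++ [v], a⟩) :
    σ.arr (.ent s) g (σ.arr (.top s) g 0 - 1) = v.e := by
  have := h.ent l.length v (by simp)
  rw [h.top]
  simpa using this

/-- Resetting the type of the removed entry keeps `kind` zero outside the branch, so that membership
can be tested by entry in constant time. -/
theorem removeLast_spec (hg : σ.reg .g = g) (h : Rep σ g s ⟨l ++ [v], a⟩) :
    WP (removeLast s) σ fun τ T =>
      T = 16 ∧ Frame (IsBranchArr s) NoReg g σ τ ∧ Rep τ g s ⟨l, a⟩ := by
  have hlast := Rep_last h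
  obtain ⟨h0, h1, h2, h3, h4, h5, h6⟩ := h
  simp only [List.map_append, List.map_cons, List.map_nil, List.nodup_append] at h0
  refine WP.seq (WP.store (WP.store ⟨by simp, ?_, ?_⟩))
  · simp only [r, Expr.eval, hg, Mem.setArr_reg]
    exact (frame_setArr (by rfl) _ _).trans (frame_setArr (by rfl) _ _)
  · simp [hg, hlast]
    refine ⟨h0.1, ?_, ?_, ?_, ?_, ?_, ?_⟩
    · simp [h1]
    · intro j w hj
      simp
      exact h2 j w (by rw [List.getElem?_append_left (List.getElem?_eq_some_iff.1 hj).1]; exact hj)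
    · intro w hw
      have : w.e ≠ v.e := h0.2.2 _ (List.mem_map_of_mem hw) _ (by simp)
      simp [Fin.val_inj, this, h3 w (by simp [hw])]
    · intro w hw
      simp [h4 w (by simp [hw])]
    · intro x hx
      simp only [Mem.setArr_arr]
      simp only [reduceCtorEq, false_and, if_false, true_and]
      split_ifs with hxv
      · rfl
      · apply h5
        intro w hw
        simp at hw
        rcases hw with hw | rfl
        · exact hx w hw
        · exact fun h => hxv (by rw [h])
    · simp [h6]

theorem append_spec (hg : σ.reg .g = g) (h : Rep σ g s B) {x : Reg} {e : Fin n}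
    (hx : σ.reg x = e) (he : ∀ w ∈ B.slots, w.e ≠ e) (k : Kind) (b : Bool) :
    WP (append s k.code x b.toNat) σ fun τ T =>
      T ≤ 40 ∧ Frame (IsBranchArr s) NoReg g σ τ ∧ Rep τ g s (B.append [⟨e, k, b⟩]) := by
  obtain ⟨h0, h1, h2, h3, h4, h5, h6⟩ := h
  refine WP.seq (WP.store (WP.seq (WP.store (WP.seq (WP.store (WP.store ⟨by simp, ?_, ?_⟩))))))
  · simp only [r, Expr.eval, hg, Mem.setArr_reg]
    exact (((frame_setArr (by rfl) _ _).trans (frame_setArr (by rfl) _ _)).trans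
      (frame_setArr (by rfl) _ _)).trans (frame_setArr (by rfl) _ _)
  · simp [hg, hx]
    refine ⟨?_, ?_, ?_, ?_, ?_, ?_, ?_⟩
    · simp only [Branch.append, List.map_append, List.nodup_append]
      refine ⟨h0, by simp, ?_⟩
      simp only [List.mem_map, List.map_cons, List.map_nil, List.mem_singleton]
      rintro a ⟨v, hv, rfl⟩ b rfl h
      exact he v hv h
    · simp [Branch.append, h1, Nat.add_assoc]
    · intro j w hj
      simp only [Mem.setArr_arr]
      simp only [reduceCtorEq, false_and, if_false, true_and, h1, Nat.add_left_cancel_iff]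
      rw [Branch.append] at hj
      split_ifs with hjl
      · simp [hjl] at hj
        simp [← hj]
      · apply h2
        have := (List.getElem?_eq_some_iff.1 hj).1
        simp at this
        rwa [List.getElem?_append_left (by omega)] at hj
    · intro w hw
      simp only [Branch.append, List.mem_append, List.mem_singleton] at hw
      rcases hw with hw | rfl
      · simp [Fin.val_inj, he w hw, h3 w hw]
      · simp
    · intro w hw
      simp only [Branch.append, List.mem_append, List.mem_singleton] at hw
      rcases hw with hw | rfl
      · simp [Fin.val_inj, he w hw, h4 w hw]
      · simp
    · intro x hx
      simp only [Branch.append, List.mem_append, List.mem_singleton] at hx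
      have hne : e ≠ x := hx ⟨e, k, b⟩ (Or.inr rfl)
      simp [Fin.val_inj, hne.symm, h5 x fun v hv => hx v (Or.inl hv)]
    · simp [Branch.append, h6]

theorem setLoose_spec (hg : σ.reg .g = g) (h : Rep σ g s B) (b : Bool) :
    WP (put (.loose s) (c 0) (c b.toNat)) σ fun τ T =>
      T = 4 ∧ Frame (IsBranchArr s) NoReg g σ τ ∧ Rep τ g s ⟨B.slots, b⟩ := by
  obtain ⟨h0, h1, h2, h3, h4, h5, h6⟩ := h
  refine WP.store ⟨by simp, ?_, ?_⟩
  · simp only [r, Expr.eval, hg]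
    exact frame_setArr (by rfl) _ _
  · simp [hg]
    exact ⟨h0, by simpa using h1, by simpa using h2, by simpa using h3, by simpa using h4,
      by simpa using h5, by simp⟩

theorem eval_nonempty (hg : σ.reg .g = g) (h : Rep σ g s B) :
    (nonempty s).eval σ ≠ 0 ↔ B.slots ≠ [] := by
  simp [hg, h.top, List.length_pos_iff]

theorem eval_lastEntry (hg : σ.reg .g = g) (h : Rep σ g s ⟨l ++ [v], a⟩) :
    (lastEntry s).eval σ = v.e := by
  have := Rep_last h
  simpa [hg] using this

theorem eval_firstEntry (hg : σ.reg .g = g) (h : Rep σ g s ⟨v :: l, a⟩) :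
    (firstEntry s).eval σ = v.e := by
  have := h.ent 0 v (by simp)
  simpa [hg] using this

theorem removeBranch_spec (hg : σ.reg .g = g) (h : Rep σ g s B) :
    WP (removeBranch s) σ fun τ T =>
      T ≤ 40 * B.slots.length + 40 ∧ Frame (IsBranchArr s) NoReg g σ τ ∧
        Rep τ g s (.empty n) := by
  refine WP.seq ((setLoose_spec hg h false).mono ?_)
  rintro τ T ⟨rfl, hf, hr⟩
  have hgτ := (hf.reg .g id).trans hg
  clear h
  suffices WP (.loop (nonempty s) (removeLast s)) τ fun υ U =>
      U ≤ 40 * B.slots.length + 10 ∧ Frame (IsBranchArr s) NoReg g τ υ ∧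
        Rep υ g s (.empty n) from
    this.mono fun υ U ⟨h1, h2, h3⟩ => ⟨by omega, hf.trans h2, h3⟩
  generalize B.slots = l at *
  clear hf hg
  induction l using List.reverseRecOn generalizing τ with
  | nil =>
    refine WP.loop_false ?_ ⟨by simp, .refl, hr⟩
    by_contra hc
    exact (eval_nonempty hgτ hr).1 hc rfl
  | append_singleton l v ih =>
    refine WP.loop_true ((eval_nonempty hgτ hr).2 (by simp)) ((removeLast_spec hgτ hr).mono ?_)
    rintro υ U ⟨rfl, hf, hr⟩
    refine (ih υ ((hf.reg .g id).trans hgτ) hr).mono ?_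
    rintro τ T ⟨h1, h2, h3⟩
    refine ⟨?_, hf.trans h2, h3⟩
    simp
    omega

/-- A round takes fewer than 40 steps and frees a slot, so the slots pay for the loop; the 30 covers
the final failing test. The other removal loops are counted in the same way. -/
theorem cutLoop_spec (hg : σ.reg .g = g) (h : Rep σ g s ⟨l, a⟩) :
    WP (.loop (.and (nonempty s) (.not (.eq (at' (.kind s) (lastEntry s)) (c 1))))
      (removeLast s)) σ fun τ T =>
        T + 40 * (cut l).length ≤ 40 * l.length + 30 ∧ Frame (IsBranchArr s) NoReg g σ τ ∧
          Rep τ g s ⟨cut l, a⟩ := by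
  induction l using List.reverseRecOn generalizing σ with
  | nil =>
    refine WP.loop_false ?_ ⟨by simp [cut], .refl, by simpa [cut] using h⟩
    have := eval_nonempty hg h
    rw [Expr.eval, if_neg]
    rintro ⟨h1, -⟩
    exact this.1 h1 rfl
  | append_singleton l v ih =>
    have h1 : (at' (.kind s) (lastEntry s)).eval σ = v.k.code := by
      have h2 : (at' (.kind s) (lastEntry s)).eval σ =
          σ.arr (.kind s) (σ.reg .g) ((lastEntry s).eval σ) := rfl
      rw [h2, eval_lastEntry hg h, hg, h.kind v (by simp)]
    have h2 := (eval_nonempty hg h).2 (by simp)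
    have h3 : (Expr.and (nonempty s) (.not (.eq (at' (.kind s) (lastEntry s)) (c 1)))).eval σ ≠ 0 ↔
        v.k ≠ .cond := by
      rw [Expr.eval, Expr.eval, Expr.eval, h1]
      simp only [c, Expr.eval]
      generalize Expr.eval σ (nonempty s) = N at h2 ⊢
      simp [h2]
    rw [cut_append_singleton]
    by_cases hv : v.k = .cond
    · rw [if_pos hv]
      refine WP.loop_false (by simpa [hv] using h3) ⟨by simp; omega, .refl, h⟩
    · rw [if_neg hv]
      refine WP.loop_true (h3.2 hv) ((removeLast_spec hg h).mono ?_)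
      rintro υ U ⟨rfl, hf, hr⟩
      refine (ih ((hf.reg .g id).trans hg) hr).mono ?_
      rintro τ T ⟨h1, h2, h3⟩
      refine ⟨?_, hf.trans h2, h3⟩
      simp
      omega

/-- No other vertex of the branch has the entry `i`, so its type becomes 0 exactly when the vertex
`v` itself is removed. -/
theorem removeUntil_spec (hg : σ.reg .g = g) {i : Fin n} (hi : σ.reg .i = i)
    (h : Rep σ g s ⟨l ++ v :: m, a⟩) (hv : v.e = i) (hk : v.k ≠ .dead) :
    WP (.loop (at' (.kind s) (r .i)) (removeLast s)) σ fun τ T =>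
        T ≤ 40 * (m.length + 1) + 30 ∧ Frame (IsBranchArr s) NoReg g σ τ ∧
          Rep τ g s ⟨l, a⟩ := by
  have hloop : (at' (.kind s) (r .i)).eval σ ≠ 0 := by
    have := h.kind v (by simp)
    rw [hv] at this
    simp [hg, hi, this, hk]
  induction m using List.reverseRecOn generalizing σ with
  | nil =>
    refine WP.loop_true hloop ((removeLast_spec hg h).mono ?_)
    rintro υ U ⟨rfl, hf, hr⟩
    refine WP.loop_false ?_ ⟨by simp, hf, hr⟩
    have h1 := hf.reg .g id
    have h2 := hf.reg .i id
    have := hr.absent i fun w hw he => ?_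
    · simp [h1, h2, hg, hi, this]
    · have := h.nodup
      simp only [List.map_append, List.map_cons, List.nodup_append] at this
      exact this.2.2 w.e (List.mem_map_of_mem hw) v.e (by simp) (he.trans hv.symm)
  | append_singleton m w ih =>
    have h' : Rep σ g s ⟨(l ++ v :: m) ++ [w], a⟩ := by simpa using h
    refine WP.loop_true hloop ((removeLast_spec hg h').mono ?_)
    rintro υ U ⟨rfl, hf, hr⟩
    have h1 := (hf.reg .g id).trans hg
    have h2 := (hf.reg .i id).trans hi
    refine (ih h1 h2 hr ?_).mono ?_
    · have := hr.kind v (by simp)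
      rw [hv] at this
      simp [h1, h2, this, hk]
    · rintro τ T ⟨h1, h2, h3⟩
      refine ⟨?_, hf.trans h2, h3⟩
      simp
      omega

theorem trimHead_spec (hg : σ.reg .g = g) (h : Rep σ g s ⟨l, a⟩) :
    WP (trimHead s) σ fun τ T =>
      T + 40 * (trim l).length ≤ 40 * l.length + 30 ∧ Frame (IsBranchArr s) NoReg g σ τ ∧
        Rep τ g s ⟨trim l, a⟩ := by
  unfold trimHead
  induction l generalizing σ with
  | nil =>
    refine WP.loop_false ?_ ⟨by simp [trim], .refl, by simpa [trim] using h⟩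
    have := eval_nonempty hg h
    rw [Expr.eval, if_neg]
    rintro ⟨h1, -⟩
    exact this.1 h1 rfl
  | cons v l ih =>
    have h1 : (at' (.kind s) (firstEntry s)).eval σ = v.k.code := by
      have h2 : (at' (.kind s) (firstEntry s)).eval σ =
          σ.arr (.kind s) (σ.reg .g) ((firstEntry s).eval σ) := rfl
      rw [h2, eval_firstEntry hg h, hg, h.kind v (by simp)]
    have h2 := (eval_nonempty hg h).2 (by simp)
    have h3 : (Expr.and (nonempty s) (.eq (at' (.kind s) (firstEntry s)) (c 0))).eval σ ≠ 0 ↔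
        v.k = .dead := by
      rw [Expr.eval, Expr.eval, h1]
      simp only [c, Expr.eval]
      generalize Expr.eval σ (nonempty s) = N at h2 ⊢
      simp [h2]
    by_cases hv : v.k = .dead
    · refine WP.loop_true (h3.2 hv) (WP.store ?_)
      have hf : Frame (IsBranchArr s) NoReg g σ
          (σ.setArr (.head s) ((r .g).eval σ) ((c 0).eval σ) ((Expr.succ (head s)).eval σ)) := by
        simp only [r, Expr.eval, hg]
        exact frame_setArr (by rfl) _ _
      have ht : trim (v :: l) = trim l := List.dropWhile_cons_of_pos (by simpa using hv)
      rw [ht]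
      refine (ih ((hf.reg .g id).trans hg) ?_).mono ?_
      · obtain ⟨h0, h1, h2, h3, h4, h5, h6⟩ := h
        simp [hg]
        refine ⟨List.Nodup.of_cons h0, ?_, ?_, ?_, ?_, ?_, ?_⟩
        · simp [h1]; omega
        · intro j w hj
          have := h2 (j + 1) w (by simpa using hj)
          simpa [Nat.add_assoc, Nat.add_comm 1 j] using this
        · intro w hw
          simp [h3 w (by simp [hw])]
        · intro w hw
          simp [h4 w (by simp [hw])]
        · intro x hx
          simp only [Mem.setArr_arr, reduceCtorEq, false_and, if_false]
          -- The skipped vertex was marked as removed, so the type stored for its entry is already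
          -- 0.
          by_cases hvx : v.e = x
          · rw [← hvx, h3 v (by simp), hv]
            rfl
          · refine h5 x fun w hw => ?_
            rcases List.mem_cons.1 hw with rfl | hw
            · exact hvx
            · exact hx w hw
        · simp [h6]
      · rintro τ T ⟨h1, h2, h3⟩
        refine ⟨?_, hf.trans h2, h3⟩
        simp
        omega
    · rw [trim_cons hv]
      exact WP.loop_false (by simpa [hv] using h3) ⟨by simp; omega, .refl, h⟩

end Tree

end Symresack

/-! ### The commands for conflicts and for fixings on one branch. -/

namespace Symresack

variable {n : ℕ} {g : ℕ} {σ τ υ : Mem Reg Arr} {s : Bool} {a : Bool} {l m : List (Slot n)}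
  {v : Slot n} {B B' : Branch n} {t t' : ITree n} {I : Fixings n}

/-- The tree with the branches `B` at `s` and `B'` at `!s`. -/
def mkTree (s : Bool) (B B' : Branch n) : ITree n := fun s' => if s' = s then B else B'

@[simp] theorem mkTree_self : mkTree s B B' s = B := by simp [mkTree]

@[simp] theorem mkTree_not : mkTree s B B' (!s) = B' := by simp [mkTree]

theorem tRep_iff (s : Bool) : TRep σ g t ↔ Rep σ g s (t s) ∧ Rep σ g (!s) (t !s) := forall_bool s

theorem tRep_mkTree : TRep σ g (mkTree s B B') ↔ Rep σ g s B ∧ Rep σ g (!s) B' := by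
  rw [tRep_iff s, mkTree_self, mkTree_not]

theorem tRep_update (h : Rep σ g s B) (h' : Rep σ g (!s) (t !s)) :
    TRep σ g (Function.update t s B) := by
  rw [tRep_iff s, Function.update_self, update_not]
  exact ⟨h, h'⟩

theorem size_mkTree : (mkTree s B B').size = B.slots.length + B'.slots.length := by
  rw [size_eq _ s, mkTree_self, mkTree_not]

theorem size_update : ITree.size (Function.update t s B) = B.slots.length + (t !s).slots.length := by
  rw [size_eq _ s, Function.update_self, update_not]

theorem Rep.frame_same {R : Reg → Prop} (h : Rep σ g s B)
    (hf : Frame (IsBranchArr (!s)) R g σ τ) : Rep τ g s B := by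
  have := Rep.frame_other (s := !s) (σ := σ) (B := B) (by simpa using h) hf
  simpa using this

theorem Frame.toTree {R : Reg → Prop} (h : Frame (IsBranchArr s) Tree.NoReg g σ τ) :
    Frame IsTreeArr R g σ τ := h.mono (fun _ ha => ⟨s, ha⟩) fun _ => False.elim

theorem TRep.of_arr (h : TRep σ g t) (he : τ.arr = σ.arr) : TRep τ g t :=
  fun s => (h s).of_eq fun a _ => by rw [he]

theorem Rep.of_arr (h : Rep σ g s B) (he : τ.arr = σ.arr) : Rep τ g s B :=
  h.of_eq fun a _ => by rw [he]

/-- Change the type and the value of a vertex. -/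
theorem Rep.modify (h : Rep σ g s ⟨l ++ v :: m, a⟩) {k : Kind} {b : Bool}
    (hkind : ∀ x, τ.arr (.kind s) g x = if x = v.e then k.code else σ.arr (.kind s) g x)
    (hval : ∀ x, τ.arr (.val s) g x = if x = v.e then b.toNat else σ.arr (.val s) g x)
    (hent : τ.arr (.ent s) g = σ.arr (.ent s) g) (hhead : τ.arr (.head s) g = σ.arr (.head s) g)
    (htop : τ.arr (.top s) g = σ.arr (.top s) g)
    (hloose : τ.arr (.loose s) g = σ.arr (.loose s) g) :
    Rep τ g s ⟨l ++ ⟨v.e, k, b⟩ :: m, a⟩ := by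
  obtain ⟨h0, h1, h2, h3, h4, h5, h6⟩ := h
  have hne : ∀ w ∈ l ++ m, w.e ≠ v.e := by
    intro w hw he
    rw [List.map_append, List.map_cons, List.nodup_append, List.nodup_cons] at h0
    rcases List.mem_append.1 hw with hw | hw
    · exact h0.2.2 w.e (List.mem_map_of_mem hw) v.e (by simp) he
    · exact h0.2.1.1 (he ▸ List.mem_map_of_mem hw)
  refine ⟨by simpa using h0, ?_, ?_, ?_, ?_, ?_, ?_⟩
  · rw [htop, hhead, h1]; simp
  · rw [hent, hhead]
    intro j w hj
    rcases Nat.lt_trichotomy j l.length with hjl | hjl | hjl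
    · apply h2
      simp only [List.getElem?_append_left hjl] at hj ⊢
      exact hj
    · subst hjl
      simp at hj
      rw [h2 l.length v (by simp), ← hj]
    · apply h2
      obtain ⟨d, rfl⟩ := Nat.exists_eq_add_of_lt hjl
      simp only [List.getElem?_append_right (show l.length ≤ l.length + d + 1 by omega),
        show l.length + d + 1 - l.length = d + 1 by omega, List.getElem?_cons_succ] at hj ⊢
      exact hj
  · intro w hw
    rw [hkind]
    simp only [List.mem_append, List.mem_cons] at hw
    rcases hw with hw | rfl | hw
    · rw [if_neg (by rw [Fin.val_inj]; exact hne w (by simp [hw])), h3 w (by simp [hw])]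
    · simp
    · rw [if_neg (by rw [Fin.val_inj]; exact hne w (by simp [hw])), h3 w (by simp [hw])]
  · intro w hw
    rw [hval]
    simp only [List.mem_append, List.mem_cons] at hw
    rcases hw with hw | rfl | hw
    · rw [if_neg (by rw [Fin.val_inj]; exact hne w (by simp [hw])), h4 w (by simp [hw])]
    · simp
    · rw [if_neg (by rw [Fin.val_inj]; exact hne w (by simp [hw])), h4 w (by simp [hw])]
  · intro x hx
    simp only [List.mem_append, List.mem_cons] at hx
    rw [hkind, if_neg, h5 x]
    · intro w hw
      simp only [List.mem_append, List.mem_cons] at hw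
      rcases hw with hw | rfl | hw
      · exact hx w (by simp [hw])
      · exact hx ⟨w.e, k, b⟩ (Or.inr (Or.inl rfl))
      · exact hx w (by simp [hw])
    · rw [Fin.val_inj]
      exact (hx ⟨v.e, k, b⟩ (Or.inr (Or.inl rfl))).symm
  · rw [hloose, h6]

namespace Tree

attribute [local simp] Expr.eval Expr.cost block at' put r c head top loose nonempty firstEntry
  lastEntry

theorem flip_spec (hg : σ.reg .g = g) (h : Rep σ g s ⟨l ++ [v], a⟩) (hu : σ.reg .u = v.e) :
    WP (block [put (.kind s) (r .u) (c 2), put (.val s) (r .u) (.not (at' (.val s) (r .u)))]) σ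
      fun τ T => T ≤ 20 ∧ Frame (IsBranchArr s) NoReg g σ τ ∧
        Rep τ g s ⟨l ++ [⟨v.e, .nec, !v.v⟩], a⟩ := by
  have hval := h.val v (by simp)
  refine WP.seq (WP.store (WP.store ⟨by simp, ?_, h.modify ?_ ?_ ?_ ?_ ?_ ?_⟩))
  · simp only [r, Expr.eval, hg, Mem.setArr_reg]
    exact (frame_setArr (by rfl) _ _).trans (frame_setArr (by rfl) _ _)
  all_goals simp [funext_iff, hg, hu, hval, Kind.code]
  intro x
  cases v.v <;> rfl

theorem kill_spec (hg : σ.reg .g = g) {i : Fin n} (hi : σ.reg .i = i)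
    (h : Rep σ g s ⟨l ++ v :: m, a⟩) (hv : v.e = i) :
    WP (put (.kind s) (r .i) (c 0)) σ
      fun τ T => T ≤ 20 ∧ Frame (IsBranchArr s) NoReg g σ τ ∧
        Rep τ g s ⟨l ++ ⟨v.e, .dead, v.v⟩ :: m, a⟩ := by
  have hval := h.val v (by simp)
  refine WP.store ⟨by simp, ?_, h.modify ?_ ?_ ?_ ?_ ?_ ?_⟩
  · simp only [r, Expr.eval, hg]
    exact frame_setArr (by rfl) _ _
  all_goals simp [funext_iff, hg, hi, hv, Kind.code]
  rw [← hv, hval]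

/-- Types and values are stored by entry, so exchanging two vertices only changes the array `ent`.
-/
theorem swap_spec (hg : σ.reg .g = g) {w : Slot n} (h : Rep σ g s ⟨w :: v :: m, a⟩)
    (hu : σ.reg .u = v.e) :
    WP (block [put (.ent s) (.succ (head s)) (firstEntry s), put (.ent s) (head s) (r .u)]) σ
      fun τ T => T ≤ 30 ∧ Frame (IsBranchArr s) NoReg g σ τ ∧
        Rep τ g s ⟨v :: w :: m, a⟩ := by
  have hfirst := h.ent 0 w (by simp)
  obtain ⟨h0, h1, h2, h3, h4, h5, h6⟩ := h
  refine WP.seq (WP.store (WP.store ⟨by simp, ?_, ?_⟩))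
  · simp only [r, Expr.eval, hg, Mem.setArr_reg]
    exact (frame_setArr (by rfl) _ _).trans (frame_setArr (by rfl) _ _)
  · simp at hfirst
    simp [hg, hu, hfirst]
    refine ⟨?_, ?_, ?_, ?_, ?_, ?_, ?_⟩
    · simp only [List.map_cons, List.nodup_cons, List.mem_cons, not_or] at h0 ⊢
      exact ⟨⟨fun h => h0.1.1 h.symm, h0.2.1⟩, h0.1.2, h0.2.2⟩
    · simpa using h1
    · intro j x hj
      simp only [Mem.setArr_arr, reduceCtorEq, false_and, if_false, true_and]
      rcases j with _ | _ | j
      · simp at hj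
        simp [hj]
      · simp at hj
        simp [hj]
      · rw [if_neg (by omega), if_neg (by omega)]
        exact h2 (j + 2) x (by simpa using hj)
    · intro x hx
      simpa using h3 x (by simp at hx ⊢; tauto)
    · intro x hx
      simpa using h4 x (by simp at hx ⊢; tauto)
    · intro x hx
      simpa using h5 x fun y hy => hx y (by simp at hy ⊢; tauto)
    · simpa using h6

/-- The effect of a command on a tree. -/
structure TreePost (σ : Mem Reg Arr) (g : ℕ) (t : ITree n) (cost : ℕ) (τ : Mem Reg Arr) (T : ℕ)
    (t' : ITree n) (bad : Bool) : Prop where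
  rep : TRep τ g t'
  frame : Frame IsTreeArr IsScratch g σ τ
  infeas : τ.reg .infeas = if bad then 1 else σ.reg .infeas
  time : T + 40 * t'.size ≤ 40 * t.size + cost

theorem conflict_spec (hg : σ.reg .g = g) (h : TRep σ g t) (hm : MergeOK s t) :
    WP (conflict s) σ fun τ T => ∃ t' bad, ConflictRel s t t' bad ∧
      TreePost σ g t 300 τ T t' bad := by
  have hsz := size_eq t s
  unfold conflict
  refine WP.seq ((setLoose_spec hg (h s) false).mono ?_)
  rintro τ₁ T₁ ⟨rfl, hf₁, hr₁⟩
  have hg₁ := (hf₁.reg .g id).trans hg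
  have ho₁ := (h !s).frame_other hf₁
  refine WP.seq ((cutLoop_spec hg₁ hr₁).mono ?_)
  rintro τ₂ T₂ ⟨hT₂, hf₂, hr₂⟩
  have hg₂ := (hf₂.reg .g id).trans hg₁
  have ho₂ := ho₁.frame_other hf₂
  have hf := hf₁.trans hf₂
  have hcost : (nonempty s).cost = 7 := by simp
  refine WP.ite (fun hc => ?_) fun hc => ?_
  · have hne := (eval_nonempty hg₂ hr₂).1 hc
    obtain ⟨l, u, hl⟩ : ∃ l u, cut (t s).slots = l ++ [u] := by
      rcases List.eq_nil_or_concat (cut (t s).slots) with h | ⟨l, u, h⟩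
      · exact absurd h hne
      · exact ⟨l, u, by simpa using h⟩
    rw [hl] at hr₂ hT₂
    refine WP.seq (WP.assign ?_)
    rw [eval_lastEntry hg₂ hr₂]
    have hf₃ : Frame IsTreeArr IsScratch g τ₂ (τ₂.setReg .u u.e) := frame_setReg trivial _
    set τ₃ := τ₂.setReg .u u.e with hτ₃
    have hg₃ : τ₃.reg .g = g := by simp [hτ₃, hg₂]
    have hu₃ : τ₃.reg .u = u.e := by simp [hτ₃]
    have hr₃ : Rep τ₃ g s ⟨l ++ [u], false⟩ := hr₂.of_arr (by simp [hτ₃])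
    have ho₃ : Rep τ₃ g (!s) (t !s) := ho₂.of_arr (by simp [hτ₃])
    have hfr := hf.toTree (R := IsScratch) |>.trans hf₃
    have hcond : (Expr.and (.eq (.succ (head s)) (top s)) (nonempty !s)).eval τ₃ ≠ 0 ↔
        l = [] ∧ (t !s).slots ≠ [] := by
      have := eval_nonempty hg₃ ho₃
      rw [Expr.eval, ← this]
      have h2 := hr₃.top
      simp only [Expr.eval, head, top, at', r, c, hg₃, h2]
      generalize Expr.eval τ₃ (nonempty !s) = N
      cases l <;> simp
    refine WP.ite (fun hc' => ?_) fun hc' => ?_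
    · obtain ⟨rfl, hne'⟩ := hcond.1 hc'
      -- The program writes the entry of `u` into the first slot of the other branch. `MergeOK` says
      -- that this is the entry of the second vertex there, so the two writes form an exchange.
      obtain ⟨w, e, q, hw, hwe⟩ := hm u hl hne'
      have ho₃' : Rep τ₃ g (!s) ⟨w :: e :: q, (t !s).loose⟩ := by rw [← hw]; exact ho₃
      refine WP.seq ((removeLast_spec hg₃ hr₃).mono ?_)
      rintro τ₄ T₄ ⟨rfl, hf₄, hr₄⟩
      have hg₄ := (hf₄.reg .g id).trans hg₃
      have hu₄ := (hf₄.reg .u id).trans hu₃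
      refine (swap_spec hg₄ (ho₃'.frame_other hf₄) (by rw [hu₄, hwe])).mono ?_
      rintro τ₅ T₅ ⟨hT₅, hf₅, hr₅⟩
      refine ⟨mkTree s (.empty n) ⟨e :: w :: q, (t !s).loose⟩, false,
        .merge u w e q hl hw mkTree_self mkTree_not,
        tRep_mkTree.2 ⟨hr₄.frame_same hf₅, hr₅⟩, (hfr.trans hf₄.toTree).trans hf₅.toTree, ?_, ?_⟩
      · simp [hf₅.reg .infeas id, hf₄.reg .infeas id, hτ₃, hf.reg .infeas id]
      · simp [size_mkTree, hsz, hw, Branch.empty] at hT₂ ⊢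
        omega
    · refine (flip_spec hg₃ hr₃ hu₃).mono ?_
      rintro τ₄ T₄ ⟨hT₄, hf₄, hr₄⟩
      refine ⟨mkTree s ⟨l ++ [⟨u.e, .nec, !u.v⟩], false⟩ (t !s), false,
        .flip l u hl ?_ mkTree_self mkTree_not,
        tRep_mkTree.2 ⟨hr₄, ho₃.frame_other hf₄⟩, hfr.trans hf₄.toTree, ?_, ?_⟩
      · intro hl'
        by_contra hne'
        exact hcond.2 ⟨hl', hne'⟩ hc'
      · simp [hf₄.reg .infeas id, hτ₃, hf.reg .infeas id]
      · simp [size_mkTree, hsz] at hT₂ ⊢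
        omega
  · have hnil : cut (t s).slots = [] := by
      by_contra hne
      exact (eval_nonempty hg₂ hr₂).2 hne hc
    rw [hnil] at hr₂ hT₂
    refine WP.assign ⟨mkTree s (.empty n) (t !s), true, .bad hnil mkTree_self mkTree_not,
      tRep_mkTree.2 ⟨hr₂.of_arr rfl, ho₂.of_arr rfl⟩,
      hf.toTree.trans (frame_setReg trivial _), by simp, ?_⟩
    simp [size_mkTree, hsz, Branch.empty] at hT₂ ⊢
    omega

theorem fixBranch_spec (hg : σ.reg .g = g) (h : TRep σ g t) {i : Fin n} {b : Bool}
    (hi : σ.reg .i = i) (hb : σ.reg .b = b.toNat) (hm : FixMergeOK s i b t) :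
    WP (fixBranch s) σ fun τ T => ∃ t' bad, FixRel s i b t t' bad ∧
      TreePost σ g t 700 τ T t' bad := by
  have hsz := size_eq t s
  unfold fixBranch
  by_cases hex : ∃ v ∈ (t s).slots, v.e = i ∧ v.k ≠ .dead
  swap
  · -- the entry does not occur
    refine WP.ite (fun hc => absurd hc ?_) fun _ => WP.skip
      ⟨t, false, .none ?_ rfl rfl, h, .refl, by simp, by simp; omega⟩
    · simp only [at', r, Expr.eval, hg, hi, not_not]
      by_cases hv : ∃ v ∈ (t s).slots, v.e = i
      · obtain ⟨v, hv, he⟩ := hv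
        rw [← he, (h s).kind v hv, Kind.code_eq_zero]
        by_contra hk
        exact hex ⟨v, hv, he, hk⟩
      · push Not at hv
        exact (h s).absent i hv
    · intro v hv he
      by_contra hk
      exact hex ⟨v, hv, he, hk⟩
  obtain ⟨v, hv, he, hk⟩ := hex
  have hkind := (h s).kind v hv
  have hval := (h s).val v hv
  rw [he] at hkind hval
  obtain ⟨l, m, hs⟩ := List.append_of_mem hv
  have hrs : Rep σ g s ⟨l ++ v :: m, (t s).loose⟩ := by rw [← hs]; exact h s
  have hlen : (t s).slots.length = l.length + m.length + 1 := by rw [hs]; simp; omega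
  refine WP.ite (fun _ => ?_) fun hc => absurd hc ?_
  swap
  · simp [hg, hi, hkind, hk]
  refine WP.seq (WP.ite (fun hc => ?_) fun hc => ?_)
  · -- the vertex has this fixing
    have hvb : v.v = b := by
      simp [hg, hi, hb, hval] at hc
      revert hc
      cases v.v <;> cases b <;> simp
    refine WP.seq ((kill_spec hg hi hrs he).mono ?_)
    rintro τ₁ T₁ ⟨hT₁, hf₁, hr₁⟩
    have hg₁ := (hf₁.reg .g id).trans hg
    have hi₁ := (hf₁.reg .i id).trans hi
    have ho₁ := (h !s).frame_other hf₁
    have hcond : (Expr.and (.eq (firstEntry s) (r .i)) (nonempty !s)).eval τ₁ ≠ 0 ↔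
        l.isEmpty ∧ (t !s).slots ≠ [] := by
      rw [Expr.eval, ← eval_nonempty hg₁ ho₁]
      generalize Expr.eval τ₁ (nonempty !s) = N
      have hfe : (firstEntry s).eval τ₁ = τ₁.reg .i ↔ l.isEmpty := by
        rcases l with _ | ⟨w, l⟩
        · rw [eval_firstEntry hg₁ hr₁, hi₁, he]
          simp
        · have hr₁' : Rep τ₁ g s ⟨w :: (l ++ ⟨v.e, .dead, v.v⟩ :: m), (t s).loose⟩ := hr₁
          rw [eval_firstEntry hg₁ hr₁', hi₁, Fin.val_inj, ← he]
          simp only [List.isEmpty_cons, Bool.false_eq_true, iff_false]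
          intro h
          have := hr₁'.nodup
          simp [h] at this
      simp only [Expr.eval, r]
      generalize Expr.eval τ₁ (firstEntry s) = E at hfe ⊢
      simp [hfe]
    -- Whether or not the other branch is removed, the trimming that follows is the same; a removal
    -- is paid for by the slots of that branch.
    have hskip : ∀ τ₂ T₂ B', Frame IsTreeArr IsScratch g τ₁ τ₂ →
        τ₂.reg .g = g → τ₂.reg .infeas = τ₁.reg .infeas →
        Rep τ₂ g s ⟨l ++ ⟨v.e, .dead, v.v⟩ :: m, (t s).loose⟩ → Rep τ₂ g (!s) B' →
        B' = (if l.isEmpty ∧ (t !s).slots ≠ [] then .empty n else t !s) →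
        T₂ + 40 * B'.slots.length ≤ 40 * (t !s).slots.length + 200 →
        WP (trimHead s) τ₂ fun υ u => ∃ t' bad, FixRel s i b t t' bad ∧
          TreePost σ g t 700 υ (T₁ + T₂ + u + 100) t' bad := by
      intro τ₂ T₂ B' hf₂ hg₂ hin hr₂ ho₂ hB hT₂
      refine (trimHead_spec hg₂ hr₂).mono ?_
      rintro τ₃ T₃ ⟨hT₃, hf₃, hr₃⟩
      refine ⟨mkTree s ⟨trim (l ++ ⟨v.e, .dead, v.v⟩ :: m), (t s).loose⟩ B', false,
        .hit l m v hs he hk hvb mkTree_self (mkTree_not.trans hB),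
        tRep_mkTree.2 ⟨hr₃, ho₂.frame_other hf₃⟩, (hf₁.toTree.trans hf₂).trans hf₃.toTree,
        ?_, ?_⟩
      · simp [hf₃.reg .infeas id, hin, hf₁.reg .infeas id]
      · simp only [List.length_append, List.length_cons] at hT₃
        simp only [size_mkTree, hsz, hlen]
        omega
    refine WP.ite (fun hc' => ?_) fun hc' => ?_
    · refine (removeBranch_spec hg₁ ho₁).mono ?_
      rintro τ₂ T₂ ⟨hT₂, hf₂, hr₂⟩
      refine (hskip τ₂ T₂ (.empty n) hf₂.toTree ((hf₂.reg .g id).trans hg₁)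
        (hf₂.reg .infeas id) (hr₁.frame_same hf₂) hr₂ (if_pos (hcond.1 hc')).symm ?_).mono ?_
      · simp [Branch.empty]; omega
      · rintro τ₃ T₃ ⟨t', bad, h1, h2⟩
        refine ⟨t', bad, h1, h2.rep, h2.frame, h2.infeas, ?_⟩
        have := h2.time
        simp only [Expr.cost, at', r, firstEntry, nonempty, head, top, c]
        omega
    · refine WP.skip ((hskip τ₁ 1 (t !s) .refl hg₁ rfl hr₁ ho₁ (if_neg ?_).symm ?_).mono ?_)
      · exact fun h => hcond.2 h hc'
      · omega
      · rintro τ₃ T₃ ⟨t', bad, h1, h2⟩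
        refine ⟨t', bad, h1, h2.rep, h2.frame, h2.infeas, ?_⟩
        have := h2.time
        simp only [Expr.cost, at', r, firstEntry, nonempty, head, top, c]
        omega
  · -- the vertex has the converse fixing
    have hvb : v.v = !b := by
      simp [hg, hi, hb, hval] at hc
      revert hc
      cases v.v <;> cases b <;> simp
    refine WP.seq (WP.assign ?_)
    have hk₁ : (at' (.kind s) (r .i)).eval σ = v.k.code := by simp [hg, hi, hkind]
    rw [hk₁]
    have hf₁ : Frame IsTreeArr IsScratch g σ (σ.setReg .k v.k.code) := frame_setReg trivial _
    have hr₁ := hrs.of_arr (τ := σ.setReg .k v.k.code) rfl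
    have ho₁ := (h !s).of_arr (τ := σ.setReg .k v.k.code) rfl
    have hg₁ : (σ.setReg .k v.k.code).reg .g = g := by simp [hg]
    have hi₁ : (σ.setReg .k v.k.code).reg .i = i := by simp [hi]
    have hkr₁ : (σ.setReg .k v.k.code).reg .k = v.k.code := by simp
    have hin₁ : (σ.setReg .k v.k.code).reg .infeas = σ.reg .infeas := by simp
    generalize σ.setReg .k v.k.code = τ₁ at *
    refine WP.seq ((setLoose_spec hg₁ hr₁ false).mono ?_)
    rintro τ₂ T₂ ⟨rfl, hf₂, hr₂⟩
    have hg₂ := (hf₂.reg .g id).trans hg₁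
    have hi₂ := (hf₂.reg .i id).trans hi₁
    refine WP.seq ((removeUntil_spec hg₂ hi₂ hr₂ he hk).mono ?_)
    rintro τ₃ T₃ ⟨hT₃, hf₃, hr₃⟩
    have hg₃ := (hf₃.reg .g id).trans hg₂
    have hkr₃ := ((hf₃.reg .k id).trans (hf₂.reg .k id)).trans hkr₁
    have hin₃ := ((hf₃.reg .infeas id).trans (hf₂.reg .infeas id)).trans hin₁
    have ho₃ := (ho₁.frame_other hf₂).frame_other hf₃
    have hf := (hf₁.trans hf₂.toTree).trans hf₃.toTree
    have hcond : (Expr.eq (r .k) (c 2)).eval τ₃ ≠ 0 ↔ v.k = .nec := by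
      simp [hkr₃]
    refine WP.ite (fun hc' => ?_) fun hc' => ?_
    · have hnec := hcond.1 hc'
      -- The conflict is handled on the branch shortened to `l`, which is the tree that `FixMergeOK`
      -- speaks of.
      refine (conflict_spec hg₃ (tRep_update hr₃ ho₃) (hm l m v hs he hnec hvb).1).mono ?_
      rintro τ₄ T₄ ⟨t₁, bad, hrel, h1, h2, h3, h4⟩
      refine (trimHead_spec ((h2.reg .g id).trans hg₃) (h1 s)).mono ?_
      rintro τ₅ T₅ ⟨hT₅, hf₅, hr₅⟩
      refine ⟨mkTree s ⟨trim (t₁ s).slots, (t₁ s).loose⟩ (t₁ !s), bad,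
        .missNec l m v t₁ bad hs he hnec hvb hrel mkTree_self mkTree_not,
        tRep_mkTree.2 ⟨hr₅, (h1 !s).frame_other hf₅⟩, (hf.trans h2).trans hf₅.toTree, ?_, ?_⟩
      · rw [hf₅.reg .infeas id, h3, hin₃]
      · rw [size_update, size_eq t₁ s] at h4
        simp only [size_mkTree, hsz, hlen]
        simp only [Expr.cost, at', r, c]
        simp only at h4
        omega
    · refine WP.skip ((trimHead_spec hg₃ hr₃).mono ?_)
      rintro τ₅ T₅ ⟨hT₅, hf₅, hr₅⟩
      have hcd : v.k = .cond := by
        have : v.k ≠ .nec := fun h => hcond.2 h hc'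
        rcases h : v.k with _ | _ | _ <;> simp_all
      refine ⟨mkTree s ⟨trim l, false⟩ (t !s), false,
        .missCond l m v hs he hcd hvb mkTree_self mkTree_not,
        tRep_mkTree.2 ⟨hr₅, ho₃.frame_other hf₅⟩, hf.trans hf₅.toTree, ?_, ?_⟩
      · simp [hf₅.reg .infeas id, hin₃]
      · simp only [size_mkTree, hsz, hlen]
        simp only [Expr.cost, at', r, c]
        omega

end Tree

end Symresack

/-! ### The command that replaces a loose end. -/

namespace Symresack

variable {n : ℕ} {g : ℕ} {σ τ υ : Mem Reg Arr} {s : Bool} {a : Bool} {l m : List (Slot n)}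
  {v : Slot n} {B B' : Branch n} {t t' t₁ t₂ : ITree n} {I : Fixings n} {p q : Fin n}

/-- The array `fixed` stores the fixings. -/
def FixedRep (σ : Mem Reg Arr) (I : Fixings n) : Prop :=
  ∀ b (i : Fin n), σ.arr .fixed b.toNat i ≠ 0 ↔ i ∈ I b

/-- The number that encodes the result of a lookup. -/
def lookCode : Option Bool → ℕ
  | none => 2
  | some b => b.toNat

theorem lookCode_injective : Function.Injective lookCode := by
  rintro (_ | _ | _) (_ | _ | _) h <;> simp_all [lookCode]

theorem TreeWF.empty_of_not_known (hw : TreeWF I t) (he : Extendable I p q t)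
    (hl : (t s).loose = true) (hp : ¬ Known I (t s) p) (hq : ¬ Known I (t s) q) :
    t (!s) = .empty n := by
  have hs := (he s hl).resolve_right (not_or.2 ⟨hp, hq⟩)
  rcases hw.shape_at s with h | h | ⟨f, g, r₀, r₁, h, -⟩
  · simp [h, Branch.empty] at hl
  · exact h
  · simp [hs] at h

/-- If neither entry is known on branch `true`, branch `false` had no loose end before the event. So
the first update did nothing, and branch `false` was empty from the start. -/
theorem TreeWF.empty_of_not_known_second (hw : TreeWF I t) (hpq : p ≠ q) {bad : Bool}
    (he : Extendable I p q t) (hl : (t true).loose = true)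
    (h : ExtendStep I false p q (t false).loose t t₁ bad)
    (hp : ¬ Known I (t₁ true) p) (hq : ¬ Known I (t₁ true) q) : t₁ false = .empty n := by
  unfold ExtendStep at h
  split_ifs at h with hl₁
  · obtain ⟨α, β, hα, hβ, h⟩ := h
    by_cases hk : Known I (t false) p ∨ Known I (t false) q
    · have e := hw.extend hl₁ hk hα hβ h
      have hp' := mt (e.known_other _) hp
      have hq' := mt (e.known_other _) hq
      have := hw.empty_of_not_known he hl hp' hq'
      rw [Bool.not_true] at this
      simp [this, Branch.empty] at hl₁
    · obtain ⟨rfl, rfl⟩ := not_known_of_look hα hβ hk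
      have hs := (he false hl₁).resolve_right hk
      rw [not_or] at hk
      have := (hw.branch_step hpq hl₁ hs hk.1 hk.2 h).1
      rw [Bool.not_false] at this
      simp [this, Branch.empty] at hl
  · obtain ⟨rfl, rfl⟩ := h
    exact hw.empty_of_not_known (s := true) he hl hp hq

theorem Frame.fixedRep {A : Arr → Prop} {R : Reg → Prop} (h : Frame A R g σ τ) (hA : ¬ A .fixed)
    (hI : FixedRep σ I) : FixedRep τ I := by
  intro b i
  rw [h.arr .fixed b.toNat fun h => absurd h hA]
  exact hI b i

theorem not_isTreeArr_fixed : ¬ IsTreeArr .fixed := fun ⟨_, h⟩ => h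

namespace Tree

attribute [local simp] Expr.eval Expr.cost block at' put r c head top loose nonempty firstEntry
  lastEntry

/-- Fixed entries are answered first. An unfixed entry has a live vertex if it has one at all, so
the type alone tells whether it occurs on the branch. -/
theorem lookup_spec (hg : σ.reg .g = g) (hI : FixedRep σ I) (hr : Rep σ g s B)
    (hB : BranchWF I B) {x dest : Reg} {e : Fin n} (hx : σ.reg x = e) :
    WP (lookup s x dest) σ fun τ T =>
      T ≤ 40 ∧ ∃ o, Look I B e o ∧ τ = σ.setReg dest (lookCode o) := by
  have h0 := hI false e
  have h1 := hI true e
  refine WP.ite (fun hc => ?_) fun hc => ?_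
  · simp [hx] at hc
    exact WP.assign ⟨by simp, some false, .fixed _ (h0.1 (by simpa using hc)), by simp [lookCode]⟩
  · simp [hx] at hc
    refine WP.ite (fun hc' => ?_) fun hc' => ?_
    · simp [hx] at hc'
      exact WP.assign ⟨by simp, some true, .fixed _ (h1.1 (by simpa using hc')),
        by simp [lookCode]⟩
    · simp [hx] at hc'
      have hf : ¬ Fixed I e := by
        rintro ⟨_ | _, h⟩
        · exact h0.2 h (by simpa using hc)
        · exact h1.2 h (by simpa using hc')
      by_cases hk : ∃ v ∈ B.slots, v.e = e
      · obtain ⟨v, hv, rfl⟩ := hk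
        have hd : v.k ≠ .dead := mt (hB.dead v hv).1 hf
        refine WP.ite (fun _ => WP.assign ⟨by simp, _, .slot v hv rfl hd, ?_⟩) fun hc => ?_
        · simp [hg, hx, hr.val v hv, lookCode]
        · simp [hg, hx, hr.kind v hv, hd] at hc
      · refine WP.ite (fun hc => ?_) fun _ =>
          WP.assign ⟨by simp, none, .none (by simp [Known, hf, hk]), by simp [lookCode]⟩
        push Not at hk
        simp [hg, hx, hr.absent e hk] at hc

theorem eval_case {α β : Option Bool} (hα : σ.reg .α = lookCode α) (hβ : σ.reg .β = lookCode β)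
    (α' β' : Option Bool) :
    (case (lookCode α') (lookCode β')).eval σ ≠ 0 ↔ α = α' ∧ β = β' := by
  simp [case, hα, hβ, lookCode_injective.eq_iff]

theorem cost_case (a b : ℕ) : (case a b).cost = 7 := rfl

theorem extend_spec (hg : σ.reg .g = g) (hI : FixedRep σ I) (h : TRep σ g t) (hw : TreeWF I t)
    (hp : σ.reg .p = p) (hq : σ.reg .q = q) (hpq : p ≠ q)
    (hbr : ¬ Known I (t s) p → ¬ Known I (t s) q → t (!s) = .empty n) :
    WP (extend s) σ fun τ T => ∃ t' bad,
      (∃ α β, Look I (t s) p α ∧ Look I (t s) q β ∧ ExtendRel s p q t t' α β bad) ∧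
      TreePost σ g t 1000 τ T t' bad := by
  have hsz := size_eq t s
  refine WP.seq ((lookup_spec hg hI (h s) (hw.branch s) hp).mono ?_)
  rintro τ₁ T₁ ⟨hT₁, α, hα, rfl⟩
  refine WP.seq ((lookup_spec (σ := σ.setReg .α (lookCode α)) (I := I) (B := t s) (e := q)
    (by simpa using hg) hI ((h s).of_arr rfl) (hw.branch s) (by simpa using hq)).mono ?_)
  rintro τ₂ T₂ ⟨hT₂, β, hβ, hτ⟩
  have hf : Frame IsTreeArr IsScratch g σ τ₂ := by
    rw [hτ]
    exact (frame_setReg trivial _).trans (frame_setReg trivial _)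
  have hin : τ₂.reg .infeas = σ.reg .infeas := by simp [hτ]
  have hα' : τ₂.reg .α = lookCode α := by simp [hτ]
  have hβ' : τ₂.reg .β = lookCode β := by simp [hτ]
  have h₂ : TRep τ₂ g t := h.of_arr (by simp [hτ])
  clear hτ
  have hg₂ := (hf.reg .g id).trans hg
  have hp₂ := (hf.reg .p id).trans hp
  have hq₂ := (hf.reg .q id).trans hq
  have hcase := eval_case hα' hβ'
  -- `N` is the time budget that is left, including the potential of appended slots. Each of the
  -- seven tests takes 8 from it: 7 for the expression and 1 for the jump.
  let Post (N : ℕ) (τ : Mem Reg Arr) (T : ℕ) : Prop :=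
    ∃ t' bad, ExtendRel s p q t t' α β bad ∧ TreePost τ₂ g t N τ T t' bad
  have step : ∀ (N i j : ℕ) (c d : C), ((case i j).eval τ₂ ≠ 0 → WP c τ₂ (Post N)) →
      ((case i j).eval τ₂ = 0 → WP d τ₂ (Post N)) →
      WP (.ite (case i j) c d) τ₂ (Post (N + 8)) := by
    intro N i j c d h1 h0
    have shift : ∀ c : C, WP c τ₂ (Post N) →
        WP c τ₂ fun τ T => Post (N + 8) τ ((case i j).cost + 1 + T) := by
      refine fun c h => h.mono ?_
      rintro τ T ⟨t', bad, h1, h2⟩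
      refine ⟨t', bad, h1, h2.rep, h2.frame, h2.infeas, ?_⟩
      have := h2.time
      rw [cost_case]
      omega
    exact WP.ite (fun h => shift c (h1 h)) fun h => shift d (h0 h)
  have one : ∀ (N : ℕ) (e : Fin n) (x : Reg) (k : Kind) (b : Bool), 400 ≤ N → τ₂.reg x = e →
      ¬ Known I (t s) e → (∀ t' : ITree n, t' s = (t s).append [⟨e, k, b⟩] → t' (!s) = t (!s) →
        ExtendRel s p q t t' α β false) →
      WP (append s k.code x b.toNat) τ₂ (Post N) := by
    intro N e x k b hN hx hk hrel
    refine (append_spec hg₂ (h₂ s) hx (fun w hw he => hk (Or.inr ⟨w, hw, he⟩)) k b).mono ?_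
    rintro τ T ⟨hT, hf₃, hr₃⟩
    refine ⟨mkTree s _ (t !s), false, hrel _ mkTree_self mkTree_not,
      tRep_mkTree.2 ⟨hr₃, (h₂ !s).frame_other hf₃⟩, hf₃.toTree, hf₃.reg _ id, ?_⟩
    simp only [size_mkTree, hsz, Branch.append, List.length_append, List.length_singleton]
    omega
  suffices H : WP (.ite (case 0 1) (conflict s)
    (.ite (case 1 0) (put (.loose s) (c 0) (c 0))
    (.ite (case 0 2) (append s 2 .q 0)
    (.ite (case 1 2) (append s 1 .q 1)
    (.ite (case 2 0) (append s 1 .p 0)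
    (.ite (case 2 1) (append s 2 .p 1)
    (.ite (case 2 2)
      (block [
        append s 1 .p 0, append s 2 .q 0,
        append (!s) 1 .q 1, append (!s) 2 .p 1, put (.loose (!s)) (c 0) (c 1)])
      .skip))))))) τ₂ (Post 800) by
    refine H.mono ?_
    rintro τ T ⟨t', bad, h1, h2⟩
    refine ⟨t', bad, ⟨α, β, hα, hβ, h1⟩, h2.rep, hf.trans h2.frame, by rw [h2.infeas, hin], ?_⟩
    have := h2.time
    omega
  refine step _ _ _ _ _ (fun hc => ?_) fun hc₁ => ?_
  · obtain ⟨rfl, rfl⟩ := (hcase (some false) (some true)).1 hc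
    refine (conflict_spec hg₂ h₂ (hw.merge s).1).mono ?_
    rintro τ T ⟨t', bad, h1, h2⟩
    exact ⟨t', bad, h1, h2.rep, h2.frame, h2.infeas, by have := h2.time; omega⟩
  refine step _ _ _ _ _ (fun hc => ?_) fun hc₂ => ?_
  · obtain ⟨rfl, rfl⟩ := (hcase (some true) (some false)).1 hc
    refine (setLoose_spec hg₂ (h₂ s) false).mono ?_
    rintro τ T ⟨rfl, hf₃, hr₃⟩
    refine ⟨mkTree s _ (t !s), false, ⟨rfl, mkTree_self, mkTree_not⟩,
      tRep_mkTree.2 ⟨hr₃, (h₂ !s).frame_other hf₃⟩, hf₃.toTree, hf₃.reg _ id, ?_⟩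
    simp only [size_mkTree, hsz]
    omega
  refine step _ _ _ _ _ (fun hc => ?_) fun hc₃ => ?_
  · obtain ⟨rfl, rfl⟩ := (hcase (some false) none).1 hc
    exact one _ q .q .nec false (by omega) hq₂ hβ.not_known fun t' h1 h2 => ⟨rfl, h1, h2⟩
  refine step _ _ _ _ _ (fun hc => ?_) fun hc₄ => ?_
  · obtain ⟨rfl, rfl⟩ := (hcase (some true) none).1 hc
    exact one _ q .q .cond true (by omega) hq₂ hβ.not_known fun t' h1 h2 => ⟨rfl, h1, h2⟩
  refine step _ _ _ _ _ (fun hc => ?_) fun hc₅ => ?_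
  · obtain ⟨rfl, rfl⟩ := (hcase none (some false)).1 hc
    exact one _ p .p .cond false (by omega) hp₂ hα.not_known fun t' h1 h2 => ⟨rfl, h1, h2⟩
  refine step _ _ _ _ _ (fun hc => ?_) fun hc₆ => ?_
  · obtain ⟨rfl, rfl⟩ := (hcase none (some true)).1 hc
    exact one _ p .p .nec true (by omega) hp₂ hα.not_known fun t' h1 h2 => ⟨rfl, h1, h2⟩
  refine step _ _ _ _ _ (fun hc => ?_) fun hc₇ => ?_
  · obtain ⟨rfl, rfl⟩ := (hcase none none).1 hc
    have ho := hbr hα.not_known hβ.not_known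
    have hps : ∀ w ∈ (t s).slots, w.e ≠ p := fun w hw he => hα.not_known (Or.inr ⟨w, hw, he⟩)
    have hqs : ∀ w ∈ (t s).slots, w.e ≠ q := fun w hw he => hβ.not_known (Or.inr ⟨w, hw, he⟩)
    have ho₂ : Rep τ₂ g (!s) (.empty n) := by rw [← ho]; exact h₂ !s
    refine WP.seq ((append_spec hg₂ (h₂ s) hp₂ hps .cond false).mono ?_)
    rintro τ₃ T₃ ⟨hT₃, hf₃, hr₃⟩
    refine WP.seq ((append_spec ((hf₃.reg .g id).trans hg₂) hr₃ ((hf₃.reg .q id).trans hq₂) ?_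
      .nec false).mono ?_)
    · intro w hw
      simp only [Branch.append, List.mem_append, List.mem_singleton] at hw
      rcases hw with hw | rfl
      · exact hqs w hw
      · exact hpq
    rintro τ₄ T₄ ⟨hT₄, hf₄, hr₄⟩
    have hf₄' := hf₃.trans hf₄
    have ho₄ := ho₂.frame_other hf₄'
    refine WP.seq ((append_spec ((hf₄'.reg .g id).trans hg₂) ho₄ ((hf₄'.reg .q id).trans hq₂)
      (by simp [Branch.empty]) .cond true).mono ?_)
    rintro τ₅ T₅ ⟨hT₅, hf₅, hr₅⟩
    have hreg : ∀ x, τ₅.reg x = τ₂.reg x := fun x => (hf₅.reg x id).trans (hf₄'.reg x id)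
    refine WP.seq ((append_spec ((hreg .g).trans hg₂) hr₅ ((hreg .p).trans hp₂)
      (by simpa [Branch.empty, Branch.append] using hpq.symm) .nec true).mono ?_)
    rintro τ₆ T₆ ⟨hT₆, hf₆, hr₆⟩
    refine (setLoose_spec ((hf₆.reg .g id).trans ((hreg .g).trans hg₂)) hr₆ true).mono ?_
    rintro τ₇ T₇ ⟨rfl, hf₇, hr₇⟩
    have hf₇' := (hf₅.trans hf₆).trans hf₇
    refine ⟨mkTree s _ _, false, ⟨rfl, ?_, ?_⟩, tRep_mkTree.2 ⟨hr₄.frame_same hf₇', hr₇⟩,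
      hf₄'.toTree.trans hf₇'.toTree, (hf₇'.reg _ id).trans (hf₄'.reg _ id), ?_⟩
    · simp [Branch.append]
    · simp [Branch.append, ho, Branch.empty]
    · simp [size_mkTree, hsz, Branch.append, Branch.empty]
      omega
  -- All tests failed, so both values are known and equal, and the loose end just moves on.
  · have hrel : ExtendRel s p q t t α β false := by
      rcases α with _ | _ | _ <;> rcases β with _ | _ | _
      · exact absurd hc₇ ((hcase none none).2 ⟨rfl, rfl⟩)
      · exact absurd hc₅ ((hcase none (some false)).2 ⟨rfl, rfl⟩)
      · exact absurd hc₆ ((hcase none (some true)).2 ⟨rfl, rfl⟩)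
      · exact absurd hc₃ ((hcase (some false) none).2 ⟨rfl, rfl⟩)
      · exact ⟨rfl, rfl, rfl⟩
      · exact absurd hc₁ ((hcase (some false) (some true)).2 ⟨rfl, rfl⟩)
      · exact absurd hc₄ ((hcase (some true) none).2 ⟨rfl, rfl⟩)
      · exact absurd hc₂ ((hcase (some true) (some false)).2 ⟨rfl, rfl⟩)
      · exact ⟨rfl, rfl, rfl⟩
    exact WP.skip ⟨t, false, hrel, h₂, .refl, by simp, by omega⟩

end Tree

end Symresack

/-! ### The stack of pending fixings. -/

namespace Symresack

variable {n : ℕ} {g : ℕ} {σ τ υ : Mem Reg Arr} {s : Bool} {B : Branch n} {t t' : ITree n}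
  {I J : Fixings n} {p q : Fin n} {Q Q' : Fin n × Bool → Prop} {S S' : List (Fin n × Bool)}
  {γ : Equiv.Perm (Fin n)} {k : ℕ}

/-- The arrays of the stack. -/
def IsStackArr : Arr → Prop
  | .stackE => True
  | .stackV => True
  | .inStack => True
  | _ => False

/-- Apart from the stack, only row `g` of the arrays in `A` and the registers in `R` have
changed. -/
structure StackFrame (A : Arr → Prop) (R : Reg → Prop) (g : ℕ) (σ τ : Mem Reg Arr) : Prop where
  arr : ∀ a j, ¬ IsStackArr a → (A a → j ≠ g) → τ.arr a j = σ.arr a j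
  reg : ∀ r, ¬ R r → τ.reg r = σ.reg r
  inStack : ∀ b i, σ.arr .inStack b i ≠ 0 → τ.arr .inStack b i ≠ 0

section

variable {A A' : Arr → Prop} {R R' : Reg → Prop}

theorem StackFrame.refl : StackFrame A R g σ σ :=
  ⟨fun _ _ _ _ => rfl, fun _ _ => rfl, fun _ _ => id⟩

theorem StackFrame.trans (h₁ : StackFrame A R g σ τ) (h₂ : StackFrame A R g τ υ) :
    StackFrame A R g σ υ :=
  ⟨fun a j h h' => (h₂.arr a j h h').trans (h₁.arr a j h h'),
    fun r h => (h₂.reg r h).trans (h₁.reg r h),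
    fun b i h => h₂.inStack b i (h₁.inStack b i h)⟩

theorem StackFrame.mono (h : StackFrame A R g σ τ) (hA : ∀ a, A a → A' a) (hR : ∀ r, R r → R' r) :
    StackFrame A' R' g σ τ :=
  ⟨fun a j h1 h' => h.arr a j h1 fun ha => h' (hA a ha),
    fun r h' => h.reg r fun hr => h' (hR r hr), h.inStack⟩

theorem Frame.toStackFrame (h : Frame A R g σ τ) (hA : ¬ A .inStack) (hR : ∀ r, R r → R' r) :
    StackFrame A R' g σ τ :=
  ⟨fun a j _ h' => h.arr a j h', fun r h' => h.reg r fun hr => h' (hR r hr), fun b i hi => by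
    rwa [h.arr .inStack b fun h => absurd h hA]⟩

theorem StackFrame.rep (h : StackFrame (fun _ => False) R g σ τ) (hr : Rep σ g s B) :
    Rep τ g s B :=
  hr.of_eq fun a ha => h.arr a g (by cases a <;> simp_all [IsStackArr, IsBranchArr]) False.elim

theorem StackFrame.rep_row {g' : ℕ} (h : StackFrame A R g' σ τ) (hr : Rep σ g s B) (hg : g ≠ g') :
    Rep τ g s B :=
  hr.of_eq fun a ha => h.arr a g (by cases a <;> simp_all [IsStackArr, IsBranchArr]) fun _ => hg

theorem StackFrame.fixedRep (h : StackFrame A R g σ τ) (hA : ¬ A .fixed) (hI : FixedRep σ I) :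
    FixedRep τ I := by
  intro b i
  rw [h.arr .fixed b.toNat id fun h => absurd h hA]
  exact hI b i

end

/-- The registers that are used by the commands for the trees and the stack. -/
def IsLocal : Reg → Prop
  | .u => True
  | .k => True
  | .α => True
  | .β => True
  | .infeas => True
  | .stk => True
  | .p => True
  | .q => True
  | .old _ => True
  | _ => False

theorem IsScratch.isLocal {r : Reg} (h : IsScratch r) : IsLocal r := by
  cases r <;> simp_all [IsScratch, IsLocal]

/-- The stack contains the fixings in `S`, which must be applied by `Q`. -/
structure StackInv (σ : Mem Reg Arr) (I : Fixings n) (Q : Fin n × Bool → Prop)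
    (S : List (Fin n × Bool)) : Prop where
  height : σ.reg .stk = S.length
  entry : ∀ (j : ℕ) (f : Fin n × Bool), S[j]? = some f →
    σ.arr .stackE 0 j = f.1 ∧ σ.arr .stackV 0 j = f.2.toNat
  nodup : S.Nodup
  inStack : ∀ f ∈ S, σ.arr .inStack f.2.toNat f.1 ≠ 0
  live : ∀ f ∈ S, f.1 ∉ I f.2
  implied : ∀ f ∈ S, Q f
  flagged : ∀ f : Fin n × Bool, σ.arr .inStack f.2.toNat f.1 ≠ 0 → f ∈ S ∨ f.1 ∈ I f.2

theorem StackInv.mono (h : StackInv σ I Q S) (hQ : ∀ f, Q f → Q' f) : StackInv σ I Q' S :=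
  { h with implied := fun f hf => hQ f (h.implied f hf) }

theorem StackInv.of_eq (h : StackInv σ I Q S) (ha : ∀ a, IsStackArr a → τ.arr a = σ.arr a)
    (hr : τ.reg .stk = σ.reg .stk) : StackInv τ I Q S := by
  have h1 := ha .stackE trivial
  have h2 := ha .stackV trivial
  have h3 := ha .inStack trivial
  exact ⟨hr.trans h.height, by rw [h1, h2]; exact h.entry, h.nodup, by rw [h3]; exact h.inStack,
    h.live, h.implied, by rw [h3]; exact h.flagged⟩

theorem StackInv.frame {A : Arr → Prop} {R : Reg → Prop} (h : StackInv σ I Q S)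
    (hf : Frame A R g σ τ) (hA : ∀ a, IsStackArr a → ¬ A a) (hR : ¬ R .stk) :
    StackInv τ I Q S :=
  h.of_eq (fun a ha => funext fun j => hf.arr a j fun h => absurd h (hA a ha)) (hf.reg _ hR)

theorem IsStackArr.not_isTreeArr {a : Arr} (h : IsStackArr a) : ¬ IsTreeArr a := by
  rintro ⟨s, hs⟩
  cases a <;> simp_all [IsStackArr, IsBranchArr]

/-- If the top element of the stack is applied, the rest stays on the stack. -/
theorem StackInv.pop {f : Fin n × Bool} (h : StackInv σ I Q (S ++ [f]))
    (ha : ∀ a, IsStackArr a → τ.arr a = σ.arr a) (hr : τ.reg .stk = σ.reg .stk - 1) :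
    StackInv τ (applyFixing I f) Q S := by
  have h1 := ha .stackE trivial
  have h2 := ha .stackV trivial
  have h3 := ha .inStack trivial
  have hnd := List.nodup_append.1 h.nodup
  refine ⟨by rw [hr, h.height]; simp, ?_, hnd.1, ?_, ?_, ?_, ?_⟩
  · rw [h1, h2]
    intro j e hj
    refine h.entry j e ?_
    rwa [List.getElem?_append_left (List.getElem?_eq_some_iff.1 hj).1]
  · rw [h3]
    exact fun e he => h.inStack e (by simp [he])
  · intro e he
    rw [mem_applyFixing]
    rintro (h4 | h4)
    · exact hnd.2.2 e he f (by simp) (by rw [← h4])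
    · exact h.live e (by simp [he]) h4
  · exact fun e he => h.implied e (by simp [he])
  · rw [h3]
    intro e he
    rw [mem_applyFixing]
    rcases h.flagged e he with h4 | h4
    · rcases List.mem_append.1 h4 with h4 | h4
      · exact Or.inl h4
      · exact Or.inr (Or.inl (by rw [List.mem_singleton.1 h4]))
    · exact Or.inr (Or.inr h4)

/-- The fixings of necessary fixing vertices at the root have been put on the stack. -/
def BranchFlagged (σ : Mem Reg Arr) (B : Branch n) : Prop :=
  ∀ v ∈ B.slots.head?, v.k = .nec → σ.arr .inStack v.v.toNat v.e ≠ 0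

theorem BranchFlagged.mono {A : Arr → Prop} {R : Reg → Prop} (h : BranchFlagged σ B)
    (hf : StackFrame A R g σ τ) : BranchFlagged τ B :=
  fun v hv hk => hf.inStack _ _ (h v hv hk)

namespace Tree

attribute [local simp] Expr.eval Expr.cost block at' put r c head top loose nonempty firstEntry
  lastEntry

/-- A fixing that is already flagged is not pushed, so it cannot enter the stack twice. A necessary
vertex is not removed, hence its entry is unfixed and a newly pushed fixing is live. -/
theorem pushRoot_spec (hg : σ.reg .g = g) (hr : Rep σ g s B) (hB : BranchWF I B)
    (hS : StackInv σ I Q S) (hQ : ∀ v ∈ B.slots.head?, v.k = .nec → Q (v.e, v.v)) :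
    WP (pushRoot s) σ fun τ T => T ≤ 100 ∧ StackFrame (fun _ => False) IsLocal g σ τ ∧
      τ.reg .infeas = σ.reg .infeas ∧ BranchFlagged τ B ∧ ∃ S', StackInv τ I Q S' := by
  obtain ⟨l, a⟩ := B
  rcases l with _ | ⟨v, l⟩
  · have h1 := eval_nonempty hg hr
    refine WP.ite (fun hc => absurd hc ?_) fun _ => WP.skip ⟨by simp, .refl, rfl, ?_, S, hS⟩
    · rw [Expr.eval]
      generalize Expr.eval σ (nonempty s) = N at h1 ⊢
      simp at h1
      simp [h1]
    · simp [BranchFlagged]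
  have h1 := (eval_nonempty hg hr).2 (by simp)
  have h2 := eval_firstEntry hg hr
  have hkind := hr.kind v (by simp)
  have hval := hr.val v (by simp)
  have hcond : (Expr.and (nonempty s) (.eq (at' (.kind s) (firstEntry s)) (c 2))).eval σ ≠ 0 ↔
      v.k = .nec := by
    simp only [Expr.eval, at', r, c]
    generalize Expr.eval σ (nonempty s) = N at h1 ⊢
    generalize Expr.eval σ (firstEntry s) = M at h2 ⊢
    simp [h1, h2, hg, hkind]
  refine WP.ite (fun hc => ?_) fun hc => WP.skip ⟨by simp, .refl, rfl, ?_, S, hS⟩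
  swap
  · intro w hw hk
    obtain rfl : v = w := by simpa using hw
    exact absurd hc (hcond.2 hk)
  have hk := hcond.1 hc
  refine WP.seq (WP.assign (WP.seq (WP.assign ?_)))
  rw [h2]
  have hval' : (at' (.val s) (r .u)).eval (σ.setReg .u v.e) = v.v.toNat := by
    simp [hg, hval]
  rw [hval']
  set τ := (σ.setReg .u v.e).setReg .k v.v.toNat with hτ
  have hf : StackFrame (fun _ => False) IsLocal g σ τ := by
    refine ⟨fun _ _ _ _ => rfl, fun x hx => ?_, fun _ _ => id⟩
    cases x <;> simp_all [IsLocal]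
  have hS' : StackInv τ I Q S := hS.of_eq (fun _ _ => rfl) (by simp [hτ])
  have hu : τ.reg .u = v.e := by simp [hτ]
  have hk' : τ.reg .k = v.v.toNat := by simp [hτ]
  have hin : τ.reg .infeas = σ.reg .infeas := by simp [hτ]
  clear_value τ
  refine WP.ite (fun hc' => WP.skip ⟨by simp, hf, hin, ?_, S, hS'⟩) fun hc' => ?_
  · intro w hw _
    obtain rfl : v = w := by simpa using hw
    simpa [hu, hk'] using hc'
  simp [hu, hk'] at hc'
  refine WP.seq (WP.store (WP.seq (WP.store (WP.seq (WP.store (WP.assign ⟨by simp, ?_, ?_, ?_,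
    S ++ [(v.e, v.v)], ?_⟩))))))
  · refine hf.trans ⟨fun a j ha _ => funext fun x => ?_, fun x hx => ?_, fun b i h => ?_⟩
    · cases a <;> simp_all [IsStackArr]
    · cases x <;> simp_all [IsLocal]
    · rw [Mem.setReg_arr, Mem.setArr_arr, if_neg (by simp), Mem.setArr_arr, if_neg (by simp),
        Mem.setArr_arr]
      split_ifs
      · simp
      · exact h
  · simp [hin]
  · intro w hw _
    obtain rfl : v = w := by simpa using hw
    simp [hu, hk']
  · have hnot : (v.e, v.v) ∉ S := fun h => hS'.inStack _ h hc'
    have hunf : ¬ Fixed I v.e := fun h => by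
      have := (hB.dead v (by simp)).2 h
      rw [hk] at this
      cases this
    obtain ⟨a1, a2, a3, a4, a5, a6, a7⟩ := hS'
    refine ⟨by simp [a1], ?_, ?_, ?_, ?_, ?_, ?_⟩
    · intro j f hj
      rcases Nat.lt_trichotomy j S.length with hjl | rfl | hjl
      · rw [List.getElem?_append_left hjl] at hj
        have := a2 j f hj
        simp [a1, hjl.ne, this]
      · simp at hj
        simp [a1, hu, hk', ← hj]
      · rw [List.getElem?_eq_none (by simp; omega)] at hj
        simp at hj
    · rw [List.nodup_append]
      refine ⟨a3, by simp, ?_⟩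
      simp only [List.mem_singleton]
      rintro f hf e rfl rfl
      exact hnot hf
    · intro f hf
      rcases List.mem_append.1 hf with hf | hf
      · have := a4 f hf
        simp
        split_ifs
        · simp
        · exact this
      · simp [List.mem_singleton.1 hf, hu, hk']
    · intro f hf
      rcases List.mem_append.1 hf with hf | hf
      · exact a5 f hf
      · rw [List.mem_singleton.1 hf]
        exact fun h => hunf ⟨_, h⟩
    · intro f hf
      rcases List.mem_append.1 hf with hf | hf
      · exact a6 f hf
      · rw [List.mem_singleton.1 hf]
        refine hQ v (by simp) hk
    · intro f hf
      simp [hu, hk'] at hf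
      by_cases he : f = (v.e, v.v)
      · simp [he]
      · have : ¬ (f.2.toNat = v.v.toNat ∧ (f.1 : ℕ) = v.e) := by
          rintro ⟨h3, h4⟩
          refine he (Prod.ext (Fin.ext h4) ?_)
          revert h3
          rcases f with ⟨e, _ | _⟩ <;> cases v.v <;> simp
        rw [if_neg this] at hf
        rcases a7 f hf with h | h
        · exact Or.inl (by simp [h])
        · exact Or.inr h

end Tree

end Symresack

/-! ### Updates of a whole tree together with the stack. -/

namespace Symresack

variable {n : ℕ} {g : ℕ} {σ τ υ : Mem Reg Arr} {s : Bool} {B : Branch n} {t t' : ITree n}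
  {I J : Fixings n} {p q : Fin n} {Q Q' : Fin n × Bool → Prop} {S S' : List (Fin n × Bool)}
  {γ : Equiv.Perm (Fin n)} {k : ℕ}

/-- Either the tree is consistent, or infeasibility has been found. -/
def TreeOutcome (γ : Equiv.Perm (Fin n)) (I : Fixings n) (k : ℕ) (τ : Mem Reg Arr)
    (t : ITree n) : Prop :=
  (τ.reg .infeas = 0 ∧ TreeInv γ I k t ∧ ∀ s, BranchFlagged τ (t s)) ∨
    (τ.reg .infeas = 1 ∧ InfConj γ I k ∅)

namespace Tree

attribute [local simp] Expr.eval Expr.cost block at' put r c head top loose nonempty firstEntry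
  lastEntry

theorem pushRoots_spec (hg : σ.reg .g = g) (hr : TRep σ g t) (hw : TreeWF I t)
    (hS : StackInv σ I Q S) (hQ : ∀ s, ∀ v ∈ (t s).slots.head?, v.k = .nec → Q (v.e, v.v)) :
    WP (block [pushRoot false, pushRoot true]) σ fun τ T => T ≤ 200 ∧
      StackFrame (fun _ => False) IsLocal g σ τ ∧ TRep τ g t ∧
      τ.reg .infeas = σ.reg .infeas ∧ (∀ s, BranchFlagged τ (t s)) ∧ ∃ S', StackInv τ I Q S' := by
  refine WP.seq ((pushRoot_spec hg (hr false) (hw.branch _) hS (hQ false)).mono ?_)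
  rintro τ₁ T₁ ⟨hT₁, hf₁, hin₁, hb₁, S₁, hS₁⟩
  refine (pushRoot_spec ((hf₁.reg .g id).trans hg) (hf₁.rep (hr true)) (hw.branch _) hS₁
    (hQ true)).mono ?_
  rintro τ₂ T₂ ⟨hT₂, hf₂, hin₂, hb₂, S₂, hS₂⟩
  refine ⟨by omega, hf₁.trans hf₂, fun s => hf₂.rep (hf₁.rep (hr s)), hin₂.trans hin₁,
    fun s => ?_, S₂, hS₂⟩
  cases s
  · exact hb₁.mono hf₂
  · exact hb₂

/-- After infeasibility both branches are empty, so nothing unjustified is pushed; otherwise a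
necessary vertex at the root is a singleton inf-conjunction. -/
theorem pushRoots_outcome (hg : σ.reg .g = g) (hr : TRep σ g t) (hw : TreeWF I t)
    (hS : StackInv σ I Q S) (hQ : ∀ f, InfConj γ I k {conv f} → Q f) {bad : Bool}
    (hin : σ.reg .infeas = if bad then 1 else 0) (h0 : bad = false → TreeInv γ I k t)
    (h1 : bad = true → InfConj γ I k ∅ ∧ ∀ s, t s = .empty n) :
    WP (block [pushRoot false, pushRoot true]) σ fun τ T => T ≤ 200 ∧
      StackFrame (fun _ => False) IsLocal g σ τ ∧ TRep τ g t ∧ TreeOutcome γ I k τ t ∧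
      ∃ S', StackInv τ I Q S' := by
  refine (pushRoots_spec hg hr hw hS ?_).mono ?_
  · intro s v hv hk
    cases bad
    · exact hQ _ ((h0 rfl).infConj_of_root hv hk)
    · simp [(h1 rfl).2 s, Branch.empty] at hv
  rintro τ T ⟨hT, hf, hr', hin', hb, hS'⟩
  refine ⟨hT, hf, hr', ?_, hS'⟩
  rw [hin] at hin'
  cases bad
  · exact Or.inl ⟨hin', h0 rfl, hb⟩
  · exact Or.inr ⟨hin', (h1 rfl).1⟩

theorem fixTree_spec (hg : σ.reg .g = g) (h : TRep σ g t) {i : Fin n} {b : Bool}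
    (hi : σ.reg .i = i) (hb : σ.reg .b = b.toNat) (ht : TreeInv γ I k t) (hI : ¬ Fixed I i)
    (hS : StackInv σ (applyFixing I (i, b)) Q S)
    (hQ : ∀ f, InfConj γ (applyFixing I (i, b)) k {conv f} → Q f)
    (hin : σ.reg .infeas = 0) :
    WP fixTree σ fun τ T => ∃ t', T + 40 * t'.size ≤ 40 * t.size + 2000 ∧
      StackFrame IsTreeArr IsLocal g σ τ ∧ TRep τ g t' ∧
      TreeOutcome γ (applyFixing I (i, b)) k τ t' ∧
      ∃ S', StackInv τ (applyFixing I (i, b)) Q S' := by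
  refine WP.seq ((fixBranch_spec hg h hi hb ht.wf.fixMergeOK).mono ?_)
  rintro τ₁ T₁ ⟨t₁, bad₁, hrel₁, h₁⟩
  refine WP.seq ((fixBranch_spec ((h₁.frame.reg .g id).trans hg) h₁.rep
    ((h₁.frame.reg .i id).trans hi) ((h₁.frame.reg .b id).trans hb)
    (ht.wf.fix_first hI hrel₁).1.fixMergeOK).mono ?_)
  rintro τ₂ T₂ ⟨t₂, bad₂, hrel₂, h₂⟩
  obtain ⟨hw, h0, h1⟩ := ht.fix hI hrel₁ hrel₂
  have hf := h₁.frame.trans h₂.frame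
  refine (pushRoots_outcome ((hf.reg .g id).trans hg) h₂.rep hw
    (hS.frame hf (fun a ha => ha.not_isTreeArr) id) hQ (bad := bad₁ || bad₂) ?_ h0 h1).mono ?_
  · rw [h₂.infeas, h₁.infeas, hin]
    cases bad₁ <;> cases bad₂ <;> rfl
  rintro τ₃ T₃ ⟨hT₃, hf₃, hr₃, ho, hS'⟩
  refine ⟨t₂, ?_, (hf.toStackFrame (fun h => IsStackArr.not_isTreeArr (a := .inStack) trivial h)
    fun r hr => hr.isLocal).trans (hf₃.mono (fun _ => False.elim) fun _ => id), hr₃, ho, hS'⟩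
  have e1 := h₁.time
  have e2 := h₂.time
  omega

theorem extendOld_spec (hg : σ.reg .g = g) (hI : FixedRep σ I) (h : TRep σ g t) (hw : TreeWF I t)
    (hp : σ.reg .p = p) (hq : σ.reg .q = q) (hpq : p ≠ q) {old : Bool}
    (ho : σ.reg (.old s) = old.toNat)
    (hbr : old = true → ¬ Known I (t s) p → ¬ Known I (t s) q → t (!s) = .empty n) :
    WP (.ite (r (.old s)) (extend s) .skip) σ fun τ T => ∃ t' bad,
      ExtendStep I s p q old t t' bad ∧ TreePost σ g t 1010 τ T t' bad := by
  unfold ExtendStep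
  cases old
  · refine WP.ite (fun hc => absurd ho (by simpa using hc)) fun _ =>
      WP.skip ⟨t, false, ⟨rfl, rfl⟩, h, .refl, by simp, by simp; omega⟩
  · refine WP.ite (fun _ => (extend_spec hg hI h hw hp hq hpq (hbr rfl)).mono ?_) fun hc =>
      absurd hc (by simp [ho])
    rintro τ T ⟨t', bad, h1, h2⟩
    exact ⟨t', bad, by simpa using h1, h2.rep, h2.frame, h2.infeas, by
      have := h2.time
      simp
      omega⟩

/-- The arrays that are changed by the index event. -/
def IsIndexArr (a : Arr) : Prop := IsTreeArr a ∨ a = .idx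

theorem indexEvent_spec (hg : σ.reg .g = g) (hI : FixedRep σ I) (h : TRep σ g t)
    (ht : TreeInv γ I k t) (hk : σ.arr .idx g 0 = k) (hpk : p.val + 1 = k)
    (hinv : σ.arr .inv g p = γ.symm p) (hc : ¬ TreeComplete γ I k t)
    (hb : ∀ s, BranchFlagged σ (t s)) (hS : StackInv σ I Q S)
    (hQ : ∀ f, InfConj γ I (k + 1) {conv f} → Q f) (hin : σ.reg .infeas = 0) :
    WP indexEvent σ fun τ T => ∃ t', T + 40 * t'.size ≤ 40 * t.size + 3000 ∧
      StackFrame IsIndexArr IsLocal g σ τ ∧ τ.arr .idx g 0 = k + 1 ∧ TRep τ g t' ∧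
      TreeOutcome γ I (k + 1) τ t' ∧ ∃ S', StackInv τ I Q S' := by
  refine WP.seq (WP.assign (WP.seq (WP.assign (WP.seq (WP.store ?_)))))
  have e1 : (Expr.pred (at' .idx (c 0))).eval σ = p := by
    simp [hg, hk, ← hpk]
  rw [e1]
  have e2 : (at' .inv (r .p)).eval (σ.setReg .p p) = γ.symm p := by
    simp [hg, hinv]
  rw [e2]
  have hf : StackFrame IsIndexArr IsLocal g σ
      (((σ.setReg .p p).setReg .q (γ.symm p)).setArr .idx g 0 (k + 1)) := by
    refine ⟨fun a j _ hj => funext fun x => ?_, fun x hx => ?_, fun _ _ hi => by simpa using hi⟩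
    · have : ¬ (a = .idx ∧ j = g) := fun ⟨h1, h2⟩ => hj (Or.inr h1) h2
      rw [Mem.setArr_arr, if_neg (by tauto)]
      rfl
    · cases x <;> simp_all [IsLocal]
  simp only [at', r, c, Expr.eval, Mem.setReg_reg, Mem.setReg_arr, reduceCtorEq, if_false, hg, hk]
  set τ := ((σ.setReg .p p).setReg .q (γ.symm p)).setArr .idx g 0 (k + 1) with hτ
  have hidx : τ.arr .idx g 0 = k + 1 := by simp [hτ]
  have hp : τ.reg .p = p := by simp [hτ]
  have hq : τ.reg .q = γ.symm p := by simp [hτ]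
  have hin' : τ.reg .infeas = 0 := by simp [hτ, hin]
  have hS' : StackInv τ I Q S := hS.of_eq (fun a ha => by
    funext j x
    rw [hτ, Mem.setArr_arr, if_neg]
    · rfl
    · rintro ⟨rfl, -⟩
      exact ha) (by simp [hτ])
  have hr : TRep τ g t := fun s => (h s).of_eq fun a ha => by
    funext x
    rw [hτ, Mem.setArr_arr, if_neg]
    · rfl
    · rintro ⟨rfl, -⟩
      exact ha
  have hg' := (hf.reg .g id).trans hg
  have hI' := hf.fixedRep (by simp [IsIndexArr, not_isTreeArr_fixed]) hI
  clear_value τ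
  refine WP.ite (fun hpq => WP.skip ?_) fun hpq => ?_
  · have hpq : γ.symm p = p := by
      simp [hp, hq, Fin.val_inj] at hpq
      exact hpq.symm
    exact ⟨t, by simp; omega, hf, hidx, hr,
      Or.inl ⟨hin', ht.skip hpk hpq, fun s => (hb s).mono hf⟩, S, hS'⟩
  have hpq : p ≠ γ.symm p := by
    simpa [hp, hq, Fin.val_inj] using hpq
  have hex := ht.extendable hc hpk hpq
  have hl : ∀ s, ∀ τ : Mem Reg Arr, τ.reg .g = g → TRep τ g t →
      (loose s).eval τ = (t s).loose.toNat := by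
    intro s τ hg hr
    simp [hg, (hr s).loose]
  -- Both looseness flags are saved before any branch is extended: branching sets the flag of the
  -- opposite branch, which must not be extended again at the same index.
  refine WP.seq (WP.assign (WP.seq (WP.assign ?_)))
  rw [hl false τ hg' hr, hl true (τ.setReg (.old false) _) (by simp [hg']) (hr.of_arr rfl)]
  have hf' : StackFrame IsIndexArr IsLocal g τ
      ((τ.setReg (.old false) (t false).loose.toNat).setReg (.old true) (t true).loose.toNat) := by
    refine ⟨fun _ _ _ _ => rfl, fun x hx => ?_, fun _ _ => id⟩
    cases x <;> simp_all [IsLocal]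
  set τ' := (τ.setReg (.old false) (t false).loose.toNat).setReg (.old true)
    (t true).loose.toNat with hτ'
  have ho : ∀ s, τ'.reg (.old s) = (t s).loose.toNat := by
    intro s
    cases s <;> simp [hτ']
  have hr' : TRep τ' g t := hr.of_arr rfl
  have hI'' : FixedRep τ' I := hI'
  have hg'' : τ'.reg .g = g := by simp [hτ', hg']
  have hp' : τ'.reg .p = p := by simp [hτ', hp]
  have hq' : τ'.reg .q = γ.symm p := by simp [hτ', hq]
  have hin'' : τ'.reg .infeas = 0 := by simp [hτ', hin']
  have hidx' : τ'.arr .idx g 0 = k + 1 := hidx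
  have hS'' : StackInv τ' I Q S := hS'.of_eq (fun _ _ => rfl) (by simp [hτ'])
  have hF := hf.trans hf'
  clear_value τ'
  refine WP.seq ((extendOld_spec hg'' hI'' hr' ht.wf hp' hq' hpq (ho false) fun hl =>
    ht.wf.empty_of_not_known hex hl).mono ?_)
  rintro τ₁ T₁ ⟨t₁, bad₁, hrel₁, h₁⟩
  have hw₁ := ht.wf.extend_first hpq hex hrel₁
  refine WP.seq ((extendOld_spec ((h₁.frame.reg .g id).trans hg'')
    (h₁.frame.fixedRep not_isTreeArr_fixed hI'') h₁.rep hw₁ ((h₁.frame.reg .p id).trans hp')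
    ((h₁.frame.reg .q id).trans hq') hpq ((h₁.frame.reg (.old true) id).trans (ho true)) fun hl =>
    ht.wf.empty_of_not_known_second hpq hex hl hrel₁).mono ?_)
  rintro τ₂ T₂ ⟨t₂, bad₂, hrel₂, h₂⟩
  obtain ⟨hw, h0, h1⟩ := ht.extend hpk hpq hex hrel₁ hrel₂
  have hf₂ := h₁.frame.trans h₂.frame
  refine (pushRoots_outcome ((hf₂.reg .g id).trans hg'') h₂.rep hw
    (hS''.frame hf₂ (fun a ha => ha.not_isTreeArr) id) hQ (bad := bad₁ || bad₂) ?_ h0 h1).mono ?_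
  · rw [h₂.infeas, h₁.infeas, hin'']
    cases bad₁ <;> cases bad₂ <;> rfl
  rintro τ₃ T₃ ⟨hT₃, hf₃, hr₃, hout, hS₃⟩
  have hf₂' : StackFrame IsIndexArr IsLocal g τ' τ₂ :=
    (hf₂.toStackFrame (fun h => IsStackArr.not_isTreeArr (a := .inStack) trivial h)
      fun r hr => hr.isLocal).mono (fun a ha => Or.inl ha) fun _ => id
  have hnt : ¬ IsTreeArr .idx := fun ⟨_, h⟩ => h
  refine ⟨t₂, ?_, (hF.trans hf₂').trans (hf₃.mono (fun _ => False.elim) fun _ => id), ?_, hr₃,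
    hout, hS₃⟩
  · have e1 := h₁.time
    have e2 := h₂.time
    simp
    omega
  · rw [hf₃.arr .idx g id False.elim, hf₂.arr .idx g fun h => absurd h hnt, hidx']

end Tree

end Symresack

/-! # The whole program -/

namespace Symresack

variable {n m : ℕ} {σ τ υ : Mem Reg Arr} {t : Fin m → ITree n} {T : ITree n}
  {I J : Fixings n} {Q : Fin n × Bool → Prop} {S : List (Fin n × Bool)}
  {γ : Fin m → Equiv.Perm (Fin n)} {k : Fin m → ℕ} {g : Fin m}

/-- The memory stores the sizes, the permutations, the fixings, the indices and the trees. -/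
structure GlobalRep (γ : Fin m → Equiv.Perm (Fin n)) (I : Fixings n) (k : Fin m → ℕ)
    (t : Fin m → ITree n) (σ : Mem Reg Arr) : Prop where
  entries : σ.reg .n = n
  perms : σ.reg .m = m
  perm : ∀ (g : Fin m) (i : Fin n), σ.arr .perm g i = γ g i
  inv : ∀ (g : Fin m) (i : Fin n), σ.arr .inv g i = (γ g).symm i
  fixed : FixedRep σ I
  idx : ∀ g : Fin m, σ.arr .idx g 0 = k g
  trees : ∀ g : Fin m, TRep σ g (t g)

theorem GlobalRep.of_eq (h : GlobalRep γ I k t σ) (ha : τ.arr = σ.arr)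
    (hn : τ.reg .n = σ.reg .n) (hm : τ.reg .m = σ.reg .m) : GlobalRep γ I k t τ :=
  ⟨hn.trans h.entries, hm.trans h.perms, by rw [ha]; exact h.perm, by rw [ha]; exact h.inv,
    fun b i => by rw [ha]; exact h.fixed b i, by rw [ha]; exact h.idx,
    fun g => (h.trees g).of_arr ha⟩

/-- A command that updates the tree and the index of one permutation. -/
theorem GlobalRep.update (h : GlobalRep γ I k t σ)
    (hf : StackFrame Tree.IsIndexArr IsLocal g σ τ) (hr : TRep τ g T) {k' : ℕ}
    (hk : τ.arr .idx g 0 = k') :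
    GlobalRep γ I (Function.update k g k') (Function.update t g T) τ := by
  have hnt : ∀ {a : Arr}, (∀ s, ¬ IsBranchArr s a) → a ≠ .idx → ¬ Tree.IsIndexArr a := by
    rintro a h1 h2 (⟨s, h⟩ | h)
    · exact h1 s h
    · exact h2 h
  have hfix : ¬ Tree.IsIndexArr .fixed := hnt (fun _ => id) (by simp)
  have hperm : ¬ Tree.IsIndexArr .perm := hnt (fun _ => id) (by simp)
  have hinv : ¬ Tree.IsIndexArr .inv := hnt (fun _ => id) (by simp)
  refine ⟨(hf.reg .n id).trans h.entries, (hf.reg .m id).trans h.perms, fun g' i => ?_, fun g' i => ?_,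
    hf.fixedRep hfix h.fixed, fun g' => ?_, fun g' s => ?_⟩
  · rw [hf.arr .perm g' id fun h => absurd h hperm, h.perm]
  · rw [hf.arr .inv g' id fun h => absurd h hinv, h.inv]
  · by_cases hg : g' = g
    · subst hg
      simpa using hk
    · rw [Function.update_of_ne hg, ← h.idx,
        hf.arr .idx g' id fun _ h => hg (Fin.ext h)]
  · by_cases hg : g' = g
    · subst hg
      simpa using hr s
    · rw [Function.update_of_ne hg]
      exact hf.rep_row (h.trees g' s) fun h => hg (Fin.ext h)

/-- The number of slots of all trees. -/
def totalSize (t : Fin m → ITree n) : ℕ := ∑ g, (t g).size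

theorem sum_update_add {f : Fin m → ℕ} (g : Fin m) (v : ℕ) :
    ∑ j, Function.update f g v j + f g = ∑ j, f j + v := by
  rw [Finset.sum_update_of_mem (Finset.mem_univ g), ← Finset.add_sum_erase _ f (Finset.mem_univ g),
    Finset.sdiff_singleton_eq_erase]
  omega

theorem totalSize_update : totalSize (Function.update t g T) + (t g).size = totalSize t + T.size := by
  have : (fun j => (Function.update t g T j).size) =
      Function.update (fun j => (t j).size) g T.size := by
    funext j
    by_cases h : j = g
    · subst h; simp
    · simp [h]
  unfold totalSize
  rw [this]
  exact sum_update_add (f := fun j => (t j).size) g T.size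

/-- One of the permutations is found to have no feasible vector. -/
def Infeasible (γ : Fin m → Equiv.Perm (Fin n)) (I : Fixings n) (k : Fin m → ℕ) : Prop :=
  ∃ g, InfConj (γ g) I (k g) ∅

/-- The fixing `f` must be applied. -/
def Implied (γ : Fin m → Equiv.Perm (Fin n)) (I : Fixings n) (k : Fin m → ℕ)
    (f : Fin n × Bool) : Prop :=
  ∃ g, InfConj (γ g) I (k g) {conv f}

theorem Implied.mono (h : Implied γ I k f) (hI : I ≤ J) {k' : Fin m → ℕ} (hk : k ≤ k') :
    Implied γ J k' f :=
  let ⟨g, hg⟩ := h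
  ⟨g, hg.anti hI (hk g)⟩

/-- All trees are consistent. -/
def Consistent (γ : Fin m → Equiv.Perm (Fin n)) (I : Fixings n) (k : Fin m → ℕ)
    (t : Fin m → ITree n) (σ : Mem Reg Arr) : Prop :=
  ∀ g, TreeInv (γ g) I (k g) (t g) ∧ ∀ s, BranchFlagged σ (t g s)

/-- Either all trees are consistent, or infeasibility has been found. -/
def Outcome (γ : Fin m → Equiv.Perm (Fin n)) (I : Fixings n) (k : Fin m → ℕ)
    (t : Fin m → ITree n) (σ : Mem Reg Arr) : Prop :=
  (σ.reg .infeas = 0 ∧ Consistent γ I k t σ) ∨ (σ.reg .infeas = 1 ∧ Infeasible γ I k)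

namespace Tree

/-- Induction on the number of remaining rounds. Besides the body, a round takes 7 steps: 4 for the
test and 3 for the increment of the counter. The last 4 steps are the failing test. -/
theorem loop_forEach_spec {x : Reg} {bound : E} {body : C} {m : ℕ} (Inv : ℕ → Mem Reg Arr → ℕ → Prop)
    (hb : bound.cost = 1) (hx : ∀ j σ T, Inv j σ T → σ.reg x = j ∧ bound.eval σ = m)
    (hstep : ∀ j < m, ∀ σ T, Inv j σ T →
      WP body σ fun τ u => Inv (j + 1) (τ.setReg x (τ.reg x + 1)) (T + (u + 7)))
    {j T : ℕ} (hj : j ≤ m) {σ : Mem Reg Arr} (h : Inv j σ T) :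
    WP (.loop (.lt (r x) bound) (block [body, .assign x (.succ (r x))])) σ
      fun τ u => ∃ T', Inv m τ T' ∧ T + u = T' + 4 := by
  obtain ⟨d, hd⟩ := Nat.exists_eq_add_of_le hj
  induction d generalizing j σ T with
  | zero =>
    obtain ⟨h1, h2⟩ := hx _ _ _ h
    obtain rfl : j = m := by omega
    refine WP.loop_false (by simp [Expr.eval, r, h1, h2]) ⟨T, h, ?_⟩
    simp [Expr.cost, r, hb]
  | succ d ih =>
    obtain ⟨h1, h2⟩ := hx _ _ _ h
    refine WP.loop_true (by simp [Expr.eval, r, h1, h2]; omega) (WP.seq ((hstep j (by omega) σ T h).mono ?_))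
    intro τ u h'
    refine WP.assign ?_
    refine (ih (j := j + 1) (by omega) h' (by omega)).mono ?_
    rintro υ w ⟨T', hT', he⟩
    refine ⟨T', hT', ?_⟩
    simp only [Expr.cost, r, hb]
    omega

/-- The rule for loops with a counter; the invariant is about the number of past iterations, the
memory and the time. -/
theorem forEach_spec {x : Reg} {bound : E} {body : C} {m : ℕ} (Inv : ℕ → Mem Reg Arr → ℕ → Prop)
    (hb : bound.cost = 1) (hx : ∀ j σ T, Inv j σ T → σ.reg x = j ∧ bound.eval σ = m)
    (h0 : Inv 0 (σ.setReg x 0) 2)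
    (hstep : ∀ j < m, ∀ σ T, Inv j σ T →
      WP body σ fun τ u => Inv (j + 1) (τ.setReg x (τ.reg x + 1)) (T + (u + 7))) :
    WP (forEach x bound body) σ fun τ u => ∃ T, Inv m τ T ∧ u = T + 4 := by
  refine WP.seq (WP.assign ?_)
  exact (loop_forEach_spec Inv hb hx hstep (Nat.zero_le m) h0).mono fun τ u h => h

/-- The update of the trees when a fixing is applied. -/
theorem fixTrees_spec {i : Fin n} {b : Bool} (hG : GlobalRep γ (applyFixing I (i, b)) k t σ)
    (hC : Consistent γ I k t σ) (hi : σ.reg .i = i) (hb : σ.reg .b = b.toNat)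
    (hI : ¬ Fixed I i) (hin : σ.reg .infeas = 0)
    (hS : StackInv σ (applyFixing I (i, b)) (Implied γ (applyFixing I (i, b)) k) S) :
    WP (forEach .g (r .m) (.ite (r .infeas) .skip fixTree)) σ fun τ u => ∃ t' S',
      u + 40 * totalSize t' ≤ 40 * totalSize t + 2100 * m + 6 ∧
      τ.reg .cur = σ.reg .cur ∧ GlobalRep γ (applyFixing I (i, b)) k t' τ ∧
      StackInv τ (applyFixing I (i, b)) (Implied γ (applyFixing I (i, b)) k) S' ∧
      Outcome γ (applyFixing I (i, b)) k t' τ := by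
  set I' := applyFixing I (i, b) with hI'
  -- The array `fixed` already holds the new fixings, but only the trees before `j` have been
  -- updated; the others are consistent with the old fixings `I`. After infeasibility the remaining
  -- trees are skipped and may stay outdated.
  let Inv (j : ℕ) (τ : Mem Reg Arr) (T : ℕ) : Prop :=
    τ.reg .g = j ∧ τ.reg .i = i ∧ τ.reg .b = b.toNat ∧ τ.reg .cur = σ.reg .cur ∧
    ∃ t' S', T + 40 * totalSize t' ≤ 40 * totalSize t + 2100 * j + 2 ∧
      GlobalRep γ I' k t' τ ∧ StackInv τ I' (Implied γ I' k) S' ∧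
      ((τ.reg .infeas = 0 ∧ ∀ g : Fin m, (g.val < j → TreeInv (γ g) I' (k g) (t' g)) ∧
          (j ≤ g.val → TreeInv (γ g) I (k g) (t' g)) ∧ ∀ s, BranchFlagged τ (t' g s)) ∨
        (τ.reg .infeas = 1 ∧ Infeasible γ I' k))
  refine (forEach_spec (m := m) Inv rfl ?_ ?_ ?_).mono ?_
  · rintro j τ T ⟨h1, -, -, -, t', S', -, h2, -⟩
    exact ⟨h1, h2.perms⟩
  · refine ⟨by simp, by simp [hi], by simp [hb], by simp, t, S, by omega, hG.of_eq rfl ?_ ?_,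
      hS.of_eq (fun _ _ => rfl) (by simp), Or.inl ⟨by simp [hin], fun g =>
        ⟨fun h => absurd h (Nat.not_lt_zero _), fun _ => (hC g).1, (hC g).2⟩⟩⟩
    · simp
    · simp
  · rintro j hj τ T ⟨h1, h2, h3, h4, t', S', h5, h6, h7, h8⟩
    refine WP.ite (fun hc => WP.skip ?_) fun hc => ?_
    · rcases h8 with ⟨h8, -⟩ | ⟨h8, h9⟩
      · exact absurd h8 hc
      · refine ⟨by simp [h1], by simp [h2], by simp [h3], by simp [h4], t', S', ?_,
          h6.of_eq rfl (by simp) (by simp), h7.of_eq (fun _ _ => rfl) (by simp),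
          Or.inr ⟨by simp [h8], h9⟩⟩
        simp only [Expr.cost, r]
        omega
    · rcases h8 with ⟨h8, h9⟩ | ⟨h8, -⟩
      swap
      · exact absurd hc (by simp [Expr.eval, r, h8])
      set g : Fin m := ⟨j, hj⟩ with hg
      refine (fixTree_spec (g := g) h1 (h6.trees g) h2 h3 ((h9 g).2.1 le_rfl) hI h7
        (fun f hf => ⟨g, hf⟩) h8).mono ?_
      rintro υ u ⟨T', hu, hf, hr, ho, S'', hS''⟩
      have hf' : StackFrame IsIndexArr IsLocal g τ υ := hf.mono (fun a ha => Or.inl ha) fun _ => id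
      have hidx : υ.arr .idx g 0 = k g := by
        rw [hf.arr .idx g id fun ⟨_, h⟩ => absurd h id, h6.idx]
      have hG' := h6.update hf' hr hidx
      rw [Function.update_eq_self] at hG'
      have hreg : ∀ x, ¬ IsLocal x → x ≠ .g → (υ.setReg .g (υ.reg .g + 1)).reg x = τ.reg x := by
        intro x hx hxg
        rw [Mem.setReg_reg, if_neg hxg, hf.reg x hx]
      refine ⟨by simp [hf.reg .g id, h1], (hreg .i id (by simp)).trans h2,
        (hreg .b id (by simp)).trans h3, (hreg .cur id (by simp)).trans h4,
        Function.update t' g T', S'', ?_, hG'.of_eq rfl (by simp) (by simp),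
        hS''.of_eq (fun _ _ => rfl) (by simp), ?_⟩
      · have := totalSize_update (t := t') (g := g) (T := T')
        simp only [Expr.cost, r]
        omega
      · rcases ho with ⟨e1, e2, e3⟩ | ⟨e1, e2⟩
        · refine Or.inl ⟨by simp [e1], fun g' => ?_⟩
          by_cases hgg : g' = g
          · subst hgg
            refine ⟨fun _ => by simpa using e2, fun h => ?_, fun s => ?_⟩
            · exact absurd h (by simp [hg])
            · rw [Function.update_self]
              exact e3 s
          · rw [Function.update_of_ne hgg]
            have hne : g'.val ≠ j := fun h => hgg (Fin.ext h)
            exact ⟨fun h => (h9 g').1 (by omega), fun h => (h9 g').2.1 (by omega),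
              fun s v hv hk => hf.inStack _ _ ((h9 g').2.2 s v hv hk)⟩
        · exact Or.inr ⟨by simp [e1], g, e2⟩
  · rintro τ u ⟨T, ⟨h1, h2, h3, h4, t', S', h5, h6, h7, h8⟩, hu⟩
    refine ⟨t', S', by omega, h4, h6, h7, h8.imp_left fun ⟨e1, e2⟩ => ⟨e1, fun g =>
      ⟨(e2 g).1 g.isLt, (e2 g).2.2⟩⟩⟩

end Tree

end Symresack

/-! ### Simulation of the inner loop. -/

namespace Symresack

variable {n m : ℕ} {σ τ υ : Mem Reg Arr} {t : Fin m → ITree n} {T : ITree n}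
  {I J I₀ : Fixings n} {Q : Fin n × Bool → Prop} {S : List (Fin n × Bool)}
  {γ : Fin m → Equiv.Perm (Fin n)} {k : Fin m → ℕ} {g : Fin m}
  {P : Finset (Equiv.Perm (Fin n))} {mode : State n → Config n}

/-- The algorithm reaches the configuration with the fixings `I` and the indices `k`. -/
def Reaches (P : Finset (Equiv.Perm (Fin n))) (I₀ : Fixings n) (γ : Fin m → Equiv.Perm (Fin n))
    (mode : State n → Config n) (I : Fixings n) (k : Fin m → ℕ) : Prop :=
  ∃ s : State n, s.fixings = I ∧ (∀ g, s.idx (γ g) = k g) ∧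
    Relation.ReflTransGen (Step complConditions P) (start I₀) (mode s)

theorem hasEmptyConj_iff (hγ : ∀ δ, δ ∈ P ↔ ∃ g, γ g = δ) {s : State n}
    (hs : ∀ g, s.idx (γ g) = k g) : HasEmptyConj P s ↔ Infeasible γ s.fixings k := by
  simp only [HasEmptyConj, Infeasible, hγ]
  constructor
  · rintro ⟨_, ⟨g, rfl⟩, h⟩
    exact ⟨g, by rwa [hs] at h⟩
  · rintro ⟨g, h⟩
    exact ⟨_, ⟨g, rfl⟩, by rwa [hs]⟩

theorem hasSingleConj_iff (hγ : ∀ δ, δ ∈ P ↔ ∃ g, γ g = δ) {s : State n}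
    (hs : ∀ g, s.idx (γ g) = k g) {f : Fin n × Bool} :
    HasSingleConj P s (conv f) ↔ Implied γ s.fixings k f ∧ f.1 ∉ s.fixings f.2 := by
  simp only [HasSingleConj, Implied, hγ]
  refine and_congr ⟨?_, ?_⟩ (by simp [conv])
  · rintro ⟨_, ⟨g, rfl⟩, h⟩
    exact ⟨g, by rwa [hs] at h⟩
  · rintro ⟨g, h⟩
    exact ⟨_, ⟨g, rfl⟩, by rwa [hs]⟩

theorem Consistent.not_infeasible (h : Consistent γ I k t σ) (hF : (F I).Nonempty) :
    ¬ Infeasible γ I k :=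
  fun ⟨g, hg⟩ => (h g).1.not_infConj_empty hF hg

/-- If the stack is empty, no root has a necessary fixing vertex as child. -/
theorem Consistent.rootFree (h : Consistent γ I k t σ) (hS : StackInv σ I Q []) (g : Fin m) :
    RootFree (t g) := by
  intro s v hv hk
  have h1 := (hS.flagged (v.e, v.v) ((h g).2 s v hv hk)).resolve_left (by simp)
  have h2 := (((h g).1.wf.branch s).dead v (List.mem_of_mem_head? hv)).2 ⟨_, h1⟩
  rw [hk] at h2
  cases h2

theorem Reaches.infeasible (h : Reaches P I₀ γ .inner I k) (hγ : ∀ δ, δ ∈ P ↔ ∃ g, γ g = δ)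
    (hi : Infeasible γ I k) : Returns complConditions P I₀ .infeasible := by
  obtain ⟨s, rfl, hs, h⟩ := h
  exact h.tail (.infeasible s ((hasEmptyConj_iff hγ hs).2 hi))

/-- A fixing that is implied and not yet present is a legal choice of the inner loop, whatever order
the stack imposes. -/
theorem Reaches.fix (h : Reaches P I₀ γ .inner I k) (hγ : ∀ δ, δ ∈ P ↔ ∃ g, γ g = δ)
    (hi : ¬ Infeasible γ I k) {f : Fin n × Bool} (hf : Implied γ I k f) (hl : f.1 ∉ I f.2) :
    Reaches P I₀ γ .inner (applyFixing I f) k ∧ (∀ b, f.1 ∉ I b) ∧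
      (F (applyFixing I f)).Nonempty := by
  obtain ⟨s, rfl, hs, h⟩ := h
  have h1 := mt (hasEmptyConj_iff hγ hs).1 hi
  have h2 := (hasSingleConj_iff hγ hs).2 ⟨hf, hl⟩
  obtain ⟨h3, h4⟩ := h2.unfixed h1
  have h5 := Step.fix (suff := complConditions) s f.1 (!f.2) h1 h2
  simp only [Bool.not_not] at h4 h5
  exact ⟨⟨⟨_, s.idx⟩, rfl, hs, h.tail h5⟩, h3, h4⟩

/-- A necessary vertex at a root is flagged, hence its fixing would be on the stack or already
applied. With an empty stack neither is possible, so all roots are free and no singleton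
inf-conjunction is left to apply. -/
theorem Reaches.leave (h : Reaches P I₀ γ .inner I k) (hγ : ∀ δ, δ ∈ P ↔ ∃ g, γ g = δ)
    (hF : (F I).Nonempty) (hC : Consistent γ I k t σ) (hS : StackInv σ I Q []) :
    Reaches P I₀ γ .outer I k := by
  obtain ⟨s, rfl, hs, h⟩ := h
  refine ⟨s, rfl, hs, h.tail (.leave s ?_ fun f hf => ?_)⟩
  · exact mt (hasEmptyConj_iff hγ hs).1 (hC.not_infeasible hF)
  · rw [← conv_conv f, hasSingleConj_iff hγ hs] at hf
    obtain ⟨⟨g, hg⟩, hl⟩ := hf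
    rw [conv_conv] at hg
    exact (hC g).1.not_infConj_singleton hF (hC.rootFree hS g) hl hg

theorem GlobalRep.fix {i : Fin n} {b : Bool} (h : GlobalRep γ I k t σ)
    (ha : τ.arr = (σ.setArr .fixed b.toNat i 1).arr) (hn : τ.reg .n = σ.reg .n)
    (hm : τ.reg .m = σ.reg .m) : GlobalRep γ (applyFixing I (i, b)) k t τ := by
  refine ⟨hn.trans h.entries, hm.trans h.perms, ?_, ?_, fun c j => ?_, ?_, fun g s => ?_⟩
  · simpa [ha] using h.perm
  · simpa [ha] using h.inv
  · rw [ha, Mem.setArr_arr, mem_applyFixing, ← h.fixed c j]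
    have : c.toNat = b.toNat ∧ (j : ℕ) = i ↔ (j, c) = (i, b) := by
      rw [Prod.ext_iff, and_comm, Fin.val_inj]
      cases b <;> cases c <;> simp
    simp only [true_and, this]
    split_ifs with h1 <;> simp [h1]
  · simpa [ha] using h.idx
  · refine (h.trees g s).of_eq fun a hs => funext fun j => ?_
    rw [ha, Mem.setArr_arr, if_neg]
    rintro ⟨rfl, -⟩
    exact hs

namespace Tree

/-- Induction on the number of unfixed entries, as every applied fixing uses one up. The weight
`4000 * m` of an entry pays for the updates of the `m` trees, about `2100 * m`, and for resetting
`cur`, which raises the last term by at most `200 * m`; `0 < m` absorbs the constants. The final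
alternative says that either the scan restarts or nothing has changed, so that earlier completeness
tests remain usable. -/
theorem propagate_spec (hγ : ∀ δ, δ ∈ P ↔ ∃ g, γ g = δ) (hm : 0 < m)
    (hG : GlobalRep γ I k t σ) (hS : StackInv σ I (Implied γ I k) S) (hO : Outcome γ I k t σ)
    (hF : (F I).Nonempty) (hR : Reaches P I₀ γ .inner I k) :
    WP propagate σ fun τ u => ∃ I' t',
      u + 40 * totalSize t' + 4000 * (m * (unfixed I').card) + 200 * (m - τ.reg .cur) ≤
        40 * totalSize t + 4000 * (m * (unfixed I).card) + 200 * (m - σ.reg .cur) + 10 ∧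
      GlobalRep γ I' k t' τ ∧
      ((τ.reg .infeas = 0 ∧ Consistent γ I' k t' τ ∧ StackInv τ I' (Implied γ I' k) [] ∧
          (F I').Nonempty ∧ Reaches P I₀ γ .outer I' k ∧
          (τ.reg .cur = 0 ∨ τ.reg .cur = σ.reg .cur ∧ I' = I ∧ t' = t)) ∨
        (τ.reg .infeas = 1 ∧ Returns complConditions P I₀ .infeasible)) := by
  generalize hU : (unfixed I).card = U
  unfold propagate
  induction U using Nat.strong_induction_on generalizing σ I t S with
  | _ U ih =>
  rcases hO with ⟨hin, hC⟩ | ⟨hin, hi⟩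
  swap
  · refine WP.loop_false (by simp [Expr.eval, r, hin]) ⟨I, t, ?_, hG,
      Or.inr ⟨hin, hR.infeasible hγ hi⟩⟩
    simp only [Expr.cost, r, hU]
    omega
  rcases List.eq_nil_or_concat S with rfl | ⟨S, ⟨i, b⟩, rfl⟩
  · have hstk := hS.height
    refine WP.loop_false (by simp [Expr.eval, r, hstk]) ⟨I, t, ?_, hG,
      Or.inl ⟨hin, hC, hS, hF, hR.leave hγ hF hC hS, Or.inr ⟨rfl, rfl, rfl⟩⟩⟩
    simp only [Expr.cost, r, hU]
    omega
  rw [List.concat_eq_append] at hS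
  have hstk := hS.height
  have hmem : (i, b) ∈ S ++ [(i, b)] := by simp
  obtain ⟨hR', hunf, hF'⟩ := hR.fix hγ (hC.not_infeasible hF) (hS.implied _ hmem) (hS.live _ hmem)
  obtain ⟨hE, hV⟩ := hS.entry S.length (i, b) (by simp)
  have hcard := card_unfixed_applyFixing hunf
  rw [hU] at hcard
  refine WP.loop_true (by simp [Expr.eval, r, hstk, hin]) (WP.seq (WP.assign (WP.seq (WP.assign
    (WP.seq (WP.assign (WP.seq (WP.store ?_))))))))
  have e0 : (Expr.pred (r .stk)).eval σ = S.length := by simp [Expr.eval, r, hstk]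
  rw [e0]
  have e1 : (Expr.get .stackE (c 0) (r .stk)).eval (σ.setReg .stk S.length) = i := by
    simp [Expr.eval, r, c, hE]
  rw [e1]
  have e2 : (Expr.get .stackV (c 0) (r .stk)).eval ((σ.setReg .stk S.length).setReg .i i) =
      b.toNat := by
    simp [Expr.eval, r, c, hV]
  rw [e2]
  simp only [Expr.eval, r, c, Mem.setReg_reg, reduceCtorEq, if_false, if_true]
  set σ₁ := (((σ.setReg .stk S.length).setReg .i i).setReg .b b.toNat).setArr .fixed b.toNat i 1
    with hσ₁
  have hstack : ∀ a, IsStackArr a → σ₁.arr a = σ.arr a := by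
    intro a ha
    funext x y
    rw [hσ₁, Mem.setArr_arr, if_neg]
    · rfl
    · rintro ⟨rfl, -⟩
      exact ha
  -- The other fixings on the stack stay implied, since inf-conjunctions persist when fixings are
  -- added.
  have hS₁ : StackInv σ₁ (applyFixing I (i, b)) (Implied γ (applyFixing I (i, b)) k) S :=
    (hS.pop hstack (by simp [hσ₁, hstk])).mono fun f hf => hf.mono (le_applyFixing _ _) le_rfl
  have hG₁ : GlobalRep γ (applyFixing I (i, b)) k t σ₁ :=
    hG.fix rfl (by simp [hσ₁]) (by simp [hσ₁])
  have hC₁ : Consistent γ I k t σ₁ := fun g => ⟨(hC g).1, fun s v hv hk => by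
    rw [hstack .inStack trivial]
    exact (hC g).2 s v hv hk⟩
  have hcur₁ : σ₁.reg .cur = σ.reg .cur := by simp [hσ₁]
  have hi₁ : σ₁.reg .i = i := by simp [hσ₁]
  have hb₁ : σ₁.reg .b = b.toNat := by simp [hσ₁]
  have hin₁ : σ₁.reg .infeas = 0 := by simp [hσ₁, hin]
  clear_value σ₁
  refine WP.seq ((fixTrees_spec hG₁ hC₁ hi₁ hb₁ (fun ⟨c, h⟩ => hunf c h) hin₁ hS₁).mono ?_)
  rintro τ u ⟨t', S', hu, hcur, hG', hS', hO'⟩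
  refine WP.assign ?_
  refine (ih _ (by omega) (σ := τ.setReg .cur 0) (I := applyFixing I (i, b)) (t := t') (S := S')
    (hG'.of_eq rfl (by simp) (by simp)) (hS'.of_eq (fun _ _ => rfl) (by simp)) ?_ hF' hR'
    rfl).mono ?_
  · simpa [Outcome, Consistent, BranchFlagged] using hO'
  rintro υ w ⟨I'', t'', hw, hG'', hfin⟩
  refine ⟨I'', t'', ?_, hG'', hfin.imp_left ?_⟩
  · rw [← hcard, Nat.mul_succ]
    simp only [Expr.cost, Mem.setReg_reg, if_true] at hw ⊢
    generalize m * (unfixed I'').card = A at *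
    generalize m * (unfixed (applyFixing I (i, b))).card = A' at *
    omega
  · rintro ⟨a1, a2, a3, a4, a5, a6⟩
    refine ⟨a1, a2, a3, a4, a5, Or.inl ?_⟩
    rcases a6 with h | h
    · exact h
    · simp [h.1]

end Tree

end Symresack

/-! ### Simulation of the outer loop, and its total time. -/

namespace Symresack

variable {n m : ℕ} {σ τ υ : Mem Reg Arr} {t : Fin m → ITree n} {T : ITree n}
  {I J I₀ : Fixings n} {Q : Fin n × Bool → Prop} {S : List (Fin n × Bool)}
  {γ : Fin m → Equiv.Perm (Fin n)} {k : Fin m → ℕ} {g : Fin m}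
  {P : Finset (Equiv.Perm (Fin n))}

theorem Reaches.suff_iff {s : State n} (hs : ∀ g, s.idx (γ g) = k g)
    (hF : (F s.fixings).Nonempty) (hC : Consistent γ s.fixings k t σ)
    (hS : StackInv σ s.fixings Q []) :
    complConditions s (γ g) ↔ TreeComplete (γ g) s.fixings (k g) (t g) := by
  have h := (hC g).1
  rw [← hs g] at h ⊢
  exact h.complConditions_iff hF (hC.rootFree hS g)

theorem Reaches.select (h : Reaches P I₀ γ .outer I k) (hγ : ∀ δ, δ ∈ P ↔ ∃ g, γ g = δ)
    (hinj : Function.Injective γ) (hF : (F I).Nonempty) (hC : Consistent γ I k t σ)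
    (hS : StackInv σ I Q []) (hc : ¬ TreeComplete (γ g) I (k g) (t g)) :
    Reaches P I₀ γ .inner I (Function.update k g (k g + 1)) := by
  obtain ⟨s, rfl, hs, h⟩ := h
  refine ⟨⟨s.fixings, Function.update s.idx (γ g) (s.idx (γ g) + 1)⟩, rfl, fun g' => ?_,
    h.tail (.select s (γ g) ((hγ _).2 ⟨g, rfl⟩) (mt (suff_iff hs hF hC hS).1 hc))⟩
  -- By injectivity, raising the index of the permutation `γ g` changes no index other than that
  -- with number `g`.
  by_cases hg : g' = g
  · subst hg
    simp [hs]
  · simp [hg, hinj.ne hg, hs]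

theorem Reaches.finish (h : Reaches P I₀ γ .outer I k) (hγ : ∀ δ, δ ∈ P ↔ ∃ g, γ g = δ)
    (hF : (F I).Nonempty) (hC : Consistent γ I k t σ) (hS : StackInv σ I Q [])
    (hc : ∀ g, TreeComplete (γ g) I (k g) (t g)) :
    Returns complConditions P I₀ (.feasible I) := by
  obtain ⟨s, rfl, hs, h⟩ := h
  refine h.tail (.finish s fun δ hδ => ?_)
  obtain ⟨g, rfl⟩ := (hγ δ).1 hδ
  exact (suff_iff hs hF hC hS).2 (hc g)

theorem decode_feasible (h : σ.reg .infeas = 0) (hI : FixedRep σ I) :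
    decode n σ = .feasible I := by
  rw [decode, if_pos h]
  congr 1
  funext b
  ext i
  simpa using hI b i

theorem decode_infeasible (h : σ.reg .infeas = 1) : decode n σ = .infeasible := by
  rw [decode, if_neg (by simp [h])]

theorem sum_index_update (hk : k g ≤ n) :
    ∑ j, (n + 1 - Function.update k g (k g + 1) j) + 1 = ∑ j, (n + 1 - k j) := by
  have : (fun j => n + 1 - Function.update k g (k g + 1) j) =
      Function.update (fun j => n + 1 - k j) g (n - k g) := by
    funext j
    by_cases h : j = g
    · subst h; simp
    · simp [h]
  rw [this]
  have : Finset.univ.sum (Function.update (fun j => n + 1 - k j) g (n - k g)) + (n + 1 - k g) =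
      ∑ j, (n + 1 - k j) + (n - k g) := sum_update_add g _
  omega

namespace Tree

theorem eval_complete (hG : GlobalRep γ I k t σ) (hg : σ.reg .g = g)
    (hp : σ.reg .p = k g - 1) (hk : 1 ≤ k g) :
    complete.eval σ ≠ 0 ↔ TreeComplete (γ g) I (k g) (t g) := by
  have hl : ∀ s, (loose s).eval σ = (t g s).loose.toNat := by
    intro s
    simp [loose, at', r, c, Expr.eval, hg, (hG.trees g s).loose]
  have hn : ∀ s, (nonempty s).eval σ ≠ 0 ↔ (t g s).slots ≠ [] := fun s =>
    eval_nonempty hg (hG.trees g s)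
  have hb : ∀ b : Bool, b.toNat = 0 ↔ b = false := by simp
  have hand : ∀ e f : E, (Expr.and e f).eval σ ≠ 0 ↔ e.eval σ ≠ 0 ∧ f.eval σ ≠ 0 := by
    intro e f
    simp [Expr.eval]
  have hor : ∀ e f : E, (Expr.or e f).eval σ ≠ 0 ↔ e.eval σ ≠ 0 ∨ f.eval σ ≠ 0 := by
    intro e f
    rw [Expr.eval]
    split_ifs with h <;> simp [h]
  have hnot : ∀ e : E, (Expr.not e).eval σ ≠ 0 ↔ e.eval σ = 0 := by
    intro e
    simp [Expr.eval]
  have hlt : ∀ e f : E, (Expr.lt e f).eval σ ≠ 0 ↔ e.eval σ < f.eval σ := by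
    intro e f
    simp [Expr.eval]
  have hidx : (at' .idx (c 0)).eval σ = k g := by
    simp [at', r, c, Expr.eval, hg, hG.idx]
  have hrn : (r .n).eval σ = n := hG.entries
  unfold complete
  rw [hor, hor]
  -- Past the last index the register `p` is no entry, so the remaining tests may read meaningless
  -- places; their values do not matter, since the second test succeeds.
  by_cases hkn : n < k g
  · exact iff_of_true (Or.inr (Or.inl ((hlt _ _).2 (by rwa [hrn, hidx])))) (Or.inr (Or.inl hkn))
  obtain ⟨p, hpk⟩ : ∃ p : Fin n, p.val + 1 = k g := ⟨⟨k g - 1, by omega⟩, by simp; omega⟩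
  have hrp : (r .p).eval σ = p := by
    rw [r, Expr.eval, hp, ← hpk, Nat.add_sub_cancel]
  have hinv : (at' .inv (r .p)).eval σ = (γ g).symm p := by
    rw [at', Expr.eval, hrp, r, Expr.eval, hg, hG.inv]
  have hperm : (at' .perm (r .p)).eval σ = γ g p := by
    rw [at', Expr.eval, hrp, r, Expr.eval, hg, hG.perm]
  have hfix : ∀ (b : Bool) (e : E) (i : Fin n), e.eval σ = i →
      ((Expr.get .fixed (c b.toNat) e).eval σ = 0 ↔ i ∉ I b) := by
    intro b e i he
    rw [← hG.fixed, not_not, Expr.eval, he]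
    rfl
  refine or_congr ?_ (or_congr ?_ ?_)
  · rw [hand, hnot, hnot, hl, hl, hb, hb, forall_bool false]
    rfl
  · rw [hlt, hrn, hidx]
  · rw [hand, hand, hand, hand, hand, hor, hor, hnot, hnot, hnot, hnot, hlt, hlt, hl, hl, hb, hb,
      hn, hn]
    refine and_congr ?_ ?_
    · rw [forall_bool false, Bool.not_false]
      cases (t g false).loose <;> cases (t g true).loose <;> simp
    · rw [hrp, hinv, hperm, show (c 0 : E) = c false.toNat from rfl,
        show (c 1 : E) = c true.toNat from rfl, hfix false _ p hrp, hfix true _ _ hinv,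
        Fin.val_fin_lt, Fin.val_fin_lt]
      constructor
      · rintro ⟨⟨h1, h2⟩, h3, h4⟩
        exact ⟨p, hpk, h1, h2, h3, h4⟩
      · rintro ⟨p', hp', h1, h2, h3, h4⟩
        obtain rfl : p' = p := Fin.ext (by omega)
        exact ⟨⟨h1, h2⟩, h3, h4⟩

theorem cost_complete : complete.cost ≤ 100 := by decide

/-- Induction on the potential: slots, unfixed entries, permutations not yet passed by `cur`, and
index increments left. Passing a permutation frees 200, more than its completeness test costs; an
index increment frees 4000, which covers the test and the amortized cost of the event. At the end
all permutations have been passed, so all trees satisfy the conditions at the same time. -/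
theorem mainLoop_spec (hγ : ∀ δ, δ ∈ P ↔ ∃ g, γ g = δ) (hinj : Function.Injective γ)
    (hG : GlobalRep γ I k t σ) (hin : σ.reg .infeas = 0) (hC : Consistent γ I k t σ)
    (hS : StackInv σ I (Implied γ I k) []) (hF : (F I).Nonempty)
    (hR : Reaches P I₀ γ .outer I k) (hk : ∀ g, 1 ≤ k g) (hcur : σ.reg .cur ≤ m)
    (hc : ∀ g : Fin m, g.val < σ.reg .cur → TreeComplete (γ g) I (k g) (t g)) :
    WP (.loop (.and (.lt (r .cur) (r .m)) (.not (r .infeas)))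
      (block [
        .assign .g (r .cur),
        .assign .p (.pred (at' .idx (c 0))),
        .ite complete
          (.assign .cur (.succ (r .cur)))
          (block [indexEvent, propagate])])) σ fun τ u =>
      u ≤ 40 * totalSize t + 4000 * (m * (unfixed I).card) + 200 * (m - σ.reg .cur) +
        4000 * ∑ g, (n + 1 - k g) + 20 ∧ Returns complConditions P I₀ (decode n τ) := by
  generalize hN : 40 * totalSize t + 4000 * (m * (unfixed I).card) + 200 * (m - σ.reg .cur) +
    4000 * ∑ g, (n + 1 - k g) = N
  induction N using Nat.strong_induction_on generalizing σ I k t with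
  | _ N ih =>
  by_cases hlt : σ.reg .cur < m
  swap
  · refine WP.loop_false (by simp [Expr.eval, r, hG.perms, hlt]) ⟨?_, ?_⟩
    · simp only [Expr.cost, r]
      omega
    · rw [decode_feasible hin hG.fixed]
      exact hR.finish hγ hF hC hS fun g => hc g (by omega)
  set g : Fin m := ⟨σ.reg .cur, hlt⟩ with hg
  refine WP.loop_true (by simp [Expr.eval, r, hG.perms, hlt, hin]) (WP.seq (WP.assign
    (WP.seq (WP.assign ?_))))
  have e1 : (Expr.pred (at' .idx (c 0))).eval (σ.setReg .g ((r .cur).eval σ)) = k g - 1 := by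
    have : σ.arr .idx (σ.reg .cur) 0 = k g := hG.idx g
    simp [Expr.eval, at', r, c, this]
  rw [e1]
  have e2 : (r .cur).eval σ = g := rfl
  rw [e2]
  have hG₁ : GlobalRep γ I k t ((σ.setReg .g g).setReg .p (k g - 1)) :=
    hG.of_eq rfl (by simp) (by simp)
  have hC₁ : Consistent γ I k t ((σ.setReg .g g).setReg .p (k g - 1)) := hC
  have hS₁ : StackInv ((σ.setReg .g g).setReg .p (k g - 1)) I (Implied γ I k) [] :=
    hS.of_eq (fun _ _ => rfl) (by simp)
  have hin₁ : ((σ.setReg .g g).setReg .p (k g - 1)).reg .infeas = 0 := by simp [hin]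
  have hcur₁ : ((σ.setReg .g g).setReg .p (k g - 1)).reg .cur = g := by simp [hg]
  have hg₁ : ((σ.setReg .g g).setReg .p (k g - 1)).reg .g = g := by simp
  have hp₁ : ((σ.setReg .g g).setReg .p (k g - 1)).reg .p = k g - 1 := by simp
  generalize (σ.setReg .g g).setReg .p (k g - 1) = σ₁ at *
  have hgc : g.val = σ.reg .cur := rfl
  have hcost := cost_complete
  have hcomp := eval_complete hG₁ hg₁ hp₁ (hk g)
  refine WP.ite (fun hcc => WP.assign ?_) fun hcc => ?_
  · rw [hcomp] at hcc
    have e3 : (Expr.succ (r .cur)).eval σ₁ = g + 1 := by simp [Expr.eval, r, hcur₁]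
    rw [e3]
    refine (ih _ ?_ (σ := σ₁.setReg .cur (g + 1)) (hG₁.of_eq rfl (by simp) (by simp))
      (by simpa using hin₁) hC₁ (hS₁.of_eq (fun _ _ => rfl) (by simp)) hF hR hk
      (by simp) (fun g' hg' => ?_) rfl).mono ?_
    · simp only [Mem.setReg_reg, if_true]
      omega
    · simp only [Mem.setReg_reg, if_true] at hg'
      by_cases h : g' = g
      · rw [h]
        exact hcc
      · exact hc g' (by have : g'.val ≠ g.val := fun h' => h (Fin.ext h'); omega)
    · rintro τ u ⟨hu, hret⟩
      refine ⟨?_, hret⟩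
      simp only [Mem.setReg_reg, if_true] at hu
      simp only [Expr.cost, r, at', c]
      omega
  · have hcc' : ¬ TreeComplete (γ g) I (k g) (t g) := fun h => hcomp.2 h hcc
    have hkn : k g ≤ n := by
      by_contra h
      exact hcc' (Or.inr (Or.inl (by omega)))
    obtain ⟨p, hpk⟩ : ∃ p : Fin n, p.val + 1 = k g :=
      ⟨⟨k g - 1, by have := hk g; omega⟩, by have := hk g; simp; omega⟩
    have hle : k ≤ Function.update k g (k g + 1) := by
      intro j
      by_cases hj : j = g
      · subst hj; simp
      · simp [hj]
    refine WP.seq ((indexEvent_spec (g := g) (Q := Implied γ I (Function.update k g (k g + 1)))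
      hg₁ hG₁.fixed (hG₁.trees g) (hC₁ g).1
      (hG₁.idx g) hpk (hG₁.inv g p) hcc' (hC₁ g).2 (hS₁.mono fun f hf => hf.mono le_rfl hle)
      (fun f hf => ⟨g, by simpa using hf⟩) hin₁).mono ?_)
    rintro τ u ⟨T, hu, hf, hidx, hr, ho, S', hS'⟩
    have hsum := sum_index_update hkn
    have hsize := totalSize_update (t := t) (g := g) (T := T)
    have hcurτ : τ.reg .cur = g := (hf.reg .cur id).trans hcur₁
    have hO : Outcome γ I (Function.update k g (k g + 1)) (Function.update t g T) τ := by
      rcases ho with ⟨h1, h2, h3⟩ | ⟨h1, h2⟩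
      · refine Or.inl ⟨h1, fun g' => ?_⟩
        by_cases h : g' = g
        · rw [h, Function.update_self, Function.update_self]
          exact ⟨h2, h3⟩
        · rw [Function.update_of_ne h, Function.update_of_ne h]
          exact ⟨(hC₁ g').1, fun s => ((hC₁ g').2 s).mono hf⟩
      · exact Or.inr ⟨h1, g, by simpa using h2⟩
    refine (propagate_spec hγ (by omega) (hG₁.update hf hr hidx) hS' hO hF
      (hR.select hγ hinj hF hC hS hcc')).mono ?_
    rintro υ w ⟨I', t', hw, hG', hfin⟩
    rcases hfin with ⟨hin', hC', hS'', hF', hR', hcur'⟩ | ⟨hin', hret⟩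
    · refine (ih _ ?_ hG' hin' hC' hS'' hF' hR' (fun j => (hk j).trans (hle j)) ?_
        (fun g' hg' => ?_) rfl).mono ?_
      · omega
      · rcases hcur' with h | h
        · omega
        · omega
      -- Without a fixing, only the tree and the index at position `cur` have changed, so the
      -- permutations before it still satisfy the conditions.
      · rcases hcur' with h | ⟨h1, rfl, rfl⟩
        · omega
        · have h : g' ≠ g := by
            rintro rfl
            omega
          rw [Function.update_of_ne h, Function.update_of_ne h]
          exact hc g' (by omega)
      · rintro ν x ⟨hx, hret⟩
        refine ⟨?_, hret⟩
        simp only [Expr.cost, r, at', c]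
        omega
    · refine WP.loop_false (by simp [Expr.eval, r, hin']) ⟨?_, ?_⟩
      · simp only [Expr.cost, r, at', c]
        omega
      · rw [decode_infeasible hin']
        exact hret

end Tree

end Symresack

/-! ### Initialization and the complete program. -/

namespace Symresack

variable {n m : ℕ} {σ τ υ : Mem Reg Arr} {I : Fixings n} {γ : Fin m → Equiv.Perm (Fin n)}

namespace Tree

theorem checkFixings_spec (hI : FixedRep σ I) (hn : σ.reg .n = n) (hin : σ.reg .infeas = 0) :
    WP (forEach .i (r .n)
      (.ite (.and (.get .fixed (c 0) (r .i)) (.get .fixed (c 1) (r .i)))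
        (.assign .infeas (c 1)) .skip)) σ fun τ u => u ≤ 30 * n + 6 ∧ τ.arr = σ.arr ∧
      (∀ x, x ≠ .i → x ≠ .infeas → τ.reg x = σ.reg x) ∧
      ((τ.reg .infeas = 0 ∧ (F I).Nonempty) ∨ (τ.reg .infeas = 1 ∧ F I = ∅)) := by
  let Inv (j : ℕ) (τ : Mem Reg Arr) (T : ℕ) : Prop :=
    τ.reg .i = j ∧ T ≤ 30 * j + 2 ∧ τ.arr = σ.arr ∧
    (∀ x, x ≠ .i → x ≠ .infeas → τ.reg x = σ.reg x) ∧
    ((τ.reg .infeas = 0 ∧ ∀ i : Fin n, i.val < j → ¬ (i ∈ I false ∧ i ∈ I true)) ∨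
      (τ.reg .infeas = 1 ∧ F I = ∅))
  refine (forEach_spec (m := n) Inv rfl ?_ ?_ ?_).mono ?_
  · rintro j τ T ⟨h1, -, -, h2, -⟩
    exact ⟨h1, (h2 .n (by simp) (by simp)).trans hn⟩
  · refine ⟨by simp, by omega, rfl, fun x h1 _ => by simp [h1], Or.inl ⟨by simpa using hin, ?_⟩⟩
    exact fun i hi => absurd hi (Nat.not_lt_zero _)
  · rintro j hj τ T ⟨h1, h2, h3, h4, h5⟩
    have hcond : (Expr.and (.get .fixed (c 0) (r .i)) (.get .fixed (c 1) (r .i))).eval τ ≠ 0 ↔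
        (⟨j, hj⟩ : Fin n) ∈ I false ∧ (⟨j, hj⟩ : Fin n) ∈ I true := by
      rw [← hI false, ← hI true]
      simp [Expr.eval, r, c, h1, h3]
    refine WP.ite (fun hc => WP.assign ⟨by simp [h1], ?_, h3, fun x e1 e2 => ?_, Or.inr ⟨?_, ?_⟩⟩)
      fun hc => WP.skip ⟨by simp [h1], ?_, h3, fun x e1 e2 => ?_, ?_⟩
    · simp only [Expr.cost, r, c]
      omega
    · simp [e1, e2, h4]
    · simp [Expr.eval, c]
    · obtain ⟨h6, h7⟩ := hcond.1 hc
      rw [Set.eq_empty_iff_forall_notMem]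
      intro x hx
      have := (hx _ _ h6).symm.trans (hx _ _ h7)
      simp at this
    · simp only [Expr.cost, r, c]
      omega
    · simp [e1, e2, h4]
    · refine h5.imp (fun ⟨h5, h6⟩ => ⟨by simpa using h5, fun i hi => ?_⟩) fun h5 => by simpa using h5
      rcases Nat.lt_succ_iff_lt_or_eq.1 hi with hi | hi
      · exact h6 i hi
      · obtain rfl : i = ⟨j, hj⟩ := Fin.ext hi
        exact fun h => hcond.2 h hc
  · rintro τ u ⟨T, ⟨-, h2, h3, h4, h5⟩, hu⟩
    -- If no entry is fixed to both values, the vector that is 1 exactly at the entries fixed to 1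
    -- respects all fixings.
    refine ⟨by omega, h3, h4, h5.imp_left fun ⟨h5, h6⟩ => ⟨h5, fun i => decide (i ∈ I true), ?_⟩⟩
    rintro (_ | _) i hi
    · simpa using fun h => h6 i i.isLt ⟨hi, h⟩
    · simpa using hi

/-- The arrays that are set up by the initialization. -/
def IsInitArr : Arr → Prop
  | .idx => True
  | .loose false => True
  | .inv => True
  | _ => False

/-- The effect of the initialization of the first `j` permutations. -/
structure InitPost (γ : Fin m → Equiv.Perm (Fin n)) (σ τ : Mem Reg Arr) (j : ℕ) : Prop where
  reg : ∀ x, x ≠ .g → x ≠ .i → τ.reg x = σ.reg x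
  arr : ∀ a, ¬ IsInitArr a → τ.arr a = σ.arr a
  done : ∀ g : Fin m, g.val < j → τ.arr .idx g 0 = 1 ∧ τ.arr (.loose false) g 0 = 1 ∧
    ∀ x, τ.arr .inv g (γ g x) = x

theorem InitPost.setReg {j : ℕ} (h : InitPost γ σ τ j) {x : Reg} (hx : x = .g ∨ x = .i) (v : ℕ) :
    InitPost γ σ (τ.setReg x v) j := by
  refine ⟨fun y h1 h2 => ?_, h.arr, h.done⟩
  rw [Mem.setReg_reg, if_neg, h.reg y h1 h2]
  rintro rfl
  exact hx.elim h1 h2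

theorem InitPost.setArr {j : ℕ} (h : InitPost γ σ τ j) {a : Arr} (ha : IsInitArr a) (i v : ℕ) :
    InitPost γ σ (τ.setArr a j i v) j := by
  refine ⟨h.reg, fun a' ha' => ?_, fun g hg => ?_⟩
  · rw [← h.arr a' ha']
    funext x y
    rw [Mem.setArr_arr, if_neg]
    rintro ⟨rfl, -⟩
    exact ha' ha
  · simpa [hg.ne] using h.done g hg

theorem initTrees_spec (hn : σ.reg .n = n) (hm : σ.reg .m = m)
    (hp : ∀ (g : Fin m) (i : Fin n), σ.arr .perm g i = γ g i) :
    WP (forEach .g (r .m)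
      (block [
        put .idx (c 0) (c 1),
        put (.loose false) (c 0) (c 1),
        forEach .i (r .n) (put .inv (at' .perm (r .i)) (r .i))])) σ fun τ u =>
      u ≤ (30 * n + 40) * m + 6 ∧ InitPost γ σ τ m := by
  let Inv (j : ℕ) (τ : Mem Reg Arr) (T : ℕ) : Prop :=
    τ.reg .g = j ∧ T ≤ (30 * n + 40) * j + 2 ∧ InitPost γ σ τ j
  refine (forEach_spec (m := m) Inv rfl ?_ ?_ ?_).mono ?_
  · rintro j τ T ⟨h1, -, h2⟩
    exact ⟨h1, (h2.reg .m (by simp) (by simp)).trans hm⟩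
  · refine ⟨by simp, by omega, fun x h1 h2 => by simp [h1], fun _ _ => rfl, fun g hg => ?_⟩
    exact absurd hg (Nat.not_lt_zero _)
  · rintro j hj τ T ⟨h1, h2, h3⟩
    set g : Fin m := ⟨j, hj⟩ with hg
    refine WP.seq (WP.store (WP.seq (WP.store ?_)))
    simp only [r, c, Expr.eval, Mem.setArr_reg, h1]
    have h4 := (h3.setArr (a := .idx) trivial 0 1).setArr (a := .loose false) trivial 0 1
    have h5 : ((τ.setArr .idx j 0 1).setArr (.loose false) j 0 1).arr .idx j 0 = 1 := by simp
    have h6 : ((τ.setArr .idx j 0 1).setArr (.loose false) j 0 1).arr (.loose false) j 0 = 1 := by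
      simp
    have h7 : ((τ.setArr .idx j 0 1).setArr (.loose false) j 0 1).reg .g = j := h1
    generalize (τ.setArr .idx j 0 1).setArr (.loose false) j 0 1 = τ₁ at *
    let Inv' (i : ℕ) (υ : Mem Reg Arr) (U : ℕ) : Prop :=
      υ.reg .i = i ∧ U ≤ 30 * i + 2 ∧ υ.reg .g = j ∧ InitPost γ σ υ j ∧ υ.arr .idx j 0 = 1 ∧
        υ.arr (.loose false) j 0 = 1 ∧ ∀ x : Fin n, x.val < i → υ.arr .inv j (γ g x) = x
    refine (forEach_spec (m := n) Inv' rfl ?_ ?_ ?_).mono ?_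
    · rintro i υ U ⟨e1, -, -, e2, -⟩
      exact ⟨e1, (e2.reg .n (by simp) (by simp)).trans hn⟩
    · exact ⟨by simp, by omega, by simpa using h7, h4.setReg (Or.inr rfl) 0, h5, h6,
        fun x hx => absurd hx (Nat.not_lt_zero _)⟩
    · rintro i hi υ U ⟨e1, e2, e3, e4, e5, e6, e7⟩
      refine WP.store ?_
      have e8 : (at' .perm (.reg .i)).eval υ = γ g ⟨i, hi⟩ := by
        have := hp g ⟨i, hi⟩
        rw [← e4.arr .perm id] at this
        rw [← this]
        simp [at', r, Expr.eval, e1, e3, hg]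
      rw [e8]
      simp only [r, Expr.eval, e1, e3]
      refine ⟨by simp [e1], ?_, by simp [e3], (e4.setArr (a := .inv) trivial _ _).setReg (Or.inr rfl) _,
        by simpa using e5, by simpa using e6, fun x hx => ?_⟩
      · simp only [Expr.cost, at', r]
        omega
      -- A permutation sends different entries to different places, so earlier values of the inverse
      -- table are not overwritten.
      · rw [Mem.setReg_arr, Mem.setArr_arr]
        simp only [true_and, Fin.val_inj, EmbeddingLike.apply_eq_iff_eq]
        split_ifs with hxi
        · rw [hxi]
        · refine e7 x ?_
          have : x.val ≠ i := fun h => hxi (Fin.ext h)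
          omega
    · rintro υ u ⟨U, ⟨e1, e2, e3, e4, e5, e6, e7⟩, hu⟩
      refine ⟨by simp [e3], ?_, InitPost.setReg ⟨e4.reg, e4.arr, fun g' hg' => ?_⟩ (Or.inl rfl) _⟩
      · rw [Nat.mul_succ]
        simp only [Expr.cost]
        generalize (30 * n + 40) * j = W at *
        omega
      · rcases Nat.lt_succ_iff_lt_or_eq.1 hg' with h | h
        · exact e4.done g' h
        · obtain rfl : g' = g := Fin.ext h
          exact ⟨e5, e6, fun x => e7 x x.isLt⟩
  · rintro τ u ⟨T, ⟨-, h2, h3⟩, hu⟩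
    exact ⟨by omega, h3⟩

/-- All memory outside the input is 0 at the start, which already represents empty branches, an
empty stack and no flags; only indices, loose ends and inverse tables must be written. As the stack
is empty, its invariant holds for every `Q`. -/
theorem init_spec (γ : Fin m → Equiv.Perm (Fin n)) (I : Fixings n) :
    WP init (encode γ I) fun τ u => u ≤ 30 * n + (30 * n + 40) * m + 12 ∧
      τ.reg .cur = 0 ∧
      GlobalRep γ I (fun _ => 1) (fun _ s => ⟨[], !s⟩) τ ∧
      Consistent γ I (fun _ => 1) (fun _ s => ⟨[], !s⟩) τ ∧
      (∀ Q, StackInv τ I Q []) ∧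
      ((τ.reg .infeas = 0 ∧ (F I).Nonempty) ∨ (τ.reg .infeas = 1 ∧ F I = ∅)) := by
  have hfix : FixedRep (encode γ I) I := by
    intro b i
    cases b <;> simp [encode]
  refine WP.seq ((checkFixings_spec hfix rfl rfl).mono ?_)
  rintro τ u ⟨hu, ha, hr, hin⟩
  have hp : ∀ (g : Fin m) (i : Fin n), τ.arr .perm g i = γ g i := by
    intro g i
    rw [ha]
    simp [encode]
  refine (initTrees_spec (γ := γ) (hr .n (by simp) (by simp)) (hr .m (by simp) (by simp)) hp).mono ?_
  rintro υ w ⟨hw, h⟩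
  have hreg : ∀ x, x ≠ .g → x ≠ .i → x ≠ .infeas → υ.reg x = (encode γ I).reg x :=
    fun x h1 h2 h3 => (h.reg x h1 h2).trans (hr x h2 h3)
  have harr : ∀ a, ¬ IsInitArr a → υ.arr a = (encode γ I).arr a :=
    fun a h1 => (h.arr a h1).trans (by rw [ha])
  refine ⟨by omega, hreg .cur (by simp) (by simp) (by simp), ⟨hreg .n (by simp) (by simp) (by simp),
    hreg .m (by simp) (by simp) (by simp), fun g i => ?_, fun g i => ?_, fun b i => ?_,
    fun g => (h.done g g.isLt).1, fun g s => ⟨by simp, ?_, by simp, by simp, by simp,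
      fun x _ => ?_, ?_⟩⟩, fun g => ⟨treeInv_initial _ _, fun s v hv => ?_⟩, fun Q => ⟨?_, ?_, ?_,
      ?_, ?_, ?_, ?_⟩, ?_⟩
  · rw [h.arr .perm id, hp]
  · have := (h.done g g.isLt).2.2 ((γ g).symm i)
    rwa [Equiv.apply_symm_apply] at this
  · rw [harr .fixed id]
    exact hfix b i
  · rw [harr (.top s) id, harr (.head s) id]
    rfl
  · rw [harr (.kind s) id]
    rfl
  · cases s
    · exact (h.done g g.isLt).2.1
    · rw [harr (.loose true) id]
      rfl
  · simp at hv
  · exact hreg .stk (by simp) (by simp) (by simp)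
  · simp
  · simp
  · simp
  · simp
  · simp
  · intro f hf
    rw [harr .inStack id] at hf
    exact absurd rfl hf
  · rwa [h.reg .infeas (by simp) (by simp)]

/-- The initial potential has at most `4000 * (n * m)` for unfixed entries, the same for the index
increments, and `200 * m` for the scan; there are no slots yet. The initialization adds terms in `n
* m`, `n` and `m` and a constant, all absorbed because `n` and `m` are positive. -/
theorem program_spec {P : Finset (Equiv.Perm (Fin n))} (hγ : ∀ δ, δ ∈ P ↔ ∃ g, γ g = δ)
    (hinj : Function.Injective γ) (hn : 0 < n) (hm : 0 < m) (I : Fixings n) :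
    WP program (encode γ I) fun τ u => u ≤ 20000 * (n * m) ∧
      Returns complConditions P I (decode n τ) := by
  have h1 : n ≤ n * m := Nat.le_mul_of_pos_right n hm
  have h2 : m ≤ n * m := Nat.le_mul_of_pos_left m hn
  refine WP.seq ((init_spec γ I).mono ?_)
  rintro τ u ⟨hu, hcur, hG, hC, hS, hF⟩
  refine WP.seq (WP.assign ?_)
  have h3 : (30 * n + 40) * m = 30 * (n * m) + 40 * m := by ring
  rw [h3] at hu
  have hG' : GlobalRep γ I (fun _ => 1) (fun _ s => ⟨[], !s⟩) (τ.setReg .cur ((c 0).eval τ)) :=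
    hG.of_eq rfl (by simp) (by simp)
  rcases hF with ⟨hin, hF⟩ | ⟨hin, hF⟩
  · have hR : Reaches P I γ .outer I (fun _ => 1) := by
      refine ⟨⟨I, fun _ => 1⟩, rfl, fun _ => rfl, ?_⟩
      rw [start, if_neg hF.ne_empty]
    refine (mainLoop_spec hγ hinj hG' (by simpa using hin) hC
      ((hS _).of_eq (fun _ _ => rfl) (by simp)) hF hR (fun _ => le_rfl) (by simp [Expr.eval, c])
      (by simp [Expr.eval, c])).mono ?_
    rintro υ w ⟨hw, hret⟩
    refine ⟨?_, hret⟩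
    have h4 : m * (unfixed I).card ≤ n * m := by
      rw [Nat.mul_comm n]
      exact Nat.mul_le_mul_left m card_unfixed_le
    simp [totalSize, ITree.size, Expr.eval, c, Nat.mul_comm m n] at hw
    simp only [Expr.cost, c]
    omega
  · refine WP.loop_false (by simp [Expr.eval, r, hin]) ⟨?_, ?_⟩
    · simp only [Expr.cost, r, c]
      omega
    · rw [decode_infeasible (by simpa using hin)]
      rw [Returns, start, if_pos hF]

end Tree

end Symresack

theorem mainTheorem4 :
    -- partial correctness, for any sufficient conditions for completeness
    (∀ (n : ℕ), 0 < n → ∀ (P : Finset (Equiv.Perm (Fin n))) (I : Symresack.Fixings n)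
      (suff : Symresack.State n → Equiv.Perm (Fin n) → Prop), Symresack.IsSufficient suff P →
      ∀ o, Symresack.Returns suff P I o → Symresack.Correct P I o) ∧
    -- with the concrete conditions every execution is finite and every output is correct
    (∀ (n : ℕ), 0 < n → ∀ (P : Finset (Equiv.Perm (Fin n))) (I : Symresack.Fixings n),
      (∀ (N : ℕ) (a : ℕ → Symresack.Config n), a 0 = Symresack.start I →
        (∀ k < N, Symresack.Step Symresack.complConditions P (a k) (a (k + 1))) →
        N ≤ 2 * n * P.card + n + 1) ∧
      ∀ o, Symresack.Returns Symresack.complConditions P I o → Symresack.Correct P I o) ∧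
    -- the implementation with implication trees takes linear time in `n * P.card`
    ∃ K : ℕ, ∀ (n : ℕ), 0 < n → ∀ (P : Finset (Equiv.Perm (Fin n))), P.Nonempty →
      ∀ (e : Fin P.card ≃ P) (I : Symresack.Fixings n),
      ∃ (τ : Symresack.Mem Symresack.Reg Symresack.Arr) (t : ℕ),
        Symresack.Exec Symresack.Tree.program
          (Symresack.encode (fun g => (e g : Equiv.Perm (Fin n))) I) τ t ∧
        t ≤ K * (n * P.card) ∧
        Symresack.Returns Symresack.complConditions P I (Symresack.decode n τ) ∧
        Symresack.Correct P I (Symresack.decode n τ) := by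
  refine ⟨fun n hn P I suff hs o ho => Symresack.correct_of_returns hn hs ho,
    fun n hn P I => ⟨Symresack.steps_le P I, fun o ho =>
      Symresack.correct_of_returns hn (Symresack.isSufficient_complConditions P) ho⟩,
    20000, fun n hn P hP e I => ?_⟩
  obtain ⟨τ, t, hexec, ht, hret⟩ := Symresack.Tree.program_spec
    (γ := fun g => (e g : Equiv.Perm (Fin n))) (P := P)
    -- The enumeration `e` lists every permutation of `P` exactly once, in an arbitrary order.
    (fun δ => ⟨fun hδ => ⟨e.symm ⟨δ, hδ⟩, by simp⟩, by rintro ⟨g, rfl⟩; exact (e g).2⟩)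
    (Subtype.val_injective.comp e.injective) hn hP.card_pos I
  exact ⟨τ, t, hexec, ht, hret,
    Symresack.correct_of_returns hn (Symresack.isSufficient_complConditions P) hret⟩
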